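/- **Setting.** Let $d\ge 2$, $0<q_{\min}\le q_{\max}$, $Q=[q_{\min},q_{\max}]$, $V(x)=|x|^2$ on $\mathbb R^d$, $W(r)=\log r$ if $d=2$ and $W(r)=-r^{-(d-2)}$ if $d\ge 3$, and $k_d=c_d|\mathbb S_{d-1}|$ with $c_2=1$, $c_d=d-2$ for $d\ge3$, so that $\Delta W(|\cdot|)=k_d\delta_0$. Let $g:Q\to(0,\infty)$ be measurable, bounded, and bounded away from $0$ (for instance constant, or monotonic and positive). Let $\nu$ be a probability measure on $Q$, and let $\mu^\star_\nu$ be a minimizer of $$\mathcal I(\mu)=\int q\,g(q)V(x)\,d\mu(q,x)-\iint qq'\,W(|x-x'|)\,d\mu(q,x)\,d\mu(q',x')\in(-\infty,+\infty]$$ among the probability measures $\mu$ on $Q\times\mathbb R^d$ with charge marginal $\nu$. Let $N\ge 1$, $q_1,\dots,q_N\in Q$, let $x_1,\dots,x_N\in\mathbb R^d$ be distinct, and put $$H_N=N\sum_i q_ig(q_i)V(x_i)-\sum_i\sum_{j\ne i}q_iq_jW(|x_i-x_j|),\qquad \tilde\mu_N=\sum_{i}\delta_{(q_i,x_i)},\qquad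 \delta_N=\tilde\mu_N-N\mu^\star_\nu,$$ $$\zeta(q,x)=\frac{q\,g(q)}2V(x)-q\int q'\,W(|x-x'|)\,d\mu^\star_\nu(q',x').$$ If $d=2$, assume that the total charges agree: $\sum_i q_i=N\int_Q q\,d\nu(q)$. Let $x_i'=N^{1/d}x_i$ and $$E_N'(x)=\int qW(|x-x'|)\Big(\sum_{i}\delta_{(q_i,x_i')}-\mu^\star_\nu(q,N^{-1/d}x')\Big),$$ where $\mu^\star_\nu(q,N^{-1/d}x')$ denotes $N$ times the image of $\mu^\star_\nu$ under $(q,x)\mapsto(q,N^{1/d}x)$. For a vector field $F$ with charges $q_i$ at the points $x_i'$ and a function $\chi$ let $$\mathcal E(F,\chi)=\lim_{\eta\to0^+}\Big(\int_{\mathbb R^d\setminus\bigcup_iB(x_i',\eta)}\chi|F|^2\,dx+k_dW(\eta)\sum_i\chi(x_i')q_i^2\Big).$$ **Statement (scaling properties).** The integrals defining the potentials $\int q'W(|x-x'|)\,d\mu^\star_\nu(q',x')$, $x\in\mathbb R^d$, converge absolutely, $\zeta$ is $\mu^\star_\nu$-integrable, and $E_N'$ has a locally integrable gradient $\nabla E_N'$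 in the sense of distributions. The integrals and the limit defining $\mathcal E(\nabla E_N',1)$ exist and are finite, and $$H_N=\begin{cases}\displaystyle N^2\mathcal I(\mu^\star_\nu)+2N\int\zeta\,d\delta_N+\frac1{k_d}\,\mathcal E(\nabla E_N',1)-\frac{\log N}2\sum_{i=1}^Nq_i^2,&d=2,\\[2mm]\displaystyle N^2\mathcal I(\mu^\star_\nu)+2N\int\zeta\,d\delta_N+\frac{N^{1-2/d}}{k_d}\,\mathcal E(\nabla E_N',1),&d\ge3.\end{cases}$$ Moreover there is a measurable, $\nu$-integrable function $c:Q\to\mathbb R$ such that $\zeta_0(q,x)=\zeta(q,x)-c(q)$ vanishes for $\mu^\star_\nu$-almost every $(q,x)$, and $$\int\zeta\,d\delta_N=\int\zeta_0\,d\tilde\mu_N+\Big(\sum_{i}c(q_i)-N\int_Qc\,d\nu\Big).$$ In particular $\int\zeta\,d\delta_N=\int\zeta_0\,d\tilde\mu_N$ when $\nu=\frac1N\sum_i\delta_{q_i}$. -/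

import Mathlib

open MeasureTheory Filter Topology
open scoped ENNReal ContDiff

noncomputable section

namespace HetGas

/-- Positions: `ℝ^d` with its Euclidean norm. -/
abbrev Pos (d : ℕ) : Type := EuclideanSpace ℝ (Fin d)

/-- Charges: the interval `Q = [qmin, qmax]`. -/
abbrev Charge (qmin qmax : ℝ) : Type := ↥(Set.Icc qmin qmax)

variable {d N : ℕ} {qmin qmax : ℝ}

/-- The radial Coulomb kernel: `log r` for `d = 2` and `-1 / r^(d-2)` for `d ≥ 3`. -/
def W (d : ℕ) (r : ℝ) : ℝ := if d = 2 then Real.log r else -(1 / r ^ (d - 2))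

/-- `k_d = c_d |S_{d-1}|` with `c_2 = 1` and `c_d = d - 2` for `d ≥ 3`, so that
`Δ W = k_d δ_0`; `|S_{d-1}|` is the surface measure of the unit sphere of `ℝ^d`. -/
def kd (d : ℕ) : ℝ :=
  (if d = 2 then 1 else (d : ℝ) - 2) * (volume : Measure (Pos d)).toSphere.real Set.univ

/-- The `N`-particle Hamiltonian with confinement `V(x) = |x|^2`. -/
def hamiltonian (g : Charge qmin qmax → ℝ) (q : Fin N → Charge qmin qmax)
    (x : Fin N → Pos d) : ℝ :=
  (N : ℝ) * ∑ i, (q i : ℝ) * g (q i) * ‖x i‖ ^ 2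
    - ∑ i, ∑ j ∈ Finset.univ.erase i, (q i : ℝ) * (q j : ℝ) * W d ‖x i - x j‖

/-- Confinement density `q g(q) V(x)`. -/
def confinement (g : Charge qmin qmax → ℝ) (z : Charge qmin qmax × Pos d) : ℝ :=
  (z.1 : ℝ) * g z.1 * ‖z.2‖ ^ 2

/-- Interaction density `q q' W(|x - x'|)`. -/
def interaction (p : (Charge qmin qmax × Pos d) × (Charge qmin qmax × Pos d)) : ℝ :=
  (p.1.1 : ℝ) * (p.2.1 : ℝ) * W d ‖p.1.2 - p.2.2‖

/-- The intensive energy `∫ q g(q) V dμ - ∫∫ q q' W(|x - x'|) dμ dμ`. -/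
def energy (g : Charge qmin qmax → ℝ) (μ : Measure (Charge qmin qmax × Pos d)) : ℝ :=
  (∫ z, confinement g z ∂μ) - ∫ p, interaction p ∂(μ.prod μ)

/-- The intensive energy of `μ`, which takes values in `(-∞, +∞]`, is finite. Since `-W(0) = +∞`,
a measure of finite energy satisfies `(μ ⊗ μ)(x = x') = 0`; this has to be said explicitly because
`W d 0` is a real number here. -/
def HasFiniteEnergy (g : Charge qmin qmax → ℝ) (μ : Measure (Charge qmin qmax × Pos d)) : Prop :=
  Integrable (confinement g) μ ∧
  (∀ᵐ p ∂(μ.prod μ), p.1.2 ≠ p.2.2) ∧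
  Integrable interaction (μ.prod μ)

/-- `μ` minimizes the intensive energy (equivalently, the rate function) among the measures on
`Q × ℝ^d` whose charge marginal is `ν`. Measures of infinite energy do not compete. -/
def IsEnergyMinimizer (g : Charge qmin qmax → ℝ) (ν : Measure (Charge qmin qmax))
    (μ : Measure (Charge qmin qmax × Pos d)) : Prop :=
  μ.map Prod.fst = ν ∧ HasFiniteEnergy g μ ∧
  ∀ μ' : Measure (Charge qmin qmax × Pos d),
    μ'.map Prod.fst = ν → HasFiniteEnergy g μ' → energy g μ ≤ energy g μ'

/-- The potential `x ↦ ∫ q W(|x - x'|) dm(q, x')` of a double-layer measure. -/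
def potential (m : Measure (Charge qmin qmax × Pos d)) (x : Pos d) : ℝ :=
  ∫ z, (z.1 : ℝ) * W d ‖x - z.2‖ ∂m

/-- `ζ(q, x) = q g(q) V(x) / 2 - q ∫ q' W(|x - x'|) dμ(q', x')`. -/
def zeta (g : Charge qmin qmax → ℝ) (μ : Measure (Charge qmin qmax × Pos d))
    (z : Charge qmin qmax × Pos d) : ℝ :=
  (z.1 : ℝ) * g z.1 / 2 * ‖z.2‖ ^ 2 - (z.1 : ℝ) * potential μ z.2

/-- The unnormalized double-layer empirical measure `∑ i, δ_(q_i, x_i)`. -/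
def pointMeasure (q : Fin N → Charge qmin qmax) (x : Fin N → Pos d) :
    Measure (Charge qmin qmax × Pos d) :=
  ∑ i, Measure.dirac (q i, x i)

/-- The blown-up positions `x_i' = N^(1/d) x_i`. -/
def blowUp (x : Fin N → Pos d) (i : Fin N) : Pos d := (N : ℝ) ^ (1 / (d : ℝ)) • x i

/-- The blown-up background: if `μ` has density `m(q, x)` in `x`, this is the measure of mass `N`
with density `m(q, N^(-1/d) x')` in `x'`. -/
def blowUpMeasure (N : ℕ) (μ : Measure (Charge qmin qmax × Pos d)) :
    Measure (Charge qmin qmax × Pos d) :=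
  (N : ℝ≥0∞) • μ.map (fun z => (z.1, (N : ℝ) ^ (1 / (d : ℝ)) • z.2))

/-- The potential `E_N'` of the blown-up particles in the blown-up background. -/
def rescaledPotential (μ : Measure (Charge qmin qmax × Pos d)) (q : Fin N → Charge qmin qmax)
    (x : Fin N → Pos d) (y : Pos d) : ℝ :=
  potential (pointMeasure q (blowUp x)) y - potential (blowUpMeasure N μ) y

/-- `F = ∇u` in the sense of distributions. -/
def IsWeakGradient (u : Pos d → ℝ) (F : Pos d → Pos d) : Prop :=
  LocallyIntegrable u volume ∧ LocallyIntegrable F volume ∧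
  ∀ φ : Pos d → ℝ, ContDiff ℝ ∞ φ → HasCompactSupport φ → ∀ v : Pos d,
    ∫ y, u y * fderiv ℝ φ y v = - ∫ y, φ y * inner ℝ (F y) v

/-- The complement of the balls of radius `η` around the particles. -/
def perforated (x : Fin N → Pos d) (η : ℝ) : Set (Pos d) := (⋃ i, Metric.ball (x i) η)ᶜ

/-- The `N`-particle heterogeneous renormalized energy `ℰ(F, χ)` of the field `F` with charges
`q_i` at `x_i` exists and equals `L`. -/
def HasRenormalizedEnergy (q : Fin N → Charge qmin qmax) (x : Fin N → Pos d)
    (F : Pos d → Pos d) (χ : Pos d → ℝ) (L : ℝ) : Prop :=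
  (∀ η : ℝ, 0 < η → IntegrableOn (fun y => χ y * ‖F y‖ ^ 2) (perforated x η) volume) ∧
  Tendsto (fun η : ℝ => (∫ y in perforated x η, χ y * ‖F y‖ ^ 2)
      + kd d * W d η * ∑ i, χ (x i) * (q i : ℝ) ^ 2) (𝓝[>] 0) (𝓝 L)

end HetGas

end

open MeasureTheory Filter Topology
open scoped ENNReal ContDiff

noncomputable section

namespace HetGas

/-! Write the empirical measure as `N` times the minimizer plus `δ_N`. The quadratic Hamiltonian
then splits into the energy of the minimizer, a linear term that is exactly `2N ∫ ζ dδ_N`, and minus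
the interaction of `δ_N` with itself without the diagonal (`hamiltonian_eq`, `offDiagonalEnergy`).
It remains to recognise the last term as an electrostatic energy and to rescale it.

The electrostatic identity rests on one exact computation, `integral_inner_ball`. In polar
coordinates around one charge the Jacobian cancels the decay of its field, so along each ray the
product of two Coulomb fields is `c_d` times the derivative of the other potential. Over the ball of
radius `ρ` around the other charge it integrates to `k_d (W ρ - W r)`, `r` being the distance of the
charges. Recentring the ball costs an error that vanishes as `ρ → ∞`, uniformly for charges in a
bounded set (`pairEnergy_estimate`), and Fubini carries the formula to measures
(`tendsto_mutual_energy`). In the square of the full field the terms `k_d W ρ` add up to the square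
of the total charge times `k_d W ρ`: neutrality removes this for `d = 2`, and `W ρ → 0` for `d ≥ 3`.
Near the particles the self-energies are annulus integrals that produce exactly the counterterm `k_d
W η`. Hence the renormalized energy is `-k_d` times the off-diagonal interaction
(`hasRenormalizedEnergy_particleField`). Under dilation by `l` the kernel is homogeneous for `d ≥
3`, and for `d = 2` it gains `log l`; by neutrality only the missing diagonal `-log l ∑ q_i²`
survives (`offDiagonalEnergy_dilate`).

All this needs a minimizer of bounded support whose potential is finite at every point. Both follow
from the first variation (`integral_zeta_le`). Reweighting the minimizer without changing its charge
marginal shows that `ζ` depends only on the charge (`exists_zeta_eq_charge`); spreading some of the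
charges over the unit ball bounds this function of the charge (`charge_constant_le`). As the
confinement is quadratic and the potential grows at most linearly, the support is bounded. The same
inequality bounds the singular part of the potential almost everywhere, and comparison with a
nearest point of a closed set carrying the minimizer gives finiteness everywhere
(`singularPotential_lt_top`). -/

/-! ### The Coulomb kernel, its field and a smooth regularization. -/

/-- The constant `c_d`, so that `W' r = c_d / r ^ (d - 1)`. -/
def cd (d : ℕ) : ℝ := if d = 2 then 1 else (d : ℝ) - 2

/-- The Coulomb field `∇ W(|·|)` of a unit point charge at the origin. -/
def coulombField (d : ℕ) (y : Pos d) : Pos d := (cd d / ‖y‖ ^ d) • y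

/-- A smooth regularization of `W(|·|)`. -/
def regW (d : ℕ) (ε : ℝ) (y : Pos d) : ℝ :=
  if d = 2 then Real.log (‖y‖ ^ 2 + ε) / 2 else -(‖y‖ ^ 2 + ε) ^ (-((d : ℝ) - 2) / 2)

/-- The gradient of `regW`. -/
def regField (d : ℕ) (ε : ℝ) (y : Pos d) : Pos d := (cd d * (‖y‖ ^ 2 + ε) ^ (-(d : ℝ) / 2)) • y

lemma cd_pos {d : ℕ} (hd : 2 ≤ d) : 0 < cd d := by
  unfold cd
  split_ifs with h
  · exact one_pos
  · have : 3 ≤ d := by omega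
    have : (3 : ℝ) ≤ d := by exact_mod_cast this
    linarith

lemma kd_eq (d : ℕ) : kd d = cd d * (volume : Measure (Pos d)).toSphere.real Set.univ := rfl

lemma toSphere_real_univ_pos {d : ℕ} (hd : 2 ≤ d) :
    0 < (volume : Measure (Pos d)).toSphere.real Set.univ := by
  rw [Measure.toSphere_real_apply_univ, finrank_euclideanSpace, Fintype.card_fin]
  have : 0 < (volume : Measure (Pos d)).real (Metric.ball 0 1) :=
    ENNReal.toReal_pos (Metric.measure_ball_pos _ _ one_pos).ne' measure_ball_lt_top.ne
  have : (0 : ℝ) < d := by exact_mod_cast (by omega : 0 < d)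
  positivity

lemma kd_pos {d : ℕ} (hd : 2 ≤ d) : 0 < kd d :=
  mul_pos (cd_pos hd) (toSphere_real_univ_pos hd)

lemma hasDerivAt_W {d : ℕ} (hd : 2 ≤ d) {r : ℝ} (hr : r ≠ 0) :
    HasDerivAt (W d) (cd d / r ^ (d - 1)) r := by
  unfold W cd
  split_ifs with h
  · subst h
    simpa using Real.hasDerivAt_log hr
  · obtain ⟨k, rfl⟩ : ∃ k, d = k + 3 := ⟨d - 3, by omega⟩
    have h1 : k + 3 - 2 = k + 1 := by omega
    have h2 : k + 3 - 1 = k + 2 := by omega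
    rw [h1, h2]
    have := ((hasDerivAt_pow (k + 1) r).inv (pow_ne_zero _ hr)).neg
    simp only [one_div]
    refine this.congr_deriv ?_
    push_cast
    field_simp
    ring

lemma measurable_W (d : ℕ) : Measurable (W d) := by
  unfold W
  split_ifs
  · exact Real.measurable_log
  · fun_prop

/-- A default value of `log` and of division, not the true value `-∞`. It makes the singular
integrand vanish at coinciding points in `isClosed_singularPotential_le`. -/
lemma W_zero {d : ℕ} (hd : 2 ≤ d) : W d 0 = 0 := by
  unfold W
  split_ifs with h
  · simp
  · simp [show d - 2 ≠ 0 by omega]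

lemma measurable_coulombField (d : ℕ) : Measurable (coulombField d) := by
  unfold coulombField; fun_prop

lemma norm_coulombField {d : ℕ} (hd : 2 ≤ d) (y : Pos d) :
    ‖coulombField d y‖ = cd d / ‖y‖ ^ (d - 1) := by
  rcases eq_or_ne y 0 with rfl | hy
  · simp [coulombField, show d - 1 ≠ 0 by omega]
  · have : 0 < ‖y‖ := norm_pos_iff.2 hy
    obtain ⟨k, rfl⟩ : ∃ k, d = k + 1 := ⟨d - 1, by omega⟩
    rw [coulombField, norm_smul, norm_div, norm_pow, norm_norm, Real.norm_of_nonneg (cd_pos hd).le]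
    simp only [Nat.add_sub_cancel]
    field_simp
    ring

lemma regW_zero {d : ℕ} (hd : 2 ≤ d) (y : Pos d) : regW d 0 y = W d ‖y‖ := by
  unfold regW W
  split_ifs with h
  · simp
  · obtain ⟨k, rfl⟩ : ∃ k, d = k + 3 := ⟨d - 3, by omega⟩
    rw [add_zero, ← Real.rpow_natCast ‖y‖ 2, ← Real.rpow_mul (norm_nonneg _), one_div,
      ← Real.rpow_natCast ‖y‖ (k + 3 - 2), ← Real.rpow_neg (norm_nonneg _)]
    congr 2
    rw [show k + 3 - 2 = k + 1 by omega]
    push_cast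
    ring

lemma regField_zero {d : ℕ} (y : Pos d) : regField d 0 y = coulombField d y := by
  unfold regField coulombField
  congr 1
  rw [add_zero, ← Real.rpow_natCast ‖y‖ 2, ← Real.rpow_mul (norm_nonneg _), div_eq_mul_inv (cd d),
      ← Real.rpow_natCast ‖y‖ d, ← Real.rpow_neg (norm_nonneg _)]
  congr 2
  push_cast
  ring

lemma hasFDerivAt_regW {d : ℕ} {ε : ℝ} {y : Pos d} (h : 0 < ‖y‖ ^ 2 + ε) :
    HasFDerivAt (regW d ε) (innerSL ℝ (regField d ε y)) y := by
  have h1 : HasFDerivAt (fun y : Pos d => ‖y‖ ^ 2 + ε) (2 • innerSL ℝ y) y :=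
    (hasStrictFDerivAt_norm_sq y).hasFDerivAt.add_const ε
  unfold regW regField cd
  split_ifs with hd
  · subst hd
    have h2 := ((Real.hasDerivAt_log h.ne').div_const 2).comp_hasFDerivAt y h1
    refine h2.congr_fderiv ?_
    ext v
    simp
    rw [Real.rpow_neg_one]
    ring
  · have h2 := ((Real.hasDerivAt_rpow_const (p := -((d : ℝ) - 2) / 2)
      (Or.inl h.ne')).comp_hasFDerivAt y h1).neg
    refine h2.congr_fderiv ?_
    ext v
    simp
    rw [show -(d : ℝ) / 2 = (2 - (d : ℝ)) / 2 - 1 by ring]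
    ring

lemma hasFDerivAt_W_norm {d : ℕ} (hd : 2 ≤ d) {y : Pos d} (hy : y ≠ 0) :
    HasFDerivAt (fun y : Pos d => W d ‖y‖) (innerSL ℝ (coulombField d y)) y := by
  have : 0 < ‖y‖ := norm_pos_iff.2 hy
  have := hasFDerivAt_regW (d := d) (ε := 0) (y := y) (by positivity)
  rwa [funext (regW_zero hd), regField_zero] at this

lemma continuous_regField {d : ℕ} {ε : ℝ} (h : 0 < ε) : Continuous (regField d ε) := by
  unfold regField
  have : ∀ y : Pos d, ‖y‖ ^ 2 + ε ≠ 0 := fun y => by positivity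
  have h2 : Continuous fun y : Pos d => (‖y‖ ^ 2 + ε) ^ (-(d : ℝ) / 2) :=
    Continuous.rpow_const (by fun_prop) (fun y => Or.inl (this y))
  fun_prop

lemma continuous_regW {d : ℕ} {ε : ℝ} (h : 0 < ε) : Continuous (regW d ε) :=
  continuous_iff_continuousAt.2 fun y => (hasFDerivAt_regW (d := d) (by positivity)).continuousAt

lemma norm_regField_le {d : ℕ} (hd : 2 ≤ d) {ε : ℝ} (h : 0 ≤ ε) (y : Pos d) :
    ‖regField d ε y‖ ≤ ‖coulombField d y‖ := by
  rcases eq_or_ne y 0 with rfl | hy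
  · simp [regField, coulombField]
  · have hy' : 0 < ‖y‖ := norm_pos_iff.2 hy
    have hc := cd_pos hd
    rw [← regField_zero, regField, regField, norm_smul, norm_smul, Real.norm_of_nonneg (by positivity),
      Real.norm_of_nonneg (by positivity)]
    have : (‖y‖ ^ 2 + ε) ^ (-(d : ℝ) / 2) ≤ (‖y‖ ^ 2 + 0) ^ (-(d : ℝ) / 2) :=
      Real.rpow_le_rpow_of_nonpos (by positivity) (by linarith)
        (by have : (0 : ℝ) ≤ d := Nat.cast_nonneg d
            linarith)
    gcongr

/-- An integrable majorant uniform in `ε`. For `d ≥ 3` the modulus decreases with `ε`. The logarithm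
changes sign: it is bounded below by its value at `ε = 0`, and above by `log t ≤ t - 1`, where `ε ≤
1` absorbs the constant and leaves `‖y‖ ^ 2`. -/
lemma norm_regW_le {d : ℕ} (hd : 2 ≤ d) {ε : ℝ} (h : 0 ≤ ε) (h1 : ε ≤ 1) {y : Pos d}
    (hy : y ≠ 0) : ‖regW d ε y‖ ≤ ‖W d ‖y‖‖ + ‖y‖ ^ 2 := by
  have hy' : 0 < ‖y‖ := norm_pos_iff.2 hy
  rw [← regW_zero hd]
  unfold regW
  split_ifs with h2
  · rw [Real.norm_eq_abs, Real.norm_eq_abs, abs_le]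
    have a1 : Real.log (‖y‖ ^ 2 + 0) ≤ Real.log (‖y‖ ^ 2 + ε) :=
      Real.log_le_log (by positivity) (by linarith)
    have a2 : Real.log (‖y‖ ^ 2 + ε) ≤ ‖y‖ ^ 2 + ε - 1 := Real.log_le_sub_one_of_pos (by positivity)
    have a3 := neg_abs_le (Real.log (‖y‖ ^ 2 + 0) / 2)
    constructor <;> nlinarith [abs_nonneg (Real.log (‖y‖ ^ 2 + 0) / 2)]
  · rw [norm_neg, norm_neg, Real.norm_of_nonneg (by positivity), Real.norm_of_nonneg (by positivity)]
    have : (‖y‖ ^ 2 + ε) ^ (-((d : ℝ) - 2) / 2) ≤ (‖y‖ ^ 2 + 0) ^ (-((d : ℝ) - 2) / 2) :=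
      Real.rpow_le_rpow_of_nonpos (by positivity) (by linarith)
        (by have : (2 : ℝ) ≤ d := by exact_mod_cast hd
            linarith)
    nlinarith

lemma tendsto_regW {d : ℕ} (hd : 2 ≤ d) {y : Pos d} (hy : y ≠ 0) :
    Tendsto (fun ε => regW d ε y) (𝓝[>] 0) (𝓝 (W d ‖y‖)) := by
  have hy' : 0 < ‖y‖ := norm_pos_iff.2 hy
  rw [← regW_zero hd]
  have h1 : Tendsto (fun ε : ℝ => ‖y‖ ^ 2 + ε) (𝓝[>] 0) (𝓝 (‖y‖ ^ 2 + 0)) :=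
    tendsto_nhdsWithin_of_tendsto_nhds (by fun_prop : Continuous fun ε : ℝ => ‖y‖ ^ 2 + ε).continuousAt
  have h0 : ‖y‖ ^ 2 + 0 ≠ 0 := by positivity
  unfold regW
  split_ifs
  · exact (h1.log h0).div_const 2
  · exact (h1.rpow_const (Or.inl h0)).neg

lemma tendsto_regField {d : ℕ} {y : Pos d} (hy : y ≠ 0) :
    Tendsto (fun ε => regField d ε y) (𝓝[>] 0) (𝓝 (coulombField d y)) := by
  have hy' : 0 < ‖y‖ := norm_pos_iff.2 hy
  rw [← regField_zero]
  have h1 : Tendsto (fun ε : ℝ => ‖y‖ ^ 2 + ε) (𝓝[>] 0) (𝓝 (‖y‖ ^ 2 + 0)) :=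
    tendsto_nhdsWithin_of_tendsto_nhds (by fun_prop : Continuous fun ε : ℝ => ‖y‖ ^ 2 + ε).continuousAt
  have h0 : ‖y‖ ^ 2 + 0 ≠ 0 := by positivity
  exact ((h1.rpow_const (Or.inl h0)).const_mul _).smul_const _

/-! ### Local integrability and the distributional gradient of the kernel. -/

lemma nontrivial_pos_of_le {d : ℕ} (hd : 2 ≤ d) : Nontrivial (Pos d) := by
  have : Nonempty (Fin d) := ⟨⟨0, by omega⟩⟩
  infer_instance

lemma locallyIntegrable_of_ball {d : ℕ} {E : Type*} [NormedAddCommGroup E] {f : Pos d → E}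
    (h : ∀ r, IntegrableOn f (Metric.ball 0 r) volume) : LocallyIntegrable f volume := fun y =>
  ⟨Metric.ball 0 (‖y‖ + 1), Metric.isOpen_ball.mem_nhds (by simp), h _⟩

lemma integrableOn_ball_of_locallyIntegrable {d : ℕ} {E : Type*} [NormedAddCommGroup E] {f : Pos d → E}
    (h : LocallyIntegrable f volume) (x : Pos d) (r : ℝ) :
    IntegrableOn f (Metric.ball x r) volume :=
  (h.integrableOn_isCompact (isCompact_closedBall x r)).mono_set Metric.ball_subset_closedBall

lemma locallyIntegrable_W_norm {d : ℕ} (hd : 2 ≤ d) :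
    LocallyIntegrable (fun y : Pos d => W d ‖y‖) volume := by
  have := nontrivial_pos_of_le hd
  refine locallyIntegrable_of_ball fun r => ?_
  rw [integrableOn_fun_norm_addHaar volume (f := W d), finrank_euclideanSpace, Fintype.card_fin]
  -- The Jacobian removes the singularity: the radial integrand is `s log s` or `-s`, which is
  -- continuous up to `0`.
  have key : ∃ g : ℝ → ℝ, Continuous g ∧ ∀ s ∈ Set.Ioo 0 r, s ^ (d - 1) • W d s = g s := by
    unfold W
    split_ifs with h
    · subst h
      exact ⟨fun s => s * Real.log s, Real.continuous_mul_log, fun s hs => by simp⟩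
    · refine ⟨fun s => -s, continuous_neg, fun s hs => ?_⟩
      obtain ⟨k, rfl⟩ : ∃ k, d = k + 3 := ⟨d - 3, by omega⟩
      have := hs.1.ne'
      rw [show k + 3 - 1 = k + 2 by omega, show k + 3 - 2 = k + 1 by omega, smul_eq_mul]
      field_simp
      ring
  obtain ⟨g, hg, h⟩ := key
  exact ((hg.integrableOn_Icc (a := 0) (b := r)).mono_set Set.Ioo_subset_Icc_self).congr_fun
    (fun s hs => (h s hs).symm) measurableSet_Ioo

lemma locallyIntegrable_coulombField {d : ℕ} (hd : 2 ≤ d) :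
    LocallyIntegrable (coulombField d) volume := by
  have := nontrivial_pos_of_le hd
  refine locallyIntegrable_of_ball fun r => ?_
  rw [IntegrableOn, ← integrable_norm_iff (measurable_coulombField d).aestronglyMeasurable]
  simp_rw [norm_coulombField hd]
  change IntegrableOn (fun a : Pos d => (fun s => cd d / s ^ (d - 1)) ‖a‖) _ _
  rw [integrableOn_fun_norm_addHaar volume (f := fun s => cd d / s ^ (d - 1)),
    finrank_euclideanSpace, Fintype.card_fin]
  refine (integrableOn_const (C := cd d) (by simp)).congr_fun (fun s hs => ?_) measurableSet_Ioo
  have := hs.1.ne'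
  simp only [smul_eq_mul]
  field_simp

lemma ae_ne_point {d : ℕ} (hd : 2 ≤ d) (a : Pos d) : ∀ᵐ y : Pos d, y ≠ a := by
  have := nontrivial_pos_of_le hd
  exact (volume : Measure (Pos d)).ae_ne a

lemma integrable_mul_of_hasCompactSupport {d : ℕ} {f φ : Pos d → ℝ}
    (hf : LocallyIntegrable f volume) (hφ : Continuous φ) (hs : HasCompactSupport φ) :
    Integrable (fun y => f y * φ y) volume := by
  have := hf.integrable_smul_left_of_hasCompactSupport hφ hs
  refine this.congr (ae_of_all _ fun y => ?_)
  simp [mul_comm]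

lemma locallyIntegrable_norm {d : ℕ} {E : Type*} [NormedAddCommGroup E] {f : Pos d → E}
    (h : LocallyIntegrable f volume) : LocallyIntegrable (fun y => ‖f y‖) volume :=
  locallyIntegrable_of_ball fun r => (integrableOn_ball_of_locallyIntegrable h 0 r).norm

lemma locallyIntegrable_norm_sq {d : ℕ} : LocallyIntegrable (fun y : Pos d => ‖y‖ ^ 2) volume :=
  (by fun_prop : Continuous fun y : Pos d => ‖y‖ ^ 2).locallyIntegrable

lemma continuous_fderiv_apply_of_contDiff {d : ℕ} {φ : Pos d → ℝ} (hφ : ContDiff ℝ ∞ φ)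
    (v : Pos d) : Continuous fun y => fderiv ℝ φ y v :=
  (hφ.continuous_fderiv (by simp)).clm_apply continuous_const

lemma hasCompactSupport_fderiv_apply {d : ℕ} {φ : Pos d → ℝ} (hs : HasCompactSupport φ)
    (v : Pos d) : HasCompactSupport fun y => fderiv ℝ φ y v :=
  (hs.fderiv (𝕜 := ℝ)).comp_left (g := fun L : Pos d →L[ℝ] ℝ => L v) (by simp)

lemma integral_regW_mul_fderiv {d : ℕ} {ε : ℝ} (hε : 0 < ε) {φ : Pos d → ℝ}
    (hφ : ContDiff ℝ ∞ φ) (hs : HasCompactSupport φ) (v : Pos d) :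
    ∫ y, regW d ε y * fderiv ℝ φ y v = - ∫ y, φ y * inner ℝ (regField d ε y) v := by
  have hder : ∀ y : Pos d, fderiv ℝ (regW d ε) y v = inner ℝ (regField d ε y) v := fun y => by
    rw [(hasFDerivAt_regW (d := d) (ε := ε) (y := y) (by positivity)).fderiv, innerSL_apply_apply]
  have hcW := continuous_regW (d := d) hε
  have hcF := continuous_regField (d := d) hε
  rw [integral_mul_fderiv_eq_neg_fderiv_mul_of_integrable]
  · simp_rw [hder, mul_comm]
  · simp_rw [hder]
    refine Continuous.integrable_of_hasCompactSupport ?_ hs.mul_left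
    exact (hcF.inner continuous_const).mul hφ.continuous
  · exact Continuous.integrable_of_hasCompactSupport
      (hcW.mul (continuous_fderiv_apply_of_contDiff hφ v))
      (hasCompactSupport_fderiv_apply hs v).mul_left
  · exact Continuous.integrable_of_hasCompactSupport (hcW.mul hφ.continuous) hs.mul_left
  · exact fun y _ => (hasFDerivAt_regW (by positivity)).differentiableAt
  · exact fun y _ => hφ.differentiable (by simp) y

/-- The classical integration by parts for `regW` passes to the limit `ε → 0` on both sides by
dominated convergence, with majorants from `norm_regW_le` and `norm_regField_le`. The singular
kernel itself is never integrated by parts. -/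
lemma integral_W_mul_fderiv {d : ℕ} (hd : 2 ≤ d) {φ : Pos d → ℝ}
    (hφ : ContDiff ℝ ∞ φ) (hs : HasCompactSupport φ) (v : Pos d) :
    ∫ y : Pos d, W d ‖y‖ * fderiv ℝ φ y v = - ∫ y, φ y * inner ℝ (coulombField d y) v := by
  have hφ' := continuous_fderiv_apply_of_contDiff hφ v
  have hs' := hasCompactSupport_fderiv_apply hs v
  have t1 : Tendsto (fun ε => ∫ y, regW d ε y * fderiv ℝ φ y v) (𝓝[>] 0)
      (𝓝 (∫ y : Pos d, W d ‖y‖ * fderiv ℝ φ y v)) := by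
    refine tendsto_integral_filter_of_dominated_convergence
      (fun y => (‖W d ‖y‖‖ + ‖y‖ ^ 2) * ‖fderiv ℝ φ y v‖) ?_ ?_ ?_ ?_
    · filter_upwards [self_mem_nhdsWithin] with ε hε
      exact ((continuous_regW hε).mul hφ').aestronglyMeasurable
    · filter_upwards [Ioc_mem_nhdsGT one_pos] with ε hε
      filter_upwards [ae_ne_point hd 0] with y hy
      rw [norm_mul]
      gcongr
      exact norm_regW_le hd hε.1.le hε.2 hy
    · exact integrable_mul_of_hasCompactSupport
        ((locallyIntegrable_norm (locallyIntegrable_W_norm hd)).add locallyIntegrable_norm_sq) hφ'.norm hs'.norm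
    · filter_upwards [ae_ne_point hd 0] with y hy
      exact (tendsto_regW hd hy).mul_const _
  have t2 : Tendsto (fun ε => - ∫ y, φ y * inner ℝ (regField d ε y) v) (𝓝[>] 0)
      (𝓝 (- ∫ y, φ y * inner ℝ (coulombField d y) v)) := by
    refine Tendsto.neg ?_
    refine tendsto_integral_filter_of_dominated_convergence
      (fun y => (‖coulombField d y‖ * ‖v‖) * ‖φ y‖) ?_ ?_ ?_ ?_
    · filter_upwards [self_mem_nhdsWithin] with ε hε
      exact (hφ.continuous.mul
        ((continuous_regField hε).inner continuous_const)).aestronglyMeasurable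
    · filter_upwards [self_mem_nhdsWithin] with ε hε
      refine ae_of_all _ fun y => ?_
      rw [norm_mul, mul_comm]
      gcongr
      exact (norm_inner_le_norm _ _).trans
        (mul_le_mul_of_nonneg_right (norm_regField_le hd (le_of_lt hε) y) (norm_nonneg _))
    · exact integrable_mul_of_hasCompactSupport
        (locallyIntegrable_of_ball fun r => (integrableOn_ball_of_locallyIntegrable
          (locallyIntegrable_coulombField hd) 0 r).norm.mul_const ‖v‖) hφ.continuous.norm hs.norm
    · filter_upwards [ae_ne_point hd 0] with y hy
      exact ((tendsto_regField hy).inner tendsto_const_nhds).const_mul _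
  refine tendsto_nhds_unique t1 (t2.congr' ?_)
  filter_upwards [self_mem_nhdsWithin] with ε hε
  exact (integral_regW_mul_fderiv hε hφ hs v).symm

lemma integral_W_sub_mul_fderiv {d : ℕ} (hd : 2 ≤ d) {φ : Pos d → ℝ}
    (hφ : ContDiff ℝ ∞ φ) (hs : HasCompactSupport φ) (v b : Pos d) :
    ∫ y : Pos d, W d ‖y - b‖ * fderiv ℝ φ y v
      = - ∫ y, φ y * inner ℝ (coulombField d (y - b)) v := by
  have h := integral_W_mul_fderiv hd (φ := fun y => φ (y + b))
    (hφ.comp (contDiff_id.add contDiff_const))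
    (hs.comp_homeomorph (Homeomorph.addRight b)) v
  simp_rw [fderiv_comp_add_right] at h
  rw [← integral_add_right_eq_self _ b, ← integral_add_right_eq_self (fun y => φ y * _) b]
  simpa using h

/-! ### Potentials and fields of measures of bounded support. -/

/-- A translation-invariant kernel that is locally integrable is jointly integrable on a ball times
a finite measure of bounded support. -/
lemma integrable_kernel_prod {d : ℕ} {E : Type*} [NormedAddCommGroup E]
    {f : Pos d → E} (hm : StronglyMeasurable f) (hf : LocallyIntegrable f volume)
    {β : Measure (Pos d)} [IsFiniteMeasure β] {R : ℝ} (hR : ∀ᵐ b ∂β, ‖b‖ ≤ R) (ρ : ℝ) :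
    Integrable (fun p : Pos d × Pos d => f (p.1 - p.2))
      ((volume.restrict (Metric.ball 0 ρ)).prod β) := by
  have hmeas : StronglyMeasurable (fun p : Pos d × Pos d => f (p.1 - p.2)) :=
    hm.comp_measurable (by fun_prop)
  refine ⟨hmeas.aestronglyMeasurable, ?_⟩
  rw [HasFiniteIntegral, lintegral_prod_symm' _ hmeas.enorm]
  have hfin : ∫⁻ y in Metric.ball (0 : Pos d) (ρ + R), ‖f y‖ₑ < ⊤ :=
    (integrableOn_ball_of_locallyIntegrable hf 0 (ρ + R)).2
  -- Integrating in `y` first, the ball translated by `b` stays inside the ball of radius `ρ + R`,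
  -- which bounds the inner integral independently of `b`.
  have key : ∀ᵐ b ∂β, ∫⁻ y in Metric.ball (0 : Pos d) ρ, ‖f (y - b)‖ₑ
      ≤ ∫⁻ y in Metric.ball (0 : Pos d) (ρ + R), ‖f y‖ₑ := by
    filter_upwards [hR] with b hb
    rw [← lintegral_indicator measurableSet_ball, ← lintegral_indicator measurableSet_ball,
      ← lintegral_sub_right_eq_self (fun y => Set.indicator (Metric.ball (0 : Pos d) (ρ + R)) _ y) b]
    refine lintegral_mono fun y => ?_
    by_cases hy : y ∈ Metric.ball (0 : Pos d) ρ
    · have : y - b ∈ Metric.ball (0 : Pos d) (ρ + R) := by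
        rw [mem_ball_zero_iff] at hy ⊢
        linarith [norm_sub_le y b]
      rw [Set.indicator_of_mem hy, Set.indicator_of_mem this]
    · rw [Set.indicator_of_notMem hy]; exact zero_le
  calc _ ≤ ∫⁻ _, (∫⁻ y in Metric.ball (0 : Pos d) (ρ + R), ‖f y‖ₑ) ∂β := lintegral_mono_ae key
    _ < ⊤ := by
      rw [lintegral_const]
      exact ENNReal.mul_lt_top hfin (measure_lt_top _ _)

/-- The potential of a measure on positions. -/
def pot {d : ℕ} (β : Measure (Pos d)) (y : Pos d) : ℝ := ∫ b, W d ‖y - b‖ ∂β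

/-- The Coulomb field of a measure on positions. -/
def field {d : ℕ} (β : Measure (Pos d)) (y : Pos d) : Pos d := ∫ b, coulombField d (y - b) ∂β

section
variable {d : ℕ} {β : Measure (Pos d)} [IsFiniteMeasure β] {R : ℝ}

lemma stronglyMeasurable_W_norm : StronglyMeasurable fun y : Pos d => W d ‖y‖ :=
  ((measurable_W d).comp measurable_norm).stronglyMeasurable

lemma locallyIntegrable_integral_kernel {E : Type*} [NormedAddCommGroup E] [NormedSpace ℝ E]
    {f : Pos d → E} (hm : StronglyMeasurable f) (hf : LocallyIntegrable f volume)
    (hR : ∀ᵐ b ∂β, ‖b‖ ≤ R) : LocallyIntegrable (fun y => ∫ b, f (y - b) ∂β) volume :=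
  locallyIntegrable_of_ball fun ρ => (integrable_kernel_prod hm hf hR ρ).integral_prod_left

lemma ae_of_forall_ball {p : Pos d → Prop}
    (h : ∀ n : ℕ, ∀ᵐ y ∂(volume.restrict (Metric.ball (0 : Pos d) n)), p y) : ∀ᵐ y, p y := by
  have : ∀ᵐ y ∂(volume.restrict (⋃ n : ℕ, Metric.ball (0 : Pos d) n)), p y :=
    ae_restrict_iUnion_iff _ _ |>.2 h
  rwa [Metric.iUnion_ball_nat, Measure.restrict_univ] at this

lemma ae_integrable_kernel {E : Type*} [NormedAddCommGroup E]
    {f : Pos d → E} (hm : StronglyMeasurable f) (hf : LocallyIntegrable f volume)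
    (hR : ∀ᵐ b ∂β, ‖b‖ ≤ R) : ∀ᵐ y : Pos d, Integrable (fun b => f (y - b)) β :=
  ae_of_forall_ball fun n => (integrable_kernel_prod hm hf hR n).prod_right_ae

/-- Fubini on a ball that contains the support of the test function. It reduces weak derivatives of
potentials to those of the kernel. -/
lemma integral_kernel_mul {f : Pos d → ℝ} (hm : StronglyMeasurable f)
    (hf : LocallyIntegrable f volume) (hR : ∀ᵐ b ∂β, ‖b‖ ≤ R) {ψ : Pos d → ℝ}
    (hψ : Continuous ψ) (hs : HasCompactSupport ψ) :
    ∫ y, (∫ b, f (y - b) ∂β) * ψ y = ∫ b, (∫ y, f (y - b) * ψ y) ∂β := by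
  obtain ⟨ρ, hρ⟩ := hs.isBounded.subset_ball (0 : Pos d)
  have hsup : Function.support ψ ⊆ Metric.ball 0 ρ := (subset_tsupport ψ).trans hρ
  have e1 : ∫ y, (∫ b, f (y - b) ∂β) * ψ y
      = ∫ y in Metric.ball 0 ρ, (∫ b, f (y - b) ∂β) * ψ y :=
    (setIntegral_eq_integral_of_forall_compl_eq_zero fun y hy => by
      rw [Function.notMem_support.1 fun h => hy (hsup h), mul_zero]).symm
  have e2 : ∀ b, ∫ y, f (y - b) * ψ y = ∫ y in Metric.ball 0 ρ, f (y - b) * ψ y := fun b =>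
    (setIntegral_eq_integral_of_forall_compl_eq_zero fun y hy => by
      rw [Function.notMem_support.1 fun h => hy (hsup h), mul_zero]).symm
  rw [e1]
  simp_rw [e2, ← integral_mul_const]
  refine integral_integral_swap ?_
  obtain ⟨C, hC⟩ := hs.exists_bound_of_continuous hψ
  exact (integrable_kernel_prod hm hf hR ρ).mul_bdd (c := C)
    (hψ.comp continuous_fst).aestronglyMeasurable (ae_of_all _ fun p => hC p.1)

/-- The field of a measure of bounded support is the weak gradient of its potential. -/
lemma isWeakGradient_pot (hd : 2 ≤ d) (hR : ∀ᵐ b ∂β, ‖b‖ ≤ R) :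
    IsWeakGradient (pot β) (field β) := by
  have hm := (measurable_coulombField d).stronglyMeasurable
  have hf := locallyIntegrable_coulombField hd
  refine ⟨locallyIntegrable_integral_kernel stronglyMeasurable_W_norm
    (locallyIntegrable_W_norm hd) hR, locallyIntegrable_integral_kernel hm hf hR, ?_⟩
  intro φ hφ hs v
  have h1 := integral_kernel_mul stronglyMeasurable_W_norm (locallyIntegrable_W_norm hd) hR
    (continuous_fderiv_apply_of_contDiff hφ v) (hasCompactSupport_fderiv_apply hs v)
  have hmv : StronglyMeasurable fun y : Pos d => inner ℝ (coulombField d y) v :=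
    hm.inner stronglyMeasurable_const
  have hfv : LocallyIntegrable (fun y : Pos d => inner ℝ (coulombField d y) v) volume :=
    locallyIntegrable_of_ball fun r => (integrableOn_ball_of_locallyIntegrable hf 0 r).inner_const v
  have h2 := integral_kernel_mul hmv hfv hR hφ.continuous hs
  calc ∫ y, pot β y * fderiv ℝ φ y v = ∫ b, (∫ y, W d ‖y - b‖ * fderiv ℝ φ y v) ∂β := h1
    _ = - ∫ b, (∫ y, inner ℝ (coulombField d (y - b)) v * φ y) ∂β := by
      rw [← integral_neg]
      congr 1 with b
      rw [integral_W_sub_mul_fderiv hd hφ hs]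
      simp_rw [mul_comm]
    _ = - ∫ y, (∫ b, inner ℝ (coulombField d (y - b)) v ∂β) * φ y := by rw [h2]
    _ = _ := by
      congr 1
      refine integral_congr_ae ?_
      filter_upwards [ae_integrable_kernel hm hf hR] with y hy
      have : inner ℝ (field β y) v = ∫ b, inner ℝ (coulombField d (y - b)) v ∂β := by
        rw [real_inner_comm, field, ← integral_inner hy]
        simp_rw [real_inner_comm]
      rw [this, mul_comm]

lemma IsWeakGradient.sub {u w : Pos d → ℝ} {F G : Pos d → Pos d} (h : IsWeakGradient u F)
    (h' : IsWeakGradient w G) : IsWeakGradient (u - w) (F - G) := by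
  refine ⟨h.1.sub h'.1, h.2.1.sub h'.2.1, fun φ hφ hs v => ?_⟩
  have hin : ∀ {F : Pos d → Pos d}, LocallyIntegrable F volume →
      Integrable (fun y => φ y * inner ℝ (F y) v) volume := fun hF =>
    ((integrable_mul_of_hasCompactSupport (locallyIntegrable_of_ball fun r =>
      (integrableOn_ball_of_locallyIntegrable hF 0 r).inner_const v) hφ.continuous hs).congr
      (ae_of_all _ fun y => mul_comm _ _))
  have hd1 := continuous_fderiv_apply_of_contDiff hφ v
  have hd2 := hasCompactSupport_fderiv_apply hs v
  simp only [Pi.sub_apply, inner_sub_left, sub_mul, mul_sub]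
  rw [integral_sub (integrable_mul_of_hasCompactSupport h.1 hd1 hd2)
    (integrable_mul_of_hasCompactSupport h'.1 hd1 hd2), integral_sub (hin h.2.1) (hin h'.2.1),
    h.2.2 φ hφ hs v, h'.2.2 φ hφ hs v]
  ring

/-- Uniqueness of the weak gradient, by testing against each coordinate direction. It lets the
renormalized energy be computed for one explicit field and then transferred to an arbitrary weak
gradient. -/
lemma IsWeakGradient.ae_eq {u : Pos d → ℝ} {F G : Pos d → Pos d} (h : IsWeakGradient u F)
    (h' : IsWeakGradient u G) : F =ᵐ[volume] G := by
  have hin : ∀ {F : Pos d → Pos d}, LocallyIntegrable F volume → ∀ v : Pos d,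
      LocallyIntegrable (fun y => inner ℝ (F y) v) volume := fun hF v =>
    locallyIntegrable_of_ball fun r => (integrableOn_ball_of_locallyIntegrable hF 0 r).inner_const v
  have key : ∀ v : Pos d, ∀ᵐ y, inner ℝ (F y) v = (inner ℝ (G y) v : ℝ) := fun v =>
    ae_eq_of_integral_contDiff_smul_eq (hin h.2.1 v) (hin h'.2.1 v) fun φ hφ hs => by
      have h1 := h.2.2 φ hφ hs v
      rw [h'.2.2 φ hφ hs v] at h1
      simpa using h1.symm
  have := ae_all_iff.2 fun i : Fin d => key (EuclideanSpace.single i 1)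
  filter_upwards [this] with y hy
  ext i
  have := hy i
  rwa [EuclideanSpace.inner_single_right, EuclideanSpace.inner_single_right, one_mul, one_mul] at this

end

/-! ### Radial integrals. -/

/-- The surface measure of the unit sphere. -/
def sphereArea (d : ℕ) : ℝ := (volume : Measure (Pos d)).toSphere.real Set.univ

lemma integrableOn_norm_iff {d : ℕ} (hd : 2 ≤ d) {E : Type*} [NormedAddCommGroup E]
    [NormedSpace ℝ E] {f : ℝ → E} {T : Set ℝ} (hT : MeasurableSet T) :
    IntegrableOn (fun y : Pos d => f ‖y‖) {y | ‖y‖ ∈ T} volume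
      ↔ IntegrableOn (fun s => s ^ (d - 1) • f s) (Set.Ioi 0 ∩ T) volume := by
  have := nontrivial_pos_of_le hd
  have hT' : MeasurableSet {y : Pos d | ‖y‖ ∈ T} := measurable_norm hT
  have h := integrable_fun_norm_addHaar (volume : Measure (Pos d)) (f := T.indicator f)
  rw [finrank_euclideanSpace, Fintype.card_fin] at h
  have e1 : (fun y : Pos d => T.indicator f ‖y‖)
      = Set.indicator {y : Pos d | ‖y‖ ∈ T} (fun y : Pos d => f ‖y‖) := by
    ext1 y; by_cases hy : ‖y‖ ∈ T <;> simp [hy]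
  have e2 : (fun s => s ^ (d - 1) • T.indicator f s)
      = T.indicator (fun s => s ^ (d - 1) • f s) := by
    ext1 s; by_cases hy : s ∈ T <;> simp [hy]
  rw [e1, e2, integrable_indicator_iff hT', IntegrableOn, IntegrableOn,
    integrable_indicator_iff hT, IntegrableOn, Measure.restrict_restrict hT] at h
  rw [Set.inter_comm]
  exact h

lemma setIntegral_norm {d : ℕ} (hd : 2 ≤ d) (f : ℝ → ℝ) {T : Set ℝ} (hT : MeasurableSet T) :
    ∫ y : Pos d in {y | ‖y‖ ∈ T}, f ‖y‖
      = sphereArea d * ∫ s in Set.Ioi 0 ∩ T, s ^ (d - 1) * f s := by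
  have := nontrivial_pos_of_le hd
  have hT' : MeasurableSet {y : Pos d | ‖y‖ ∈ T} := measurable_norm hT
  have h := integral_fun_norm_addHaar (volume : Measure (Pos d)) (T.indicator f)
  have e1 : (fun y : Pos d => T.indicator f ‖y‖)
      = Set.indicator {y : Pos d | ‖y‖ ∈ T} (fun y : Pos d => f ‖y‖) := by
    ext1 y; by_cases hy : ‖y‖ ∈ T <;> simp [hy]
  have e2 : (fun s => s ^ (d - 1) • T.indicator f s)
      = T.indicator (fun s => s ^ (d - 1) * f s) := by
    ext1 s; by_cases hy : s ∈ T <;> simp [hy]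
  rw [finrank_euclideanSpace, Fintype.card_fin, e1, e2, integral_indicator hT',
    setIntegral_indicator hT] at h
  rw [h, sphereArea, Measure.toSphere_real_apply_univ, finrank_euclideanSpace, Fintype.card_fin]
  simp [mul_assoc]

lemma continuousOn_div_pow {c : ℝ} {n : ℕ} {u v : ℝ} (hu : 0 < u) :
    ContinuousOn (fun s : ℝ => c / s ^ n) (Set.Icc u v) :=
  continuousOn_const.div (by fun_prop) fun s hs => pow_ne_zero _ (hu.trans_le hs.1).ne'

lemma intervalIntegral_deriv_W {d : ℕ} (hd : 2 ≤ d) {u v : ℝ} (hu : 0 < u) (huv : u ≤ v) :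
    ∫ s in u..v, cd d / s ^ (d - 1) = W d v - W d u := by
  refine intervalIntegral.integral_eq_sub_of_hasDerivAt (f := W d) (fun s hs => ?_) ?_
  · rw [Set.uIcc_of_le huv] at hs
    exact hasDerivAt_W hd (hu.trans_le hs.1).ne'
  · refine ContinuousOn.intervalIntegrable ?_
    rw [Set.uIcc_of_le huv]
    exact continuousOn_div_pow hu

lemma Ioi_inter_Ico {u v : ℝ} (hu : 0 < u) : Set.Ioi 0 ∩ Set.Ico u v = Set.Ico u v :=
  Set.inter_eq_right.2 fun _ hs => hu.trans_le hs.1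

/-- The energy of a Coulomb field in an annulus. -/
lemma annulus_energy {d : ℕ} (hd : 2 ≤ d) {u v : ℝ} (hu : 0 < u) (huv : u ≤ v) :
    IntegrableOn (fun y : Pos d => ‖coulombField d y‖ ^ 2) {y | ‖y‖ ∈ Set.Ico u v} ∧
    ∫ y : Pos d in {y | ‖y‖ ∈ Set.Ico u v}, ‖coulombField d y‖ ^ 2 = kd d * (W d v - W d u) := by
  simp_rw [norm_coulombField hd]
  -- After multiplication by the Jacobian the squared field is `c_d` times the derivative of `W`, so
  -- the radial integral telescopes.
  have e : ∀ s ∈ Set.Ico u v, s ^ (d - 1) * (cd d / s ^ (d - 1)) ^ 2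
      = cd d * (cd d / s ^ (d - 1)) := fun s hs => by
    have : s ≠ 0 := (hu.trans_le hs.1).ne'
    field_simp
  constructor
  · rw [integrableOn_norm_iff hd (f := fun s => (cd d / s ^ (d - 1)) ^ 2) measurableSet_Ico,
      Ioi_inter_Ico hu]
    refine IntegrableOn.congr_fun ?_ (fun s hs => (e s hs).symm) measurableSet_Ico
    exact (((continuousOn_div_pow hu).integrableOn_Icc).mono_set Set.Ico_subset_Icc_self).const_mul _
  · rw [setIntegral_norm hd (fun s => (cd d / s ^ (d - 1)) ^ 2) measurableSet_Ico,
      Ioi_inter_Ico hu, setIntegral_congr_fun measurableSet_Ico e, integral_const_mul,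
      integral_Ico_eq_integral_Ioc, ← intervalIntegral.integral_of_le huv,
      intervalIntegral_deriv_W hd hu huv, kd_eq, sphereArea]
    ring

lemma shell_norm_field {d : ℕ} (hd : 2 ≤ d) {u v : ℝ} (hu : 0 < u) (huv : u ≤ v) :
    IntegrableOn (fun y : Pos d => ‖coulombField d y‖) {y | ‖y‖ ∈ Set.Ico u v} ∧
    ∫ y : Pos d in {y | ‖y‖ ∈ Set.Ico u v}, ‖coulombField d y‖ = kd d * (v - u) := by
  simp_rw [norm_coulombField hd]
  have e : ∀ s ∈ Set.Ico u v, s ^ (d - 1) * (cd d / s ^ (d - 1)) = cd d := fun s hs => by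
    have : s ≠ 0 := (hu.trans_le hs.1).ne'
    field_simp
  constructor
  · rw [integrableOn_norm_iff hd (f := fun s => cd d / s ^ (d - 1)) measurableSet_Ico,
      Ioi_inter_Ico hu]
    exact (integrableOn_const (by simp)).congr_fun (fun s hs => (e s hs).symm) measurableSet_Ico
  · rw [setIntegral_norm hd (fun s => cd d / s ^ (d - 1)) measurableSet_Ico,
      Ioi_inter_Ico hu, setIntegral_congr_fun measurableSet_Ico e, setIntegral_const,
      Real.volume_real_Ico_of_le huv, kd_eq, sphereArea, smul_eq_mul]
    ring

/-! ### Integrability of the product of two Coulomb fields. -/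

/-- The product of two Coulomb fields at distance `r` is at most a sum of two such functions,
centred at the two charges. -/
def pairBound (d : ℕ) (r s : ℝ) : ℝ := cd d / s ^ (d - 1) * (cd d / max (r / 2) s ^ (d - 1))

lemma pairBound_nonneg {d : ℕ} (hd : 2 ≤ d) {r s : ℝ} (hr : 0 < r) (hs : 0 ≤ s) :
    0 ≤ pairBound d r s := by
  have := cd_pos hd
  have : 0 < max (r / 2) s := lt_max_of_lt_left (by positivity)
  unfold pairBound; positivity

/-- With `z`, `w` the positions relative to the two charges, `‖z - w‖ ≤ ‖z‖ + ‖w‖ ≤ 2 ‖w‖`: the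
farther charge is at distance at least half the separation, so its field stays bounded near the
closer one. -/
lemma norm_mul_norm_le_pairBound {d : ℕ} (hd : 2 ≤ d) {z w : Pos d} (hzw : z ≠ w)
    (h : ‖z‖ ≤ ‖w‖) : ‖coulombField d z‖ * ‖coulombField d w‖ ≤ pairBound d ‖z - w‖ ‖z‖ := by
  have hc := cd_pos hd
  have hr : 0 < ‖z - w‖ := norm_pos_iff.2 (sub_ne_zero.2 hzw)
  have hmax : max (‖z - w‖ / 2) ‖z‖ ≤ ‖w‖ := max_le (by linarith [norm_sub_le z w]) h
  have : 0 < max (‖z - w‖ / 2) ‖z‖ := lt_max_of_lt_left (by positivity)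
  rw [norm_coulombField hd, norm_coulombField hd, pairBound]
  gcongr

lemma norm_mul_norm_le {d : ℕ} (hd : 2 ≤ d) {z w : Pos d} (hzw : z ≠ w) :
    ‖coulombField d z‖ * ‖coulombField d w‖
      ≤ pairBound d ‖z - w‖ ‖z‖ + pairBound d ‖z - w‖ ‖w‖ := by
  have hr : 0 < ‖z - w‖ := norm_pos_iff.2 (sub_ne_zero.2 hzw)
  rcases le_total ‖z‖ ‖w‖ with h | h
  · linarith [norm_mul_norm_le_pairBound hd hzw h, pairBound_nonneg hd hr (norm_nonneg w)]
  · have := norm_mul_norm_le_pairBound hd hzw.symm h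
    rw [norm_sub_rev] at this
    linarith [pairBound_nonneg hd hr (norm_nonneg z)]

/-- The left side is what the radial integral of `pairBound` yields. For `d = 2` it is `1 + log 2 -
log r`; for `d ≥ 3` both terms are multiples of `1 / r ^ (d - 2)`. -/
lemma W_half_bound {d : ℕ} (hd : 2 ≤ d) : ∃ C : ℝ, 0 ≤ C ∧ ∀ r : ℝ, 0 < r →
    r / 2 * (cd d / (r / 2) ^ (d - 1)) - W d (r / 2) ≤ C * (1 + |W d r|) := by
  have hc := cd_pos hd
  refine ⟨(cd d + 1) * 2 ^ d, by positivity, fun r hr => ?_⟩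
  unfold W
  split_ifs with h
  · subst h
    rw [Real.log_div hr.ne' (by norm_num)]
    have h2 : Real.log 2 ≤ 1 := by
      have := Real.log_le_sub_one_of_pos (zero_lt_two' ℝ); linarith
    have h3 := neg_abs_le (Real.log r)
    have h4 : cd 2 = 1 := by simp [cd]
    rw [h4]
    have : r / 2 * (1 / (r / 2) ^ (2 - 1)) = 1 := by
      rw [show 2 - 1 = 1 by rfl]; field_simp
    rw [this]
    nlinarith [abs_nonneg (Real.log r)]
  · obtain ⟨k, rfl⟩ : ∃ k, d = k + 3 := ⟨d - 3, by omega⟩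
    have hk : k + 3 - 2 = k + 1 := by omega
    have hk' : k + 3 - 1 = k + 2 := by omega
    rw [hk, hk', abs_neg, abs_of_pos (by positivity)]
    have e1 : r / 2 * (cd (k + 3) / (r / 2) ^ (k + 2)) - -(1 / (r / 2) ^ (k + 1))
        = (cd (k + 3) + 1) * 2 ^ (k + 1) * (1 / r ^ (k + 1)) := by
      rw [div_pow, div_pow]; field_simp; ring
    rw [e1]
    have : (2 : ℝ) ^ (k + 1) ≤ 2 ^ (k + 3) := pow_le_pow_right₀ (by norm_num) (by omega)
    have h5 : (0 : ℝ) < 1 / r ^ (k + 1) := by positivity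
    gcongr
    linarith

/-- Radially the integrand is constant up to `r / 2` and proportional to the derivative of `W`
beyond, so the integral is explicit. The bound in terms of `|W d r|` is what makes Fubini work for
measures of finite interaction. -/
lemma integral_pairBound {d : ℕ} (hd : 2 ≤ d) {P : ℝ} (hP : 0 < P) :
    ∃ C : ℝ, 0 ≤ C ∧ ∀ r : ℝ, 0 < r → r / 2 ≤ P →
      IntegrableOn (fun y : Pos d => pairBound d r ‖y‖) (Metric.ball 0 P) ∧
      ∫ y in Metric.ball (0 : Pos d) P, pairBound d r ‖y‖ ≤ C * (1 + |W d r|) := by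
  obtain ⟨C, hC, h⟩ := W_half_bound hd
  have hk := kd_pos hd
  refine ⟨kd d * (C + |W d P|), by positivity, fun r hr hrP => ?_⟩
  have hb : (Metric.ball 0 P : Set (Pos d)) = {y : Pos d | ‖y‖ ∈ Set.Iio P} := by ext; simp
  have e : ∀ s ∈ Set.Ioi 0 ∩ Set.Iio P, s ^ (d - 1) * pairBound d r s
      = cd d * (cd d / max (r / 2) s ^ (d - 1)) := fun s hs => by
    have : s ≠ 0 := ne_of_gt hs.1
    rw [pairBound]; field_simp
  have hcont : Continuous fun s : ℝ => cd d / max (r / 2) s ^ (d - 1) :=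
    continuous_const.div (by fun_prop) fun s =>
      pow_ne_zero _ (lt_max_of_lt_left (by positivity)).ne'
  have hset : Set.Ioi 0 ∩ Set.Iio P = Set.Ioo 0 P := rfl
  rw [hb]
  constructor
  · rw [integrableOn_norm_iff hd (f := pairBound d r) measurableSet_Iio]
    refine IntegrableOn.congr_fun ?_ (fun s hs => (e s hs).symm) (measurableSet_Ioi.inter measurableSet_Iio)
    exact ((hcont.integrableOn_Icc (a := 0) (b := P)).mono_set Set.Ioo_subset_Icc_self).const_mul _
  · rw [setIntegral_norm hd (pairBound d r) measurableSet_Iio,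
      setIntegral_congr_fun (measurableSet_Ioi.inter measurableSet_Iio) e, integral_const_mul, hset,
      ← integral_Ioc_eq_integral_Ioo, ← intervalIntegral.integral_of_le hP.le,
      ← intervalIntegral.integral_add_adjacent_intervals (b := r / 2)
        (hcont.intervalIntegrable _ _) (hcont.intervalIntegrable _ _)]
    have i1 : ∫ s in (0 : ℝ)..(r / 2), cd d / max (r / 2) s ^ (d - 1)
        = r / 2 * (cd d / (r / 2) ^ (d - 1)) := by
      rw [intervalIntegral.integral_congr (g := fun _ => cd d / (r / 2) ^ (d - 1))]
      · simp [mul_div_assoc]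
      · intro s hs
        rw [Set.uIcc_of_le (by positivity)] at hs
        simp only [max_eq_left hs.2]
    have i2 : ∫ s in (r / 2)..P, cd d / max (r / 2) s ^ (d - 1) = W d P - W d (r / 2) := by
      rw [← intervalIntegral_deriv_W hd (by positivity) hrP]
      refine intervalIntegral.integral_congr fun s hs => ?_
      rw [Set.uIcc_of_le hrP] at hs
      simp only [max_eq_right hs.1]
    rw [i1, i2, ← mul_assoc, mul_comm _ (cd d), sphereArea, ← kd_eq, mul_assoc]
    gcongr
    have := h r hr
    nlinarith [le_abs_self (W d P), abs_nonneg (W d r), abs_nonneg (W d P)]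

/-- The product of the fields of two charges is integrable on balls, with a bound of the order of
the interaction of the charges. -/
lemma integrableOn_norm_mul_norm {d : ℕ} (hd : 2 ≤ d) {R ρ : ℝ} (hR : 0 ≤ R) (hρ : 0 < ρ) :
    ∃ C : ℝ, 0 ≤ C ∧ ∀ a b : Pos d, ‖a‖ ≤ R → ‖b‖ ≤ R → a ≠ b →
      IntegrableOn (fun y => ‖coulombField d (y - a)‖ * ‖coulombField d (y - b)‖)
        (Metric.ball 0 ρ) ∧
      ∫ y in Metric.ball 0 ρ, ‖coulombField d (y - a)‖ * ‖coulombField d (y - b)‖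
        ≤ C * (1 + |W d ‖a - b‖|) := by
  obtain ⟨C, hC, h⟩ := integral_pairBound hd (P := ρ + R) (by positivity)
  refine ⟨2 * C, by positivity, fun a b ha hb hab => ?_⟩
  have hr : 0 < ‖a - b‖ := norm_pos_iff.2 (sub_ne_zero.2 hab)
  obtain ⟨h1, h2⟩ := h ‖a - b‖ hr (by linarith [norm_sub_le a b])
  have hm := measurable_coulombField d
  have key : ∀ c : Pos d, ‖c‖ ≤ R →
      IntegrableOn (fun y : Pos d => pairBound d ‖a - b‖ ‖y - c‖) (Metric.ball 0 ρ) ∧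
      ∫ y in Metric.ball (0 : Pos d) ρ, pairBound d ‖a - b‖ ‖y - c‖
        ≤ C * (1 + |W d ‖a - b‖|) := fun c hc => by
    have hsub : Metric.ball (0 : Pos d) ρ ⊆ (fun y => y - c) ⁻¹' Metric.ball 0 (ρ + R) := by
      intro y hy
      rw [Set.mem_preimage, mem_ball_zero_iff]
      rw [mem_ball_zero_iff] at hy
      linarith [norm_sub_le y c]
    have mp := measurePreserving_sub_right (volume : Measure (Pos d)) c
    have me := (MeasurableEquiv.subRight c).measurableEmbedding
    have i1 : IntegrableOn (fun y : Pos d => pairBound d ‖a - b‖ ‖y - c‖)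
        ((fun y => y - c) ⁻¹' Metric.ball 0 (ρ + R)) :=
      (mp.integrableOn_comp_preimage me).2 h1
    refine ⟨i1.mono_set hsub, le_trans (setIntegral_mono_set i1 ?_ (LE.le.eventuallyLE hsub)) ?_⟩
    · exact ae_of_all _ fun y => pairBound_nonneg hd hr (norm_nonneg _)
    · rw [mp.setIntegral_preimage_emb me (fun y => pairBound d ‖a - b‖ ‖y‖)]
      exact h2
  obtain ⟨a1, a2⟩ := key a ha
  obtain ⟨b1, b2⟩ := key b hb
  have hle : ∀ y : Pos d, ‖coulombField d (y - a)‖ * ‖coulombField d (y - b)‖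
      ≤ pairBound d ‖a - b‖ ‖y - a‖ + pairBound d ‖a - b‖ ‖y - b‖ := fun y => by
    have := norm_mul_norm_le hd (z := y - a) (w := y - b) (by simpa using hab)
    rwa [show y - a - (y - b) = b - a by abel, norm_sub_rev b a] at this
  have hi : IntegrableOn (fun y => ‖coulombField d (y - a)‖ * ‖coulombField d (y - b)‖)
      (Metric.ball 0 ρ) := by
    refine (a1.add b1).mono' (by fun_prop) (ae_of_all _ fun y => ?_)
    rw [Real.norm_of_nonneg (by positivity)]
    exact hle y
  refine ⟨hi, (setIntegral_mono hi (a1.add b1) hle).trans ?_⟩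
  simp only [Pi.add_apply]
  rw [integral_add a1 b1]
  linarith

/-! ### The exact mutual energy of two charges in a ball. -/

/-- Integration in polar coordinates. -/
lemma integral_polar {d : ℕ} (hd : 2 ≤ d) {f : Pos d → ℝ} (hf : Integrable f volume) :
    ∫ y, f y = ∫ θ, (∫ r in Set.Ioi (0 : ℝ), r ^ (d - 1) * f (r • (θ : Pos d)))
      ∂((volume : Measure (Pos d)).toSphere) := by
  have := nontrivial_pos_of_le hd
  set μ : Measure (Pos d) := volume
  have mp := μ.measurePreserving_homeomorphUnitSphereProd
  have me : MeasurableEmbedding (homeomorphUnitSphereProd (Pos d)) :=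
    Homeomorph.measurableEmbedding _
  let g : Metric.sphere (0 : Pos d) 1 × Set.Ioi (0 : ℝ) → ℝ := fun p => f ((p.2 : ℝ) • (p.1 : Pos d))
  have hg : ∀ x : ({0}ᶜ : Set (Pos d)), g (homeomorphUnitSphereProd (Pos d) x) = f x := fun x => by
    have hx : ‖(x : Pos d)‖ ≠ 0 := norm_ne_zero_iff.2 x.2
    simp only [g, homeomorphUnitSphereProd_apply_fst_coe, homeomorphUnitSphereProd_apply_snd_coe]
    rw [smul_smul, mul_inv_cancel₀ hx, one_smul]
  rw [finrank_euclideanSpace, Fintype.card_fin] at mp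
  have hms : MeasurableSet ({0}ᶜ : Set (Pos d)) := (measurableSet_singleton _).compl
  have h1 : ∫ y, f y ∂μ = ∫ p, g p ∂(μ.toSphere.prod (.volumeIoiPow (d - 1))) := by
    rw [← mp.integral_comp me]
    simp_rw [hg]
    rw [integral_subtype_comap hms, restrict_compl_singleton]
  have h2 : Integrable g (μ.toSphere.prod (.volumeIoiPow (d - 1))) := by
    rw [← mp.integrable_comp_emb me]
    have : g ∘ homeomorphUnitSphereProd (Pos d) = f ∘ ((↑) : ({0}ᶜ : Set (Pos d)) → Pos d) :=
      funext hg
    rw [this, ← integrableOn_iff_comap_subtypeVal hms]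
    exact hf.integrableOn
  rw [h1, integral_prod _ h2]
  congr 1 with θ
  simp only [Measure.volumeIoiPow, ENNReal.ofReal, g]
  rw [integral_withDensity_eq_integral_smul
    ((measurable_subtype_coe.pow_const _).real_toNNReal),
    integral_subtype_comap measurableSet_Ioi
      fun a : ℝ => Real.toNNReal (a ^ (d - 1)) • f (a • (θ : Pos d))]
  refine setIntegral_congr_fun measurableSet_Ioi fun x hx => ?_
  simp only [NNReal.smul_def, smul_eq_mul]
  rw [Real.coe_toNNReal _ (pow_nonneg hx.out.le _)]

/-- Only the ray in the direction of `w` meets `w`. That direction is null for the surface measure,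
since the cone over it lies in a line and `d ≥ 2`. -/
lemma toSphere_ae_ray_ne {d : ℕ} (hd : 2 ≤ d) {w : Pos d} (hw : w ≠ 0) :
    ∀ᵐ θ : Metric.sphere (0 : Pos d) 1 ∂((volume : Measure (Pos d)).toSphere), ∀ r : ℝ, 0 ≤ r → r • (θ : Pos d) ≠ w := by
  have hw' : ‖w‖ ≠ 0 := norm_ne_zero_iff.2 hw
  let θ₀ : Metric.sphere (0 : Pos d) 1 := ⟨‖w‖⁻¹ • w, by simp [norm_smul, hw']⟩
  have hnull : (volume : Measure (Pos d)).toSphere {θ₀} = 0 := by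
    rw [Measure.toSphere_apply' _ (measurableSet_singleton _)]
    have : (volume : Measure (Pos d)) (Submodule.span ℝ {w}) = 0 := by
      refine Measure.addHaar_submodule _ _ fun h => ?_
      have h1 := finrank_span_singleton (K := ℝ) hw
      rw [h, finrank_top, finrank_euclideanSpace, Fintype.card_fin] at h1
      omega
    rw [measure_mono_null ?_ this, mul_zero]
    rintro _ ⟨r, -, _, ⟨θ, rfl, rfl⟩, rfl⟩
    exact Submodule.smul_mem _ _ (Submodule.smul_mem _ _ (Submodule.mem_span_singleton_self w))
  filter_upwards [compl_mem_ae_iff.2 hnull] with θ hθ r hr h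
  refine hθ ?_
  have hn : ‖(θ : Pos d)‖ = 1 := by simp
  have hrw : r = ‖w‖ := by rw [← h, norm_smul, hn, mul_one, Real.norm_of_nonneg hr]
  refine Subtype.ext ?_
  simp only [θ₀]
  rw [← h, smul_smul, norm_smul, hn, mul_one, Real.norm_of_nonneg hr, inv_mul_cancel₀ (hrw ▸ hw'),
    one_smul]

lemma continuousAt_coulombField {d : ℕ} {y : Pos d} (hy : y ≠ 0) :
    ContinuousAt (coulombField d) y := by
  unfold coulombField
  have : ‖y‖ ^ d ≠ 0 := pow_ne_zero _ (norm_ne_zero_iff.2 hy)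
  have h1 : ContinuousAt (fun z : Pos d => cd d / ‖z‖ ^ d) y :=
    continuousAt_const.div (by fun_prop) this
  exact h1.smul continuousAt_id

/-- The flux along a ray that starts at the origin and leaves the ball around `w`. -/
lemma integral_ray {d : ℕ} (hd : 2 ≤ d) {w : Pos d} {ρ : ℝ} (hρ : ‖w‖ < ρ) {θ : Pos d}
    (hθ : ‖θ‖ = 1) (hray : ∀ r : ℝ, 0 ≤ r → r • θ ≠ w) :
    ∫ r in Set.Ioi (0 : ℝ), Set.indicator (Metric.ball w ρ)
      (fun z => (inner ℝ (coulombField d (z - w)) θ : ℝ)) (r • θ) = W d ρ - W d ‖w‖ := by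
  set s : ℝ := inner ℝ θ w
  have hsq : ∀ r : ℝ, ‖r • θ - w‖ ^ 2 = (r - s) ^ 2 + ‖w‖ ^ 2 - s ^ 2 := fun r => by
    rw [norm_sub_sq_real, norm_smul, hθ, inner_smul_left, mul_one, Real.norm_eq_abs, sq_abs]
    simp only [conj_trivial, s]
    ring
  have hw0 := norm_nonneg w
  have hpos : 0 < s ^ 2 + ρ ^ 2 - ‖w‖ ^ 2 := by nlinarith [sq_nonneg s]
  -- `s` is the abscissa of the foot of the perpendicular from `w` to the ray's line, and `D` is the
  -- half chord. The origin lies inside the ball, so `|s| < D` and the ray leaves the ball exactly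
  -- once, at `s + D`.
  set D : ℝ := √(s ^ 2 + ρ ^ 2 - ‖w‖ ^ 2)
  have hD : D ^ 2 = s ^ 2 + ρ ^ 2 - ‖w‖ ^ 2 := Real.sq_sqrt hpos.le
  have hD0 : 0 < D := Real.sqrt_pos.2 hpos
  have hsD : |s| < D := by
    refine abs_lt_of_sq_lt_sq ?_ hD0.le
    nlinarith
  obtain ⟨hs1, hs2⟩ := abs_lt.1 hsD
  have hend : ‖(s + D) • θ - w‖ = ρ := by
    have h1 := hsq (s + D)
    have : ‖(s + D) • θ - w‖ ^ 2 = ρ ^ 2 := by rw [h1]; ring_nf; linarith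
    exact (pow_left_inj₀ (norm_nonneg _) (by linarith) two_ne_zero).1 this
  have hmem : ∀ r : ℝ, 0 < r → (r • θ ∈ Metric.ball w ρ ↔ r < s + D) := fun r hr => by
    rw [mem_ball_iff_norm, ← sq_lt_sq₀ (norm_nonneg _) (by linarith : (0:ℝ) ≤ ρ), hsq]
    constructor
    · intro h
      have : |r - s| < D := abs_lt_of_sq_lt_sq (by linarith) hD0.le
      linarith [(abs_lt.1 this).2]
    · intro h
      have : (r - s) ^ 2 < D ^ 2 := sq_lt_sq' (by linarith) (by linarith)
      linarith
  have e : ∀ r ∈ Set.Ioi (0 : ℝ), Set.indicator (Metric.ball w ρ)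
      (fun z => (inner ℝ (coulombField d (z - w)) θ : ℝ)) (r • θ)
      = Set.indicator (Set.Iio (s + D)) (fun r => inner ℝ (coulombField d (r • θ - w)) θ) r := by
    intro r hr
    by_cases h : r < s + D
    · rw [Set.indicator_of_mem ((hmem r hr).2 h), Set.indicator_of_mem (Set.mem_Iio.2 h)]
    · rw [Set.indicator_of_notMem (fun h' => h ((hmem r hr).1 h')),
        Set.indicator_of_notMem (fun h' => h (Set.mem_Iio.1 h'))]
  rw [setIntegral_congr_fun measurableSet_Ioi e, setIntegral_indicator measurableSet_Iio,
    Set.Ioi_inter_Iio, ← integral_Ioc_eq_integral_Ioo,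
    ← intervalIntegral.integral_of_le (by linarith)]
  have hne : ∀ r ∈ Set.uIcc 0 (s + D), r • θ - w ≠ 0 := fun r hr => by
    rw [Set.uIcc_of_le (by linarith)] at hr
    exact sub_ne_zero.2 (hray r hr.1)
  have hc : Continuous fun r : ℝ => r • θ - w := by fun_prop
  -- The integrand is the derivative of `W d ‖r • θ - w‖`, whose argument is `‖w‖` at the start and
  -- `ρ` at the exit.
  rw [intervalIntegral.integral_eq_sub_of_hasDerivAt (f := fun r => W d ‖r • θ - w‖)]
  · simp [hend]
  · intro r hr
    have h1 := hasFDerivAt_W_norm hd (hne r hr)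
    have h2 : HasDerivAt (fun r : ℝ => r • θ - w) θ r := by
      simpa using ((hasDerivAt_id r).smul_const θ).sub_const w
    exact h1.comp_hasDerivAt r h2
  · refine ContinuousOn.intervalIntegrable fun r hr => ?_
    have : ContinuousAt (fun r : ℝ => coulombField d (r • θ - w)) r :=
      ContinuousAt.comp (f := fun r : ℝ => r • θ - w) (g := coulombField d)
        (continuousAt_coulombField (hne r hr)) hc.continuousAt
    exact (this.inner continuousAt_const).continuousWithinAt

/-- The mutual energy of two unit charges in a ball around the second. -/
lemma integral_inner_ball {d : ℕ} (hd : 2 ≤ d) {w : Pos d} (hw : w ≠ 0) {ρ : ℝ} (hρ : ‖w‖ < ρ)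
    (hi : IntegrableOn (fun z => (inner ℝ (coulombField d z) (coulombField d (z - w)) : ℝ))
      (Metric.ball w ρ)) :
    ∫ z in Metric.ball w ρ, inner ℝ (coulombField d z) (coulombField d (z - w))
      = kd d * (W d ρ - W d ‖w‖) := by
  rw [← integral_indicator measurableSet_ball, integral_polar hd (hi.integrable_indicator measurableSet_ball)]
  have key : ∀ᵐ θ : Metric.sphere (0 : Pos d) 1 ∂((volume : Measure (Pos d)).toSphere),
      ∫ r in Set.Ioi (0 : ℝ), r ^ (d - 1) * Set.indicator (Metric.ball w ρ)
        (fun z => (inner ℝ (coulombField d z) (coulombField d (z - w)) : ℝ)) (r • (θ : Pos d))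
      = cd d * (W d ρ - W d ‖w‖) := by
    filter_upwards [toSphere_ae_ray_ne hd hw] with θ hθ
    have hn : ‖(θ : Pos d)‖ = 1 := by simp
    -- The Jacobian `r ^ (d - 1)` times the field of the charge at the origin is `c_d θ`, which
    -- reduces the radial integral to the flux along the ray.
    rw [← integral_ray hd hρ hn hθ, ← integral_const_mul]
    refine setIntegral_congr_fun measurableSet_Ioi fun r hr => ?_
    have hr' : (0 : ℝ) < r := hr
    by_cases h : r • (θ : Pos d) ∈ Metric.ball w ρ
    · simp only [Set.indicator_of_mem h]
      rw [coulombField, norm_smul, hn, mul_one, Real.norm_of_nonneg hr'.le, smul_smul,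
        inner_smul_left, real_inner_comm, ← mul_assoc]
      congr 1
      obtain ⟨k, rfl⟩ : ∃ k, d = k + 1 := ⟨d - 1, by omega⟩
      simp only [Nat.add_sub_cancel, conj_trivial]
      field_simp
      ring
    · simp only [Set.indicator_of_notMem h, mul_zero]
  rw [integral_congr_ae key, integral_const, kd_eq, smul_eq_mul]
  ring

/-! ### Mutual energies in large balls around the origin. -/

section
variable {d : ℕ}

/-- The error made when a ball around a charge is replaced by a ball around the origin. -/
def shellError (d : ℕ) (R ρ : ℝ) : ℝ := 2 * (cd d / (ρ - 3 * R) ^ (d - 1) * (kd d * (2 * R)))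

lemma tendsto_shellError (hd : 2 ≤ d) (R : ℝ) : Tendsto (shellError d R) atTop (𝓝 0) := by
  have h1 : Tendsto (fun ρ : ℝ => ρ - 3 * R) atTop atTop := tendsto_atTop_add_const_right _ _ tendsto_id
  have h2 : Tendsto (fun ρ : ℝ => (ρ - 3 * R) ^ (d - 1)) atTop atTop :=
    (tendsto_pow_atTop (by omega)).comp h1
  have h3 := ((h2.const_div_atTop (cd d)).mul_const (kd d * (2 * R))).const_mul 2
  rw [zero_mul, mul_zero] at h3
  exact h3

/-- The region lies in the shell `ρ - R ≤ ‖y - b‖ < ρ + R`, over which the field of `b` has integral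
norm `k_d · 2R`. There `‖y - a‖ ≥ ρ - R - 2R`, which bounds the field of `a`. -/
lemma shell_estimate (hd : 2 ≤ d) {R ρ : ℝ} (hR : 0 ≤ R) (hρ : 3 * R < ρ) {a b : Pos d}
    (ha : ‖a‖ ≤ R) (hb : ‖b‖ ≤ R) {f : Pos d → ℝ} {A : Set (Pos d)}
    (hA : MeasurableSet A) (hAb : ∀ y ∈ A, ‖y - b‖ < ρ + R)
    (hf : ∀ y, |f y| ≤ ‖coulombField d (y - a)‖ * ‖coulombField d (y - b)‖) :
    |∫ y in A \ Metric.ball b (ρ - R), f y| ≤ shellError d R ρ / 2 := by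
  have hc := cd_pos hd
  have hu : 0 < ρ - R := by linarith
  obtain ⟨s1, s2⟩ := shell_norm_field hd hu (by linarith : ρ - R ≤ ρ + R)
  have mp := measurePreserving_sub_right (volume : Measure (Pos d)) b
  have me := (MeasurableEquiv.subRight b).measurableEmbedding
  set S : Set (Pos d) := {y | ‖y‖ ∈ Set.Ico (ρ - R) (ρ + R)}
  have i1 : IntegrableOn (fun y : Pos d => ‖coulombField d (y - b)‖) ((fun y => y - b) ⁻¹' S) :=
    (mp.integrableOn_comp_preimage me).2 s1
  have i2 : ∫ y in (fun y => y - b) ⁻¹' S, ‖coulombField d (y - b)‖ = kd d * (2 * R) := by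
    rw [mp.setIntegral_preimage_emb me (fun y => ‖coulombField d y‖), s2]; ring
  have hsub : A \ Metric.ball b (ρ - R) ⊆ (fun y => y - b) ⁻¹' S := fun y hy => by
    refine ⟨?_, hAb y hy.1⟩
    have := hy.2
    rw [mem_ball_iff_norm, not_lt] at this
    exact this
  have hms : MeasurableSet (A \ Metric.ball b (ρ - R)) := hA.diff measurableSet_ball
  set c := cd d / (ρ - 3 * R) ^ (d - 1)
  have hcpos : 0 ≤ c := by have : 0 < ρ - 3 * R := by linarith
                           positivity
  have hbound : ∀ y ∈ A \ Metric.ball b (ρ - R), ‖f y‖ ≤ c * ‖coulombField d (y - b)‖ := by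
    intro y hy
    refine (hf y).trans (mul_le_mul_of_nonneg_right ?_ (norm_nonneg _))
    rw [norm_coulombField hd]
    have h1 : ρ - R ≤ ‖y - b‖ := (hsub hy).1
    have h2 : ρ - 3 * R ≤ ‖y - a‖ := by
      have := norm_sub_norm_le (y - b) (a - b)
      rw [show y - b - (a - b) = y - a by abel] at this
      linarith [norm_sub_le a b]
    have : 0 < ρ - 3 * R := by linarith
    change _ ≤ cd d / (ρ - 3 * R) ^ (d - 1)
    gcongr
  calc _ ≤ ∫ y in A \ Metric.ball b (ρ - R), c * ‖coulombField d (y - b)‖ :=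
        norm_integral_le_of_norm_le ((i1.mono_set hsub).const_mul c)
          ((ae_restrict_iff' hms).2 (ae_of_all _ hbound))
    _ = c * ∫ y in A \ Metric.ball b (ρ - R), ‖coulombField d (y - b)‖ := integral_const_mul _ _
    _ ≤ c * ∫ y in (fun y => y - b) ⁻¹' S, ‖coulombField d (y - b)‖ := by
        refine mul_le_mul_of_nonneg_left ?_ hcpos
        exact setIntegral_mono_set i1 (ae_of_all _ fun y => norm_nonneg _) (LE.le.eventuallyLE hsub)
    _ = _ := by rw [i2, shellError]; ring

/-- Both balls contain `Metric.ball b (ρ - R)`, and each exceeds it by part of a shell; the factor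
`2` in `shellError` counts the two shells. -/
lemma ball_change_center (hd : 2 ≤ d) {R ρ : ℝ} (hR : 0 ≤ R) (hρ : 3 * R < ρ) {a b : Pos d}
    (ha : ‖a‖ ≤ R) (hb : ‖b‖ ≤ R) {f : Pos d → ℝ}
    (hf : ∀ y, |f y| ≤ ‖coulombField d (y - a)‖ * ‖coulombField d (y - b)‖)
    (hi : ∀ r, IntegrableOn f (Metric.ball 0 r)) :
    |(∫ y in Metric.ball 0 ρ, f y) - ∫ y in Metric.ball b ρ, f y| ≤ shellError d R ρ := by
  have hT1 : Metric.ball b (ρ - R) ⊆ Metric.ball 0 ρ := fun y hy => by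
    rw [mem_ball_iff_norm] at hy
    rw [mem_ball_zero_iff]
    have := norm_add_le (y - b) b
    rw [sub_add_cancel] at this
    linarith
  have hT2 : Metric.ball b (ρ - R) ⊆ Metric.ball b ρ := Metric.ball_subset_ball (by linarith)
  have hbi : IntegrableOn f (Metric.ball b ρ) := (hi (ρ + R)).mono_set fun y hy => by
    rw [mem_ball_iff_norm] at hy
    rw [mem_ball_zero_iff]
    have := norm_add_le (y - b) b
    rw [sub_add_cancel] at this
    linarith
  have e1 := setIntegral_sdiff measurableSet_ball (hi ρ) hT1
  have e2 := setIntegral_sdiff measurableSet_ball hbi hT2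
  have h1 := shell_estimate hd hR hρ ha hb (A := Metric.ball 0 ρ) measurableSet_ball
    (fun y hy => by
      rw [mem_ball_zero_iff] at hy
      linarith [norm_sub_le y b]) hf
  have h2 := shell_estimate hd hR hρ ha hb (A := Metric.ball b ρ) measurableSet_ball
    (fun y hy => by
      rw [mem_ball_iff_norm] at hy
      linarith) hf
  rw [e1] at h1
  rw [e2] at h2
  rw [abs_le] at *
  constructor <;> linarith

/-- The mutual energy in the ball of radius `ρ` around the origin of unit charges at `a`, `b`. -/
def pairEnergy (d : ℕ) (ρ : ℝ) (p : Pos d × Pos d) : ℝ :=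
  ∫ y in Metric.ball 0 ρ, inner ℝ (coulombField d (y - p.1)) (coulombField d (y - p.2))

lemma integrableOn_inner_pair (hd : 2 ≤ d) {a b : Pos d} (hab : a ≠ b) (ρ : ℝ) :
    IntegrableOn (fun y => (inner ℝ (coulombField d (y - a)) (coulombField d (y - b)) : ℝ))
      (Metric.ball 0 ρ) := by
  obtain ⟨C, -, h⟩ := integrableOn_norm_mul_norm hd (R := max ‖a‖ ‖b‖) (ρ := max ρ 1)
    (le_max_of_le_left (norm_nonneg _)) (lt_max_of_lt_right one_pos)
  have hm := measurable_coulombField d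
  have := (h a b (le_max_left _ _) (le_max_right _ _) hab).1.mono_set
    (Metric.ball_subset_ball (le_max_left ρ 1))
  refine this.mono' ?_ (ae_of_all _ fun y => norm_inner_le_norm _ _)
  exact (Measurable.inner (by fun_prop) (by fun_prop)).aestronglyMeasurable

/-- Translating one charge to the origin makes `integral_inner_ball` applicable on the ball around
the other; recentring then gives an error independent of `a` and `b`, so the estimate can be
integrated against measures. -/
lemma pairEnergy_estimate (hd : 2 ≤ d) {R ρ : ℝ} (hR : 0 ≤ R) (hρ : 3 * R < ρ) {a b : Pos d}
    (ha : ‖a‖ ≤ R) (hb : ‖b‖ ≤ R) (hab : a ≠ b) :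
    |pairEnergy d ρ (a, b) - kd d * (W d ρ - W d ‖a - b‖)| ≤ shellError d R ρ := by
  have hi := integrableOn_inner_pair hd hab
  have h1 := ball_change_center hd hR hρ ha hb
    (f := fun y => (inner ℝ (coulombField d (y - a)) (coulombField d (y - b)) : ℝ))
    (fun y => abs_real_inner_le_norm _ _) hi
  have hlt : ‖b - a‖ < ρ := by linarith [norm_sub_le b a]
  have mp := measurePreserving_sub_right (volume : Measure (Pos d)) a
  have me := (MeasurableEquiv.subRight a).measurableEmbedding
  have hpre : (fun y => y - a) ⁻¹' Metric.ball (b - a) ρ = Metric.ball b ρ := by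
    ext y; simp
  have hfe : (fun y => (inner ℝ (coulombField d (y - a)) (coulombField d (y - b)) : ℝ))
      = fun y => (fun z => (inner ℝ (coulombField d z) (coulombField d (z - (b - a))) : ℝ)) (y - a) := by
    ext y; simp
  have hbi : IntegrableOn (fun y => (inner ℝ (coulombField d (y - a)) (coulombField d (y - b)) : ℝ))
      (Metric.ball b ρ) := (hi (ρ + R)).mono_set fun y hy => by
    rw [mem_ball_iff_norm] at hy
    rw [mem_ball_zero_iff]
    have := norm_add_le (y - b) b
    rw [sub_add_cancel] at this
    linarith
  have h2 : ∫ y in Metric.ball b ρ, inner ℝ (coulombField d (y - a)) (coulombField d (y - b))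
      = kd d * (W d ρ - W d ‖b - a‖) := by
    rw [hfe, ← hpre, mp.setIntegral_preimage_emb me
      (fun z => (inner ℝ (coulombField d z) (coulombField d (z - (b - a))) : ℝ))]
    refine integral_inner_ball hd (sub_ne_zero.2 hab.symm) hlt ?_
    rw [hfe, ← hpre] at hbi
    exact (mp.integrableOn_comp_preimage me).1 hbi
  rw [h2, norm_sub_rev] at h1
  exact h1

variable {α β : Measure (Pos d)} [IsFiniteMeasure α] [IsFiniteMeasure β] {R : ℝ}

/-- Tonelli, integrating in space first: the spatial integral is at most `C (1 + |W|)`, which is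
integrable because the interaction is finite. Excluding the diagonal is essential, as the bound
fails there. -/
lemma integrable_inner_prod (hd : 2 ≤ d) (hR : 0 ≤ R) (hα : ∀ᵐ a ∂α, ‖a‖ ≤ R)
    (hβ : ∀ᵐ b ∂β, ‖b‖ ≤ R) (hne : ∀ᵐ p ∂(α.prod β), p.1 ≠ p.2)
    (hW : Integrable (fun p : Pos d × Pos d => W d ‖p.1 - p.2‖) (α.prod β)) {ρ : ℝ} (hρ : 0 < ρ) :
    Integrable (fun z : Pos d × (Pos d × Pos d) =>
      (inner ℝ (coulombField d (z.1 - z.2.1)) (coulombField d (z.1 - z.2.2)) : ℝ))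
      ((volume.restrict (Metric.ball 0 ρ)).prod (α.prod β)) := by
  have hm := measurable_coulombField d
  obtain ⟨C, hC, h⟩ := integrableOn_norm_mul_norm hd hR hρ
  have hα' : ∀ᵐ p ∂(α.prod β), ‖p.1‖ ≤ R := Measure.quasiMeasurePreserving_fst.ae hα
  have hβ' : ∀ᵐ p ∂(α.prod β), ‖p.2‖ ≤ R := Measure.quasiMeasurePreserving_snd.ae hβ
  have hg : Integrable (fun z : Pos d × (Pos d × Pos d) =>
      ‖coulombField d (z.1 - z.2.1)‖ * ‖coulombField d (z.1 - z.2.2)‖)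
      ((volume.restrict (Metric.ball 0 ρ)).prod (α.prod β)) := by
    have hmeas : AEStronglyMeasurable (fun z : Pos d × (Pos d × Pos d) =>
      ‖coulombField d (z.1 - z.2.1)‖ * ‖coulombField d (z.1 - z.2.2)‖)
      ((volume.restrict (Metric.ball 0 ρ)).prod (α.prod β)) := by
        exact (by fun_prop : Measurable _).aestronglyMeasurable
    rw [integrable_prod_iff' hmeas]
    constructor
    · filter_upwards [hα', hβ', hne] with p h1 h2 h3
      exact (h p.1 p.2 h1 h2 h3).1
    · refine (((integrable_const (1 : ℝ)).add hW.norm).const_mul C).mono'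
        hmeas.norm.prod_swap.integral_prod_right' ?_
      filter_upwards [hα', hβ', hne] with p h1 h2 h3
      rw [Real.norm_of_nonneg (integral_nonneg fun y => norm_nonneg _)]
      simp only [norm_mul, norm_norm]
      exact (h p.1 p.2 h1 h2 h3).2
  refine hg.mono' ?_ (ae_of_all _ fun z => norm_inner_le_norm _ _)
  exact (Measurable.inner (by fun_prop) (by fun_prop)).aestronglyMeasurable

lemma inner_field_ae (hd : 2 ≤ d) (hR : 0 ≤ R) (hα : ∀ᵐ a ∂α, ‖a‖ ≤ R)
    (hβ : ∀ᵐ b ∂β, ‖b‖ ≤ R) (hne : ∀ᵐ p ∂(α.prod β), p.1 ≠ p.2)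
    (hW : Integrable (fun p : Pos d × Pos d => W d ‖p.1 - p.2‖) (α.prod β)) {ρ : ℝ} (hρ : 0 < ρ) :
    ∀ᵐ y ∂(volume.restrict (Metric.ball 0 ρ)), inner ℝ (field α y) (field β y)
      = ∫ p, (inner ℝ (coulombField d (y - p.1)) (coulombField d (y - p.2)) : ℝ) ∂(α.prod β) := by
  have hm := (measurable_coulombField d).stronglyMeasurable
  have hf := locallyIntegrable_coulombField hd
  filter_upwards [(integrable_inner_prod hd hR hα hβ hne hW hρ).prod_right_ae,
    ae_restrict_of_ae (ae_integrable_kernel hm hf hα),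
    ae_restrict_of_ae (ae_integrable_kernel hm hf hβ)] with y h1 h2 h3
  rw [integral_prod _ h1]
  simp only
  simp_rw [integral_inner h3]
  rw [show (∫ b, coulombField d (y - b) ∂β) = field β y from rfl, real_inner_comm]
  rw [show field α y = ∫ a, coulombField d (y - a) ∂α from rfl, ← integral_inner h2]
  simp_rw [real_inner_comm]

/-- The interaction of two measures. -/
def interactionEnergy (α β : Measure (Pos d)) : ℝ := ∫ p, W d ‖p.1 - p.2‖ ∂(α.prod β)

lemma integrableOn_inner_field (hd : 2 ≤ d) (hR : 0 ≤ R) (hα : ∀ᵐ a ∂α, ‖a‖ ≤ R)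
    (hβ : ∀ᵐ b ∂β, ‖b‖ ≤ R) (hne : ∀ᵐ p ∂(α.prod β), p.1 ≠ p.2)
    (hW : Integrable (fun p : Pos d × Pos d => W d ‖p.1 - p.2‖) (α.prod β)) {ρ : ℝ} (hρ : 0 < ρ) :
    IntegrableOn (fun y => (inner ℝ (field α y) (field β y) : ℝ)) (Metric.ball 0 ρ) :=
  ((integrable_inner_prod hd hR hα hβ hne hW hρ).integral_prod_left).congr
    ((inner_field_ae hd hR hα hβ hne hW hρ).mono fun _ h => h.symm)

/-- The mutual energy of two charge distributions in a large ball, up to the energy at infinity, is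
their interaction. -/
lemma tendsto_mutual_energy (hd : 2 ≤ d) (hR : 0 ≤ R) (hα : ∀ᵐ a ∂α, ‖a‖ ≤ R)
    (hβ : ∀ᵐ b ∂β, ‖b‖ ≤ R) (hne : ∀ᵐ p ∂(α.prod β), p.1 ≠ p.2)
    (hW : Integrable (fun p : Pos d × Pos d => W d ‖p.1 - p.2‖) (α.prod β)) :
    Tendsto (fun ρ => (∫ y in Metric.ball 0 ρ, inner ℝ (field α y) (field β y))
      - kd d * W d ρ * (α.real Set.univ * β.real Set.univ)) atTop
      (𝓝 (-(kd d * interactionEnergy α β))) := by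
  have hα' : ∀ᵐ p ∂(α.prod β), ‖p.1‖ ≤ R := Measure.quasiMeasurePreserving_fst.ae hα
  have hβ' : ∀ᵐ p ∂(α.prod β), ‖p.2‖ ≤ R := Measure.quasiMeasurePreserving_snd.ae hβ
  rw [tendsto_iff_norm_sub_tendsto_zero]
  have hlim : Tendsto (fun ρ => shellError d R ρ * (α.prod β).real Set.univ) atTop (𝓝 0) := by
    simpa using (tendsto_shellError hd R).mul_const ((α.prod β).real Set.univ)
  refine squeeze_zero' (Eventually.of_forall fun ρ => norm_nonneg _) ?_ hlim
  filter_upwards [eventually_gt_atTop (3 * R)] with ρ hρ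
  have hρ0 : 0 < ρ := by linarith
  have hI := integrable_inner_prod hd hR hα hβ hne hW hρ0
  have e1 : ∫ y in Metric.ball 0 ρ, inner ℝ (field α y) (field β y)
      = ∫ p, pairEnergy d ρ p ∂(α.prod β) := by
    rw [integral_congr_ae (inner_field_ae hd hR hα hβ hne hW hρ0)]
    exact integral_integral_swap hI
  have hpi : Integrable (pairEnergy d ρ) (α.prod β) := hI.integral_prod_right
  have e2 : (∫ y in Metric.ball 0 ρ, inner ℝ (field α y) (field β y))
      - kd d * W d ρ * (α.real Set.univ * β.real Set.univ) - -(kd d * interactionEnergy α β)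
      = ∫ p, (pairEnergy d ρ p - kd d * (W d ρ - W d ‖p.1 - p.2‖)) ∂(α.prod β) := by
    have hsub : Integrable (fun p : Pos d × Pos d => kd d * (W d ρ - W d ‖p.1 - p.2‖)) (α.prod β) :=
      ((integrable_const (W d ρ)).sub hW).const_mul (kd d)
    rw [e1, integral_sub hpi hsub, integral_const_mul,
      integral_sub (integrable_const _) hW, integral_const, ← Set.univ_prod_univ,
      measureReal_prod_prod, interactionEnergy, smul_eq_mul]
    ring
  rw [e2]
  refine norm_integral_le_of_norm_le_const ?_
  filter_upwards [hα', hβ', hne] with p h1 h2 h3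
  exact pairEnergy_estimate hd hR hρ h1 h2 h3

end

/-! ### Self-energies of point charges, near and far. -/

section
variable {d N : ℕ} {qmin qmax : ℝ}

lemma setIntegral_translate {E : Type*} [NormedAddCommGroup E] [NormedSpace ℝ E] (p : Pos d)
    (S : Set (Pos d)) (f : Pos d → E) :
    ∫ y in (fun y => y - p) ⁻¹' S, f (y - p) = ∫ y in S, f y :=
  (measurePreserving_sub_right (volume : Measure (Pos d)) p).setIntegral_preimage_emb
    (MeasurableEquiv.subRight p).measurableEmbedding f S

lemma integrableOn_translate {E : Type*} [NormedAddCommGroup E] (p : Pos d)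
    (S : Set (Pos d)) (f : Pos d → E) :
    IntegrableOn (fun y => f (y - p)) ((fun y => y - p) ⁻¹' S) ↔ IntegrableOn f S :=
  (measurePreserving_sub_right (volume : Measure (Pos d)) p).integrableOn_comp_preimage
    (MeasurableEquiv.subRight p).measurableEmbedding

lemma field_dirac (p y : Pos d) : field (Measure.dirac p) y = coulombField d (y - p) := by
  rw [field, integral_dirac]

lemma interactionEnergy_dirac_left (p : Pos d) (β : Measure (Pos d)) [SFinite β] :
    interactionEnergy (Measure.dirac p) β = pot β p := by
  have h : StronglyMeasurable fun p : Pos d × Pos d => W d ‖p.1 - p.2‖ :=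
    stronglyMeasurable_W_norm.comp_measurable (by fun_prop)
  rw [interactionEnergy, Measure.dirac_prod, integral_map (by fun_prop) h.aestronglyMeasurable]
  rfl

lemma pot_dirac (p y : Pos d) : pot (Measure.dirac p) y = W d ‖y - p‖ := by
  rw [pot, integral_dirac]

/-- The squared field of a point charge outside a ball around it. -/
def outerEnergy (δ : ℝ) (p y : Pos d) : ℝ :=
  Set.indicator {y | δ ≤ ‖y - p‖} (fun y => ‖coulombField d (y - p)‖ ^ 2) y

/-- The squared field of a point charge inside a ball around it. -/
def innerEnergy (δ : ℝ) (p y : Pos d) : ℝ :=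
  Set.indicator {y | ‖y - p‖ < δ} (fun y => ‖coulombField d (y - p)‖ ^ 2) y

lemma innerEnergy_add_outerEnergy (δ : ℝ) (p y : Pos d) :
    innerEnergy δ p y + outerEnergy δ p y = ‖coulombField d (y - p)‖ ^ 2 := by
  by_cases h : ‖y - p‖ < δ
  · simp [innerEnergy, outerEnergy, h]
  · simp [innerEnergy, outerEnergy, h, not_lt.1 h]

lemma integrableOn_outerEnergy (hd : 2 ≤ d) {δ : ℝ} (hδ : 0 < δ) (p : Pos d) (r : ℝ) :
    IntegrableOn (outerEnergy δ p) (Metric.ball 0 r) := by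
  have hc := cd_pos hd
  have hm := measurable_coulombField d
  have h1 : IntegrableOn (fun y => coulombField d (y - p)) (Metric.ball 0 r) := by
    refine ((integrableOn_translate p (Metric.ball 0 (r + ‖p‖)) (coulombField d)).2
      (integrableOn_ball_of_locallyIntegrable (locallyIntegrable_coulombField hd) 0 _)).mono_set fun y hy => ?_
    rw [mem_ball_zero_iff] at hy
    rw [Set.mem_preimage, mem_ball_zero_iff]
    linarith [norm_sub_le y p]
  refine (h1.norm.const_mul (cd d / δ ^ (d - 1))).mono' ?_ (ae_of_all _ fun y => ?_)
  · exact (Measurable.indicator (by fun_prop)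
      (measurableSet_le measurable_const (by fun_prop))).aestronglyMeasurable
  · by_cases h : δ ≤ ‖y - p‖
    · rw [outerEnergy, Set.indicator_of_mem (by exact h), norm_pow, norm_norm, sq]
      refine mul_le_mul_of_nonneg_right ?_ (norm_nonneg _)
      rw [norm_coulombField hd]
      gcongr
    · rw [outerEnergy, Set.indicator_of_notMem (by exact h), norm_zero]
      positivity

/-- On balls centred at `p` this is an annulus energy, hence exact; the change of centre is
`ball_change_center` with both charges at `p`. -/
lemma tendsto_outerEnergy (hd : 2 ≤ d) {δ : ℝ} (hδ : 0 < δ) (p : Pos d) :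
    Tendsto (fun ρ => (∫ y in Metric.ball 0 ρ, outerEnergy δ p y) - kd d * W d ρ) atTop
      (𝓝 (-(kd d * W d δ))) := by
  have hi := integrableOn_outerEnergy hd hδ p
  rw [tendsto_iff_norm_sub_tendsto_zero]
  refine squeeze_zero' (Eventually.of_forall fun ρ => norm_nonneg _) ?_ (tendsto_shellError hd ‖p‖)
  filter_upwards [eventually_gt_atTop (3 * ‖p‖), eventually_ge_atTop δ] with ρ hρ hδρ
  have h1 := ball_change_center hd (norm_nonneg p) hρ le_rfl le_rfl (f := outerEnergy δ p)
    (fun y => by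
      rw [outerEnergy, ← sq, abs_of_nonneg (Set.indicator_nonneg (fun _ _ => by positivity) _)]
      exact Set.indicator_le_self' (fun _ _ => by positivity) _) hi
  have h2 : ∫ y in Metric.ball p ρ, outerEnergy δ p y = kd d * (W d ρ - W d δ) := by
    rw [← (annulus_energy hd hδ hδρ).2,
      ← setIntegral_translate p {y | ‖y‖ ∈ Set.Ico δ ρ} (fun y => ‖coulombField d y‖ ^ 2)]
    unfold outerEnergy
    rw [setIntegral_indicator (measurableSet_le measurable_const (by fun_prop))]
    congr 2
    ext y
    simp only [Set.mem_inter_iff, mem_ball_iff_norm, Set.mem_ofPred_eq, Set.mem_preimage, Set.mem_Ico]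
    exact and_comm
  rw [h2] at h1
  rw [Real.norm_eq_abs]
  convert h1 using 2
  ring

lemma mem_perforated {p : Fin N → Pos d} {η : ℝ} {y : Pos d} :
    y ∈ perforated p η ↔ ∀ i, η ≤ ‖y - p i‖ := by
  simp [perforated, dist_eq_norm]

lemma measurableSet_perforated (p : Fin N → Pos d) (η : ℝ) : MeasurableSet (perforated p η) :=
  (MeasurableSet.iUnion fun _ => measurableSet_ball).compl

/-- By the separation, a point within `δ` of `p i` is at distance at least `δ ≥ η` from the other
charges. So only the hole around `p i` itself is cut out and an annulus remains. -/
lemma perforated_innerEnergy (hd : 2 ≤ d) {p : Fin N → Pos d} {δ : ℝ}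
    (hsep : ∀ i j, i ≠ j → 2 * δ ≤ ‖p i - p j‖) {η : ℝ} (hη : 0 < η) (hηδ : η ≤ δ) (i : Fin N) :
    IntegrableOn (innerEnergy δ (p i)) (perforated p η) ∧
    ∫ y in perforated p η, innerEnergy δ (p i) y = kd d * (W d δ - W d η) := by
  obtain ⟨h1, h2⟩ := annulus_energy hd hη hηδ
  have hset : perforated p η ∩ {y | ‖y - p i‖ < δ}
      = (fun y => y - p i) ⁻¹' {y | ‖y‖ ∈ Set.Ico η δ} := by
    ext y
    simp only [Set.mem_inter_iff, mem_perforated, Set.mem_ofPred_eq, Set.mem_preimage, Set.mem_Ico]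
    refine ⟨fun h => ⟨h.1 i, h.2⟩, fun h => ⟨fun j => ?_, h.2⟩⟩
    rcases eq_or_ne j i with rfl | hj
    · exact h.1
    · have h3 := hsep j i hj
      have h4 := norm_sub_le (y - p i) (y - p j)
      rw [show y - p i - (y - p j) = p j - p i by abel] at h4
      linarith [h.2]
  have hms : MeasurableSet {y : Pos d | ‖y - p i‖ < δ} :=
    measurableSet_lt (by fun_prop) measurable_const
  constructor
  · have : IntegrableOn (fun y => ‖coulombField d (y - p i)‖ ^ 2)
        (perforated p η ∩ {y | ‖y - p i‖ < δ}) := by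
      rw [hset]
      exact (integrableOn_translate (p i) _ (fun y => ‖coulombField d y‖ ^ 2)).2 h1
    rw [Set.inter_comm, IntegrableOn, ← Measure.restrict_restrict hms] at this
    exact IntegrableOn.integrable_indicator this hms
  · unfold innerEnergy
    rw [setIntegral_indicator hms, hset,
      setIntegral_translate (p i) _ (fun y => ‖coulombField d y‖ ^ 2), h2]

lemma exists_separation {p : Fin N → Pos d} (hp : Function.Injective p) :
    ∃ δ : ℝ, 0 < δ ∧ ∀ i j, i ≠ j → 2 * δ ≤ ‖p i - p j‖ := by
  have h : ∀ᶠ δ : ℝ in 𝓝[>] 0, ∀ i j, i ≠ j → 2 * δ ≤ ‖p i - p j‖ := by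
    refine eventually_all.2 fun i => eventually_all.2 fun j => ?_
    by_cases hij : i = j
    · exact Eventually.of_forall fun _ h => absurd hij h
    · have hpos : 0 < ‖p i - p j‖ / 2 := by
        have := norm_pos_iff.2 (sub_ne_zero.2 (hp.ne hij))
        positivity
      filter_upwards [Ioc_mem_nhdsGT hpos] with δ hδ _
      linarith [hδ.2]
  obtain ⟨δ, h1, h2⟩ := (h.and self_mem_nhdsWithin).exists
  exact ⟨δ, h2, h1⟩

/-- The only place where the energy at infinity is disposed of: for `d = 2` the coefficient
vanishes, for `d ≥ 3` the kernel decays. -/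
lemma tendsto_W_mul_zero (hd : 2 ≤ d) {s : ℝ} (hs : d = 2 → s = 0) :
    Tendsto (fun ρ => kd d * W d ρ * s) atTop (𝓝 0) := by
  by_cases h : d = 2
  · simp [hs h]
  · have : Tendsto (W d) atTop (𝓝 0) := by
      unfold W
      simp only [h, if_false]
      have h2 : Tendsto (fun ρ : ℝ => ρ ^ (d - 2)) atTop atTop := tendsto_pow_atTop (by omega)
      simpa using (h2.const_div_atTop 1).neg
    simpa using (this.const_mul (kd d)).mul_const s

lemma tendsto_setIntegral_perforated {p : Fin N → Pos d} (hd : 2 ≤ d) {h : Pos d → ℝ}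
    (hi : Integrable h volume) :
    Tendsto (fun η => ∫ y in perforated p η, h y) (𝓝[>] 0) (𝓝 (∫ y, h y)) := by
  simp_rw [← integral_indicator (measurableSet_perforated p _)]
  refine tendsto_integral_filter_of_dominated_convergence (fun y => ‖h y‖) ?_ ?_ hi.norm ?_
  · exact Eventually.of_forall fun η =>
      hi.aestronglyMeasurable.indicator (measurableSet_perforated p _)
  · exact Eventually.of_forall fun η => ae_of_all _ fun y => norm_indicator_le_norm_self _ _
  · filter_upwards [ae_all_iff.2 fun i => ae_ne_point hd (p i)] with y hy
    refine tendsto_const_nhds.congr' ?_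
    have : ∀ᶠ η : ℝ in 𝓝[>] 0, ∀ i, η ≤ ‖y - p i‖ := by
      refine eventually_all.2 fun i => ?_
      filter_upwards [Ioc_mem_nhdsGT (norm_pos_iff.2 (sub_ne_zero.2 (hy i)))] with η hη
      exact hη.2
    filter_upwards [this] with η hη
    rw [Set.indicator_of_mem (mem_perforated.2 hη)]

end

/-! ### The renormalized energy of point charges in a background. -/

section
variable {d N : ℕ} {qmin qmax : ℝ}

/-- The field of point charges in a background. -/
def particleField (q : Fin N → ℝ) (p : Fin N → Pos d) (β : Measure (Pos d)) (y : Pos d) : Pos d :=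
  (∑ i, q i • coulombField d (y - p i)) - field β y

/-- The interaction of point charges and a background, without the self-energies of the charges. -/
def offDiagonalEnergy (q : Fin N → ℝ) (p : Fin N → Pos d) (β : Measure (Pos d)) : ℝ :=
  (∑ i, ∑ j ∈ Finset.univ.erase i, q i * q j * W d ‖p i - p j‖)
    - 2 * ∑ i, q i * pot β (p i) + interactionEnergy β β

/-- The squared field without its singular part near the point charges. -/
def regularEnergy (δ : ℝ) (q : Fin N → ℝ) (p : Fin N → Pos d) (β : Measure (Pos d)) (y : Pos d) : ℝ :=
  (∑ i, q i ^ 2 * outerEnergy δ (p i) y)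
    + (∑ i, ∑ j ∈ Finset.univ.erase i, q i * q j *
        inner ℝ (field (Measure.dirac (p i)) y) (field (Measure.dirac (p j)) y))
    - 2 * (∑ i, q i * inner ℝ (field (Measure.dirac (p i)) y) (field β y))
    + inner ℝ (field β y) (field β y)

lemma norm_sq_particleField (δ : ℝ) (q : Fin N → ℝ) (p : Fin N → Pos d) (β : Measure (Pos d))
    (y : Pos d) : ‖particleField q p β y‖ ^ 2
      = regularEnergy δ q p β y + ∑ i, q i ^ 2 * innerEnergy δ (p i) y := by
  have h1 : ‖∑ i, q i • coulombField d (y - p i)‖ ^ 2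
      = (∑ i, q i ^ 2 * ‖coulombField d (y - p i)‖ ^ 2)
        + ∑ i, ∑ j ∈ Finset.univ.erase i, q i * q j *
          inner ℝ (coulombField d (y - p i)) (coulombField d (y - p j)) := by
    rw [← real_inner_self_eq_norm_sq, sum_inner, ← Finset.sum_add_distrib]
    refine Finset.sum_congr rfl fun i _ => ?_
    rw [inner_sum, ← Finset.add_sum_erase _ _ (Finset.mem_univ i)]
    simp only [inner_smul_left, inner_smul_right, real_inner_self_eq_norm_sq, conj_trivial]
    congr 1
    · ring
    · exact Finset.sum_congr rfl fun j _ => by ring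
  have h2 : ∑ i, q i ^ 2 * ‖coulombField d (y - p i)‖ ^ 2
      = ∑ i, q i ^ 2 * outerEnergy δ (p i) y + ∑ i, q i ^ 2 * innerEnergy δ (p i) y := by
    rw [← Finset.sum_add_distrib]
    refine Finset.sum_congr rfl fun i _ => ?_
    rw [← innerEnergy_add_outerEnergy δ]; ring
  rw [particleField, norm_sub_sq_real, h1, h2, regularEnergy, sum_inner, real_inner_self_eq_norm_sq]
  simp only [field_dirac, inner_smul_left, conj_trivial]
  ring

lemma dirac_prod_dirac_ae {a b : Pos d} {P : Pos d × Pos d → Prop} (h : P (a, b)) :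
    ∀ᵐ z ∂((Measure.dirac a).prod (Measure.dirac b)), P z := by
  rw [Measure.dirac_prod_dirac, ae_dirac_eq]
  exact h

variable {β : Measure (Pos d)} [IsFiniteMeasure β] {R : ℝ} {q : Fin N → ℝ} {p : Fin N → Pos d}

/-- Every term of the expanded square contributes `k_d W ρ` times a product of charges plus a
convergent remainder. The products add up to the square of the total charge. -/
lemma regularEnergy_asymptotics (hd : 2 ≤ d) (hR : 0 ≤ R) (hp : Function.Injective p)
    (hpR : ∀ i, ‖p i‖ ≤ R) (hβ : ∀ᵐ b ∂β, ‖b‖ ≤ R) (hne : ∀ᵐ z ∂(β.prod β), z.1 ≠ z.2)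
    (hW : Integrable (fun z : Pos d × Pos d => W d ‖z.1 - z.2‖) (β.prod β))
    (hpot : ∀ y, Integrable (fun b => W d ‖y - b‖) β) (hpne : ∀ y, ∀ᵐ b ∂β, y ≠ b)
    (hneutral : d = 2 → ∑ i, q i = β.real Set.univ) {δ : ℝ} (hδ : 0 < δ) :
    (∀ ρ, IntegrableOn (regularEnergy δ q p β) (Metric.ball 0 ρ)) ∧
    Tendsto (fun ρ => ∫ y in Metric.ball 0 ρ, regularEnergy δ q p β y) atTop
      (𝓝 (-(kd d * (offDiagonalEnergy q p β + W d δ * ∑ i, q i ^ 2)))) := by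
  have hdirac : ∀ i, ∀ᵐ a ∂(Measure.dirac (p i)), ‖a‖ ≤ R := fun i => by
    rw [ae_dirac_eq]; exact hpR i
  have hWm : StronglyMeasurable fun z : Pos d × Pos d => W d ‖z.1 - z.2‖ :=
    stronglyMeasurable_W_norm.comp_measurable (by fun_prop)
  -- pairs of particles
  have hpp : ∀ i j, i ≠ j →
      (∀ᵐ z ∂((Measure.dirac (p i)).prod (Measure.dirac (p j))), z.1 ≠ z.2) ∧
      Integrable (fun z : Pos d × Pos d => W d ‖z.1 - z.2‖)
        ((Measure.dirac (p i)).prod (Measure.dirac (p j))) := fun i j hij =>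
    ⟨dirac_prod_dirac_ae (hp.ne hij), by
      rw [Measure.dirac_prod_dirac]
      exact integrable_dirac (by simp)⟩
  have hpb : ∀ i, (∀ᵐ z ∂((Measure.dirac (p i)).prod β), z.1 ≠ z.2) ∧
      Integrable (fun z : Pos d × Pos d => W d ‖z.1 - z.2‖) ((Measure.dirac (p i)).prod β) := by
    intro i
    rw [Measure.dirac_prod]
    constructor
    · have hms : MeasurableSet {z : Pos d × Pos d | z.1 ≠ z.2} :=
        (measurableSet_eq_fun measurable_fst measurable_snd).compl
      rw [ae_map_iff measurable_prodMk_left.aemeasurable hms]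
      exact hpne (p i)
    · rw [integrable_map_measure hWm.aestronglyMeasurable (by fun_prop)]
      exact hpot (p i)
  have intO := fun i => integrableOn_outerEnergy hd hδ (p i)
  have limO := fun i => tendsto_outerEnergy hd hδ (p i)
  have intPP := fun i j hij ρ hρ => integrableOn_inner_field (ρ := ρ) hd hR (hdirac i) (hdirac j)
    (hpp i j hij).1 (hpp i j hij).2 hρ
  have limPP := fun i j hij => tendsto_mutual_energy hd hR (hdirac i) (hdirac j)
    (hpp i j hij).1 (hpp i j hij).2
  have intPB := fun i ρ hρ => integrableOn_inner_field (ρ := ρ) hd hR (hdirac i) hβ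
    (hpb i).1 (hpb i).2 hρ
  have limPB := fun i => tendsto_mutual_energy hd hR (hdirac i) hβ (hpb i).1 (hpb i).2
  have intBB := fun ρ hρ => integrableOn_inner_field (ρ := ρ) hd hR hβ hβ hne hW hρ
  have limBB := tendsto_mutual_energy hd hR hβ hβ hne hW
  simp only [interactionEnergy_dirac_left, pot_dirac, probReal_univ, one_mul, mul_one] at limPP limPB
  have i1 : ∀ ρ, IntegrableOn (fun y => ∑ i, q i ^ 2 * outerEnergy δ (p i) y) (Metric.ball 0 ρ) :=
    fun ρ => integrable_finsetSum _ fun i _ => (intO i ρ).const_mul _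
  have i2 : ∀ ρ, 0 < ρ → IntegrableOn (fun y => ∑ i, ∑ j ∈ Finset.univ.erase i, q i * q j *
        inner ℝ (field (Measure.dirac (p i)) y) (field (Measure.dirac (p j)) y)) (Metric.ball 0 ρ) :=
    fun ρ hρ => integrable_finsetSum _ fun i _ => integrable_finsetSum _ fun j hj =>
      (intPP i j (Finset.ne_of_mem_erase hj).symm ρ hρ).const_mul _
  have i3 : ∀ ρ, 0 < ρ → IntegrableOn (fun y => 2 * (∑ i, q i *
      inner ℝ (field (Measure.dirac (p i)) y) (field β y))) (Metric.ball 0 ρ) :=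
    fun ρ hρ => (integrable_finsetSum _ fun i _ => (intPB i ρ hρ).const_mul _).const_mul _
  have int : ∀ ρ, 0 < ρ → IntegrableOn (regularEnergy δ q p β) (Metric.ball 0 ρ) := fun ρ hρ =>
    (((i1 ρ).add (i2 ρ hρ)).sub (i3 ρ hρ)).add (intBB ρ hρ)
  refine ⟨fun ρ => (int (max ρ 1) (lt_max_of_lt_right one_pos)).mono_set
    (Metric.ball_subset_ball (le_max_left _ _)), ?_⟩
  set b := β.real Set.univ
  -- The individual limits, each with its divergence subtracted. The last summand restores all the
  -- subtracted divergences at once and tends to zero.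
  have hlim := ((((tendsto_finsetSum Finset.univ fun i _ => (limO i).const_mul (q i ^ 2)).add
    (tendsto_finsetSum Finset.univ fun i _ => tendsto_finsetSum (Finset.univ.erase i) fun j hj =>
      (limPP i j (Finset.ne_of_mem_erase hj).symm).const_mul (q i * q j))).sub
    ((tendsto_finsetSum Finset.univ fun i _ => (limPB i).const_mul (q i)).const_mul 2)).add
      limBB).add (tendsto_W_mul_zero hd (s := (∑ i, q i - b) ^ 2) fun h => by
        rw [hneutral h, sub_self, zero_pow two_ne_zero])
  have hsq : (∑ i, q i) * (∑ i, q i) = ∑ i, q i ^ 2 + ∑ i, ∑ j ∈ Finset.univ.erase i, q i * q j := by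
    rw [Finset.sum_mul_sum, ← Finset.sum_add_distrib]
    refine Finset.sum_congr rfl fun i _ => ?_
    rw [← Finset.add_sum_erase _ _ (Finset.mem_univ i)]
    ring
  refine (hlim.congr' ?_).trans_eq ?_
  · filter_upwards [eventually_gt_atTop 0] with ρ hρ
    have e : ∫ y in Metric.ball 0 ρ, regularEnergy δ q p β y
        = (∑ i, q i ^ 2 * ∫ y in Metric.ball 0 ρ, outerEnergy δ (p i) y)
          + (∑ i, ∑ j ∈ Finset.univ.erase i, q i * q j * ∫ y in Metric.ball 0 ρ,
            inner ℝ (field (Measure.dirac (p i)) y) (field (Measure.dirac (p j)) y))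
          - 2 * (∑ i, q i * ∫ y in Metric.ball 0 ρ,
            inner ℝ (field (Measure.dirac (p i)) y) (field β y))
          + ∫ y in Metric.ball 0 ρ, inner ℝ (field β y) (field β y) := by
      have hsplit := integral_add' (((i1 ρ).add (i2 ρ hρ)).sub (i3 ρ hρ)) (intBB ρ hρ)
      rw [integral_sub' ((i1 ρ).add (i2 ρ hρ)) (i3 ρ hρ), integral_add' (i1 ρ) (i2 ρ hρ)] at hsplit
      refine hsplit.trans ?_
      rw [
        integral_finsetSum _ fun i _ => (intO i ρ).const_mul _,
        integral_finsetSum _ fun i _ => integrable_finsetSum _ fun j hj =>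
          (intPP i j (Finset.ne_of_mem_erase hj).symm ρ hρ).const_mul _,
        integral_const_mul,
        integral_finsetSum _ fun i _ => (intPB i ρ hρ).const_mul _]
      simp only [integral_const_mul]
      congr 3
      refine Finset.sum_congr rfl fun i _ => ?_
      rw [integral_finsetSum _ fun j hj =>
          (intPP i j (Finset.ne_of_mem_erase hj).symm ρ hρ).const_mul _]
      simp only [integral_const_mul]
    rw [e]
    simp only [mul_sub, Finset.sum_sub_distrib, ← Finset.sum_mul]
    have : (∑ i, q i - b) ^ 2 = (∑ i, q i) * (∑ i, q i) - 2 * (∑ i, q i) * b + b * b := by ring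
    rw [this, hsq]
    simp only [← mul_assoc]
    ring
  · congr 1
    rw [offDiagonalEnergy]
    simp only [mul_neg, Finset.sum_neg_distrib, mul_left_comm _ (kd d), ← Finset.mul_sum]
    rw [← Finset.sum_mul]
    ring

end

section
variable {d N : ℕ} {qmin qmax : ℝ}
variable {β : Measure (Pos d)} [IsFiniteMeasure β] {R : ℝ} {q : Fin N → ℝ} {p : Fin N → Pos d}

/-- Convergence of the integrals over balls alone does not give integrability. Away from the
particles, however, `regularEnergy` is the squared field and hence nonnegative, so convergence there
implies integrability. -/
lemma regularEnergy_integral (hd : 2 ≤ d) (hR : 0 ≤ R) (hp : Function.Injective p)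
    (hpR : ∀ i, ‖p i‖ ≤ R) (hβ : ∀ᵐ b ∂β, ‖b‖ ≤ R) (hne : ∀ᵐ z ∂(β.prod β), z.1 ≠ z.2)
    (hW : Integrable (fun z : Pos d × Pos d => W d ‖z.1 - z.2‖) (β.prod β))
    (hpot : ∀ y, Integrable (fun b => W d ‖y - b‖) β) (hpne : ∀ y, ∀ᵐ b ∂β, y ≠ b)
    (hneutral : d = 2 → ∑ i, q i = β.real Set.univ) {δ : ℝ} (hδ : 0 < δ) :
    Integrable (regularEnergy δ q p β) volume ∧
    ∫ y, regularEnergy δ q p β y = -(kd d * (offDiagonalEnergy q p β + W d δ * ∑ i, q i ^ 2)) := by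
  obtain ⟨hi, hlim⟩ := regularEnergy_asymptotics hd hR hp hpR hβ hne hW hpot hpne hneutral hδ
  set B : Set (Pos d) := Metric.ball 0 (R + δ)
  have hB : MeasurableSet B := measurableSet_ball
  have hnn : ∀ y, 0 ≤ Set.indicator Bᶜ (regularEnergy δ q p β) y := by
    refine fun y => Set.indicator_nonneg (fun y hy => ?_) y
    have h0 : ∀ i, innerEnergy δ (p i) y = 0 := fun i => by
      refine Set.indicator_of_notMem (fun h => hy ?_) _
      have h' : ‖y - p i‖ < δ := h
      rw [mem_ball_zero_iff]
      have := norm_add_le (y - p i) (p i)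
      rw [sub_add_cancel] at this
      linarith [hpR i]
    have := norm_sq_particleField δ q p β y
    simp only [h0, mul_zero, Finset.sum_const_zero, add_zero] at this
    rw [← this]
    positivity
  have hout : Integrable (Set.indicator Bᶜ (regularEnergy δ q p β)) volume := by
    refine (aecover_ball (x := (0 : Pos d)) tendsto_id).integrable_of_integral_tendsto_of_nonneg_ae
      (-(kd d * (offDiagonalEnergy q p β + W d δ * ∑ i, q i ^ 2)) -
        ∫ y in B, regularEnergy δ q p β y) (fun ρ => (hi ρ).indicator hB.compl)
      (ae_of_all _ hnn) ((hlim.sub_const _).congr' ?_)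
    filter_upwards [eventually_ge_atTop (R + δ)] with ρ hρ
    have hsub : B ⊆ Metric.ball 0 ρ := Metric.ball_subset_ball hρ
    rw [setIntegral_indicator hB.compl, ← Set.sdiff_eq, id, setIntegral_sdiff hB (hi ρ) hsub]
  have hint : Integrable (regularEnergy δ q p β) volume := by
    rw [← integrableOn_univ, ← Set.union_compl_self B]
    exact (hi _).union ((integrable_indicator_iff hB.compl).1 hout)
  exact ⟨hint, (aecover_ball (x := (0 : Pos d)) tendsto_id).integral_eq_of_tendsto _ hint hlim⟩

/-- The renormalized energy of point charges in a background. -/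
theorem hasRenormalizedEnergy_particleField {q : Fin N → Charge qmin qmax} (hd : 2 ≤ d)
    (hR : 0 ≤ R) (hp : Function.Injective p)
    (hpR : ∀ i, ‖p i‖ ≤ R) (hβ : ∀ᵐ b ∂β, ‖b‖ ≤ R) (hne : ∀ᵐ z ∂(β.prod β), z.1 ≠ z.2)
    (hW : Integrable (fun z : Pos d × Pos d => W d ‖z.1 - z.2‖) (β.prod β))
    (hpot : ∀ y, Integrable (fun b => W d ‖y - b‖) β) (hpne : ∀ y, ∀ᵐ b ∂β, y ≠ b)
    (hneutral : d = 2 → ∑ i, (q i : ℝ) = β.real Set.univ) :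
    HasRenormalizedEnergy q p (particleField (fun i => (q i : ℝ)) p β) (fun _ => 1)
      (-(kd d * offDiagonalEnergy (fun i => (q i : ℝ)) p β)) := by
  obtain ⟨δ, hδ, hsep⟩ := exists_separation hp
  obtain ⟨hint, hval⟩ := regularEnergy_integral hd hR hp hpR hβ hne hW hpot hpne hneutral hδ
  have hI : ∀ η, 0 < η → η ≤ δ → Integrable (fun y => ∑ i, (q i : ℝ) ^ 2 * innerEnergy δ (p i) y)
      (volume.restrict (perforated p η)) := fun η h1 h2 =>
    integrable_finsetSum _ fun i _ => (perforated_innerEnergy hd hsep h1 h2 i).1.const_mul _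
  constructor
  · intro η hη
    -- Taking `min η δ` only enlarges the perforated domain and brings the radius into the range
    -- where the annulus formula holds.
    have h1 : IntegrableOn (fun y => (1 : ℝ) * ‖particleField (fun i => (q i : ℝ)) p β y‖ ^ 2)
        (perforated p (min η δ)) volume := by
      simp_rw [one_mul, norm_sq_particleField δ]
      exact hint.integrableOn.add (hI _ (lt_min hη hδ) (min_le_right _ _))
    refine h1.mono_set fun y hy => ?_
    rw [mem_perforated] at hy ⊢
    exact fun i => (min_le_left _ _).trans (hy i)
  · have hlim := (tendsto_setIntegral_perforated (p := p) hd hint).add_const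
      (kd d * W d δ * ∑ i, (q i : ℝ) ^ 2)
    refine (hlim.congr' ?_).trans_eq ?_
    -- The annuli contribute `k_d (W δ - W η) ∑ q_i²`: the part in `η` cancels the counterterm, and
    -- the part in `δ` cancels against the value in `hval`.
    · filter_upwards [Ioc_mem_nhdsGT hδ] with η hη
      simp_rw [one_mul, norm_sq_particleField δ]
      rw [integral_add hint.integrableOn (hI η hη.1 hη.2), integral_finsetSum _ fun i _ =>
        (perforated_innerEnergy hd hsep hη.1 hη.2 i).1.const_mul _]
      simp_rw [integral_const_mul, (perforated_innerEnergy hd hsep hη.1 hη.2 _).2]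
      rw [← Finset.sum_mul]
      ring
    · rw [hval]
      congr 1
      ring

lemma HasRenormalizedEnergy.congr_ae {q : Fin N → Charge qmin qmax} {F G : Pos d → Pos d}
    {χ : Pos d → ℝ} {L : ℝ} (h : HasRenormalizedEnergy q p F χ L) (hFG : F =ᵐ[volume] G) :
    HasRenormalizedEnergy q p G χ L := by
  have e : ∀ η, (fun y => χ y * ‖F y‖ ^ 2) =ᵐ[volume.restrict (perforated p η)]
      fun y => χ y * ‖G y‖ ^ 2 := fun η => ae_restrict_of_ae (by
    filter_upwards [hFG] with y hy
    rw [hy])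
  refine ⟨fun η hη => (h.1 η hη).congr (e η), ?_⟩
  simp_rw [← integral_congr_ae (e _)]
  exact h.2

end

/-! ### Interaction with charges spread uniformly over the unit ball. -/

section
variable {d N : ℕ} {qmin qmax : ℝ}

/-- Separates the singularity, confined to `r < 1`, from growth that is at most linear and hence
controlled by a first moment. -/
lemma abs_W_le {r : ℝ} (hr : 0 ≤ r) :
    |W d r| ≤ Set.indicator (Set.Iio 1) (fun s => |W d s|) r + r := by
  by_cases h : r < 1
  · rw [Set.indicator_of_mem (by exact h)]; linarith
  · rw [Set.indicator_of_notMem (by exact h), zero_add]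
    rw [not_lt] at h
    unfold W
    split_ifs
    · rw [abs_of_nonneg (Real.log_nonneg h)]
      linarith [Real.log_le_sub_one_of_pos (by linarith : 0 < r)]
    · rw [abs_neg, abs_of_nonneg (by positivity)]
      have : 1 ≤ r ^ (d - 2) := one_le_pow₀ h
      rw [div_le_iff₀ (by positivity)]
      nlinarith

lemma W_le_self {r : ℝ} (hr : 0 ≤ r) : W d r ≤ r := by
  unfold W
  split_ifs
  · exact Real.log_le_self hr
  · have : 0 ≤ 1 / r ^ (d - 2) := by positivity
    linarith

/-- The uniform distribution on the unit ball. -/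
def unitBall (d : ℕ) : Measure (Pos d) := ProbabilityTheory.cond volume (Metric.ball 0 1)

instance : IsProbabilityMeasure (unitBall d) :=
  ProbabilityTheory.cond_isProbabilityMeasure_of_finite (Metric.measure_ball_pos _ _ one_pos).ne'
    measure_ball_lt_top.ne

lemma unitBall_ae_norm : ∀ᵐ y ∂(unitBall d), ‖y‖ < 1 :=
  ProbabilityTheory.ae_cond_of_forall_mem measurableSet_ball fun y hy => by simpa using hy

lemma unitBall_ae_ne (hd : 2 ≤ d) (x : Pos d) : ∀ᵐ y ∂(unitBall d), x ≠ y :=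
  (ProbabilityTheory.cond_absolutelyContinuous).ae_le ((ae_ne_point hd x).mono fun _ h => h.symm)

/-- By translation invariance the singular part contributes at most the normalized integral of `|W|`
over a unit ball, wherever `x` lies; the remaining part is at most `‖x‖ + 1`. -/
lemma lintegral_W_unitBall (hd : 2 ≤ d) : ∃ C : ℝ≥0∞, C < ⊤ ∧ ∀ x : Pos d,
    ∫⁻ y, ‖W d ‖x - y‖‖ₑ ∂(unitBall d) ≤ C + ‖x‖ₑ := by
  set c : ℝ≥0∞ := (volume (Metric.ball (0 : Pos d) 1))⁻¹
  have hc : c < ⊤ := ENNReal.inv_lt_top.2 (Metric.measure_ball_pos _ _ one_pos)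
  set I : ℝ≥0∞ := ∫⁻ y in Metric.ball (0 : Pos d) 1, ‖W d ‖y‖‖ₑ
  have hI : I < ⊤ := (integrableOn_ball_of_locallyIntegrable (locallyIntegrable_W_norm hd) 0 1).2
  refine ⟨c * I + 1, ENNReal.add_lt_top.2 ⟨ENNReal.mul_lt_top hc hI, ENNReal.one_lt_top⟩, fun x => ?_⟩
  have hWm : Measurable fun y : Pos d => ‖W d ‖y‖‖ₑ := stronglyMeasurable_W_norm.measurable.enorm
  have h1 : ∀ᵐ y ∂(unitBall d), ‖W d ‖x - y‖‖ₑ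
      ≤ Set.indicator (Metric.ball 0 1) (fun z : Pos d => ‖W d ‖z‖‖ₑ) (y - x) + (‖x‖ₑ + 1) := by
    filter_upwards [unitBall_ae_norm] with y hy
    have h2 := abs_W_le (d := d) (norm_nonneg (x - y))
    have h3 : ‖x - y‖ ≤ ‖x‖ + 1 := (norm_sub_le _ _).trans (by linarith)
    have h4 : ENNReal.ofReal (‖x‖ + 1) = ‖x‖ₑ + 1 := by
      rw [ENNReal.ofReal_add (norm_nonneg _) zero_le_one, ofReal_norm, ENNReal.ofReal_one]
    rw [← h4, norm_sub_rev x y] at *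
    by_cases hball : y - x ∈ Metric.ball (0 : Pos d) 1
    · rw [Set.indicator_of_mem hball]
      exact le_self_add
    · rw [Set.indicator_of_notMem hball, zero_add, ← ofReal_norm]
      rw [mem_ball_zero_iff] at hball
      rw [Set.indicator_of_notMem (by exact hball)] at h2
      exact ENNReal.ofReal_le_ofReal (by rw [Real.norm_eq_abs]; linarith)
  calc _ ≤ ∫⁻ y, (Set.indicator (Metric.ball 0 1) (fun z : Pos d => ‖W d ‖z‖‖ₑ) (y - x)
          + (‖x‖ₑ + 1)) ∂(unitBall d) := lintegral_mono_ae h1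
    _ = (∫⁻ y, Set.indicator (Metric.ball 0 1) (fun z : Pos d => ‖W d ‖z‖‖ₑ) (y - x) ∂(unitBall d))
          + (‖x‖ₑ + 1) := by
        rw [lintegral_add_right _ measurable_const, lintegral_const, measure_univ, mul_one]
    _ ≤ c * I + (‖x‖ₑ + 1) := by
        refine add_le_add_left ?_ _
        rw [unitBall, ProbabilityTheory.cond, lintegral_smul_measure, smul_eq_mul]
        refine mul_le_mul_right ((setLIntegral_le_lintegral _ _).trans ?_) _
        rw [lintegral_sub_right_eq_self (fun y =>
          Set.indicator (Metric.ball 0 1) (fun z : Pos d => ‖W d ‖z‖‖ₑ) y) x,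
          lintegral_indicator measurableSet_ball]
    _ = c * I + 1 + ‖x‖ₑ := by ring

lemma charge_nonneg (hq : 0 < qmin) (t : Charge qmin qmax) : 0 < (t : ℝ) := hq.trans_le t.2.1

lemma measurable_interaction : Measurable
    (interaction : (Charge qmin qmax × Pos d) × (Charge qmin qmax × Pos d) → ℝ) := by
  have := measurable_W d
  unfold interaction
  fun_prop

lemma interaction_swap (p : (Charge qmin qmax × Pos d) × (Charge qmin qmax × Pos d)) :
    interaction p.swap = interaction p := by
  simp only [interaction, Prod.fst_swap, Prod.snd_swap]
  rw [norm_sub_rev]; ring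

lemma measurable_confinement {g : Charge qmin qmax → ℝ} (hg : Measurable g) :
    Measurable (confinement g : Charge qmin qmax × Pos d → ℝ) := by
  unfold confinement
  fun_prop

lemma measurableSet_ne : MeasurableSet
    {p : (Charge qmin qmax × Pos d) × (Charge qmin qmax × Pos d) | p.1.2 ≠ p.2.2} :=
  (measurableSet_eq_fun (by fun_prop) (by fun_prop)).compl

/-- Two measures interact with finite energy. -/
def Interact (m m' : Measure (Charge qmin qmax × Pos d)) : Prop :=
  (∀ᵐ p ∂(m.prod m'), p.1.2 ≠ p.2.2) ∧ Integrable interaction (m.prod m')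

lemma Interact.symm {m m' : Measure (Charge qmin qmax × Pos d)} [SFinite m] [SFinite m']
    (h : Interact m m') : Interact m' m := by
  constructor
  · rw [← Measure.prod_swap, ae_map_iff measurable_swap.aemeasurable measurableSet_ne]
    exact h.1.mono fun p hp => hp.symm
  · exact h.2.swap.congr (ae_of_all _ interaction_swap)

/-- Makes competitors admissible without new estimates: those used below are dominated by multiples
of measures already known to interact. -/
lemma Interact.mono {m m' n n' : Measure (Charge qmin qmax × Pos d)} [SFinite n']
    [SFinite m'] (h : Interact n n') {K : ℝ≥0∞} (hK : K ≠ ⊤) (hm : m ≤ K • n) (hm' : m' ≤ K • n') :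
    Interact m m' := by
  have hle : m.prod m' ≤ (K * K) • n.prod n' := by
    refine (Measure.prod_mono hm hm').trans_eq ?_
    rw [Measure.prod_smul_left, Measure.prod_smul_right, smul_smul]
  constructor
  · exact Measure.ae_le_iff_absolutelyContinuous.2 (Measure.absolutelyContinuous_of_le_smul hle) h.1
  · exact (h.2.smul_measure (ENNReal.mul_ne_top hK hK)).mono_measure hle

lemma Interact.add_left {m m' n : Measure (Charge qmin qmax × Pos d)} [SFinite m] [SFinite m']
    [SFinite n] (h : Interact m n) (h' : Interact m' n) : Interact (m + m') n := by
  rw [Interact, Measure.add_prod, ae_add_measure_iff, integrable_add_measure]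
  exact ⟨⟨h.1, h'.1⟩, h.2, h'.2⟩

lemma Interact.add_right {m m' n : Measure (Charge qmin qmax × Pos d)} [SFinite m] [SFinite m']
    [SFinite n] (h : Interact n m) (h' : Interact n m') : Interact n (m + m') :=
  (h.symm.add_left h'.symm).symm

/-- A measure with finite first moment interacts with any distribution of charges that is
uniform on the unit ball. -/
lemma interact_unitBall (hd : 2 ≤ d) (hq : 0 < qmin) (ν : Measure (Charge qmin qmax))
    [IsProbabilityMeasure ν] (m : Measure (Charge qmin qmax × Pos d)) [IsFiniteMeasure m]
    (hm : Integrable (fun z => ‖z.2‖) m) : Interact m (ν.prod (unitBall d)) := by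
  constructor
  · rw [Measure.ae_prod_iff_ae_ae measurableSet_ne]
    refine ae_of_all _ fun z => ?_
    exact Measure.quasiMeasurePreserving_snd.ae (unitBall_ae_ne hd z.2)
  · refine ⟨measurable_interaction.aestronglyMeasurable, ?_⟩
    obtain ⟨C, hC, h⟩ := lintegral_W_unitBall hd
    have hW := measurable_W d
    rw [HasFiniteIntegral, lintegral_prod _ measurable_interaction.enorm.aemeasurable]
    have hbound : ∀ z, ∫⁻ z', ‖interaction (z, z')‖ₑ ∂(ν.prod (unitBall d))
        ≤ ENNReal.ofReal (qmax * qmax) * (C + ‖z.2‖ₑ) := fun z => by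
      have h1 : ∀ z' : Charge qmin qmax × Pos d, ‖interaction (z, z')‖ₑ
          ≤ ENNReal.ofReal (qmax * qmax) * ‖W d ‖z.2 - z'.2‖‖ₑ := fun z' => by
        rw [interaction, enorm_mul]
        refine mul_le_mul_left ?_ _
        have a1 := charge_nonneg hq z.1
        have a2 := charge_nonneg hq z'.1
        rw [← ofReal_norm, Real.norm_of_nonneg (by positivity)]
        exact ENNReal.ofReal_le_ofReal (mul_le_mul z.1.2.2 z'.1.2.2 a2.le (a1.le.trans z.1.2.2))
      refine (lintegral_mono h1).trans ?_
      have hmz : Measurable fun y : Pos d => ‖W d ‖z.2 - y‖‖ₑ := by fun_prop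
      have hmz' : Measurable fun z' : Charge qmin qmax × Pos d => ‖W d ‖z.2 - z'.2‖‖ₑ :=
        hmz.comp measurable_snd
      rw [lintegral_const_mul _ hmz']
      refine mul_le_mul_right ?_ _
      have mp : MeasurePreserving (Prod.snd : Charge qmin qmax × Pos d → Pos d)
        (ν.prod (unitBall d)) (unitBall d) := measurePreserving_snd
      rw [mp.lintegral_comp hmz]
      exact h z.2
    refine (lintegral_mono hbound).trans_lt ?_
    rw [lintegral_const_mul _ (by fun_prop), lintegral_add_left measurable_const, lintegral_const]
    refine ENNReal.mul_lt_top ENNReal.ofReal_lt_top (ENNReal.add_lt_top.2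
      ⟨ENNReal.mul_lt_top hC (measure_lt_top _ _), ?_⟩)
    have := hm.2
    simp only [HasFiniteIntegral, enorm_norm] at this
    exact this

lemma integrable_norm_of_confinement (hq : 0 < qmin) {g : Charge qmin qmax → ℝ} {a : ℝ}
    (ha : 0 < a) (hga : ∀ t, a ≤ g t) {m : Measure (Charge qmin qmax × Pos d)} [IsFiniteMeasure m]
    (h : Integrable (confinement g) m) : Integrable (fun z => ‖z.2‖) m := by
  refine ((integrable_const (1 : ℝ)).add (h.const_mul (qmin * a)⁻¹)).mono'
    (by fun_prop : Measurable fun z : Charge qmin qmax × Pos d => ‖z.2‖).aestronglyMeasurable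
    (ae_of_all _ fun z => ?_)
  simp only [norm_norm, Pi.add_apply, confinement]
  have h1 : qmin * a ≤ z.1 * g z.1 :=
    mul_le_mul z.1.2.1 (hga _) ha.le (charge_nonneg hq z.1).le
  have h0 : 0 < qmin * a := by positivity
  have h2 : ‖z.2‖ ^ 2 ≤ (qmin * a)⁻¹ * (z.1 * g z.1 * ‖z.2‖ ^ 2) := by
    rw [inv_mul_eq_div, le_div_iff₀ h0, mul_comm]
    gcongr
  nlinarith [sq_nonneg (‖z.2‖ - 1)]

end

/-! ### The first variation at a minimizer. -/

section
variable {d N : ℕ} {qmin qmax : ℝ} {g : Charge qmin qmax → ℝ} {ν : Measure (Charge qmin qmax)}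
  {μ μ' : Measure (Charge qmin qmax × Pos d)}

/-- The interaction of two double-layer measures. -/
def crossEnergy (m m' : Measure (Charge qmin qmax × Pos d)) : ℝ :=
  ∫ p, interaction p ∂(m.prod m')

lemma crossEnergy_comm [SFinite μ] [SFinite μ'] : crossEnergy μ μ' = crossEnergy μ' μ := by
  rw [crossEnergy, crossEnergy, ← integral_prod_swap]
  simp_rw [interaction_swap]

lemma crossEnergy_add_left {m : Measure (Charge qmin qmax × Pos d)} [SFinite μ] [SFinite μ']
    [SFinite m] (h : Interact μ m) (h' : Interact μ' m) :
    crossEnergy (μ + μ') m = crossEnergy μ m + crossEnergy μ' m := by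
  rw [crossEnergy, Measure.add_prod, integral_add_measure h.2 h'.2]; rfl

lemma crossEnergy_smul_left {m : Measure (Charge qmin qmax × Pos d)} [SFinite m] (c : ℝ≥0∞) :
    crossEnergy (c • μ) m = c.toReal * crossEnergy μ m := by
  rw [crossEnergy, Measure.prod_smul_left, integral_smul_measure]; rfl

lemma Interact.smul_left {m : Measure (Charge qmin qmax × Pos d)} [SFinite m] [SFinite μ]
    (h : Interact μ m) {c : ℝ≥0∞} (hc : c ≠ ⊤) : Interact (c • μ) m := by
  rw [Interact, Measure.prod_smul_left]
  exact ⟨Measure.ae_smul_measure h.1 c, h.2.smul_measure hc⟩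

lemma interaction_eq (z z' : Charge qmin qmax × Pos d) :
    interaction (z, z') = (z.1 : ℝ) * ((z'.1 : ℝ) * W d ‖z.2 - z'.2‖) := by
  simp only [interaction]; ring

lemma integral_interaction_right (z : Charge qmin qmax × Pos d) :
    ∫ z', interaction (z, z') ∂μ = z.1 * potential μ z.2 := by
  simp_rw [interaction_eq]
  rw [integral_const_mul, potential]

lemma measurable_potential [SFinite μ] : Measurable (potential μ) := by
  have hW := measurable_W d
  have : StronglyMeasurable fun p : Pos d × (Charge qmin qmax × Pos d) =>
      (p.2.1 : ℝ) * W d ‖p.1 - p.2.2‖ := Measurable.stronglyMeasurable (by fun_prop)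
  exact this.integral_prod_right.measurable

lemma measurable_zeta [SFinite μ] (hg : Measurable g) : Measurable (zeta g μ) := by
  have := measurable_potential (μ := μ)
  unfold zeta
  fun_prop

lemma zeta_eq (z : Charge qmin qmax × Pos d) :
    zeta g μ z = confinement g z / 2 - ∫ z', interaction (z, z') ∂μ := by
  rw [integral_interaction_right, zeta, confinement]; ring

/-- The integral of `ζ` against a measure with which the reference measure interacts. -/
lemma integral_zeta [SFinite μ] [SFinite μ'] (hc : Integrable (confinement g) μ')
    (h : Interact μ' μ) : Integrable (zeta g μ) μ' ∧
    ∫ z, zeta g μ z ∂μ' = (∫ z, confinement g z ∂μ') / 2 - crossEnergy μ' μ := by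
  have e : zeta g μ = fun z => confinement g z / 2 - ∫ z', interaction (z, z') ∂μ := funext zeta_eq
  rw [e]
  refine ⟨(hc.div_const 2).sub h.2.integral_prod_left, ?_⟩
  rw [integral_sub (hc.div_const 2) h.2.integral_prod_left, integral_div, crossEnergy,
    integral_prod _ h.2]

lemma isProbabilityMeasure_of_map_fst [IsProbabilityMeasure ν] (h : μ.map Prod.fst = ν) :
    IsProbabilityMeasure μ := by
  constructor
  rw [← measure_univ (μ := ν), ← h, Measure.map_apply measurable_fst MeasurableSet.univ,
    Set.preimage_univ]

lemma HasFiniteEnergy.interact (h : HasFiniteEnergy g μ) : Interact μ μ := h.2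

/-- The first variation of the energy at a minimizer is nonnegative. -/
lemma integral_zeta_le [IsProbabilityMeasure ν] (hμ : IsEnergyMinimizer g ν μ)
    (hν : μ'.map Prod.fst = ν) (hc : Integrable (confinement g) μ') (h : Interact μ μ')
    (h' : Interact μ' μ') : ∫ z, zeta g μ z ∂μ ≤ ∫ z, zeta g μ z ∂μ' := by
  have := isProbabilityMeasure_of_map_fst hμ.1
  have := isProbabilityMeasure_of_map_fst hν
  have h0 := hμ.2.1.interact
  rw [(integral_zeta hμ.2.1.1 h0).2, (integral_zeta hc h.symm).2]
  set C := ∫ z, confinement g z ∂μ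
  set C' := ∫ z, confinement g z ∂μ'
  set D := crossEnergy μ μ
  set D' := crossEnergy μ' μ'
  set M := crossEnergy μ' μ
  -- The energy along `(1 - t) μ + t μ'` is quadratic in `t`. Minimality, divided by `t`, gives this
  -- inequality, whose constant term is twice the difference of the integrals of `ζ`.
  have key : ∀ t : ℝ, 0 < t → t < 1 →
      0 ≤ (C' - C + 2 * D - 2 * M) + t * (2 * M - D - D') := by
    intro t ht ht1
    set a := ENNReal.ofReal (1 - t)
    set b := ENNReal.ofReal t
    have ha : a ≠ ⊤ := ENNReal.ofReal_ne_top
    have hb : b ≠ ⊤ := ENNReal.ofReal_ne_top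
    have ha' : a.toReal = 1 - t := ENNReal.toReal_ofReal (by linarith)
    have hb' : b.toReal = t := ENNReal.toReal_ofReal ht.le
    have hab : a + b = 1 := by
      rw [← ENNReal.ofReal_add (by linarith) ht.le]; simp
    have i1 : ∀ m : Measure (Charge qmin qmax × Pos d), SFinite m → Interact μ m → Interact μ' m →
        Interact (a • μ + b • μ') m := fun m _ hm hm' =>
      (hm.smul_left ha).add_left (hm'.smul_left hb)
    have e1 : ∀ m : Measure (Charge qmin qmax × Pos d), SFinite m → Interact μ m → Interact μ' m →
        crossEnergy (a • μ + b • μ') m = (1 - t) * crossEnergy μ m + t * crossEnergy μ' m :=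
      fun m _ hm hm' => by
        rw [crossEnergy_add_left (hm.smul_left ha) (hm'.smul_left hb), crossEnergy_smul_left,
          crossEnergy_smul_left, ha', hb']
    have j1 := i1 μ inferInstance h0 h.symm
    have j2 := i1 μ' inferInstance h h'
    have hA : SFinite (a • μ) := inferInstance
    have hB : SFinite (b • μ') := inferInstance
    have hAB : SFinite (a • μ + b • μ') := inferInstance
    have j3 := i1 (a • μ + b • μ') inferInstance j1.symm j2.symm
    have hmarg : (a • μ + b • μ').map Prod.fst = ν := by
      rw [Measure.map_add _ _ measurable_fst, Measure.map_smul, Measure.map_smul, hμ.1, hν,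
        ← add_smul, hab, one_smul]
    have hci : Integrable (confinement g) (a • μ + b • μ') :=
      (hμ.2.1.1.smul_measure ha).add_measure (hc.smul_measure hb)
    have hle := hμ.2.2 _ hmarg ⟨hci, j3⟩
    have hen : energy g (a • μ + b • μ') = ((1 - t) * C + t * C')
        - ((1 - t) * ((1 - t) * D + t * M) + t * ((1 - t) * M + t * D')) := by
      have hE : energy g (a • μ + b • μ') = (∫ z, confinement g z ∂(a • μ + b • μ'))
        - crossEnergy (a • μ + b • μ') (a • μ + b • μ') := rfl
      rw [hE, e1 _ inferInstance j1.symm j2.symm, crossEnergy_comm (μ := μ),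
        crossEnergy_comm (μ := μ'), e1 _ inferInstance h0 h.symm, e1 _ inferInstance h h',
        crossEnergy_comm (μ := μ) (μ' := μ'),
        integral_add_measure (hμ.2.1.1.smul_measure ha) (hc.smul_measure hb),
        integral_smul_measure, integral_smul_measure, ha', hb']
      simp only [smul_eq_mul]
      rfl
    have hE0 : energy g μ = C - D := rfl
    rw [hen, hE0] at hle
    have : 0 ≤ t * ((C' - C + 2 * D - 2 * M) + t * (2 * M - D - D')) := by nlinarith
    exact nonneg_of_mul_nonneg_right this ht
  have hlim : Tendsto (fun t : ℝ => (C' - C + 2 * D - 2 * M) + t * (2 * M - D - D')) (𝓝[>] 0)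
      (𝓝 ((C' - C + 2 * D - 2 * M) + 0 * (2 * M - D - D'))) :=
    tendsto_nhdsWithin_of_tendsto_nhds (by fun_prop : Continuous fun t : ℝ =>
      (C' - C + 2 * D - 2 * M) + t * (2 * M - D - D')).continuousAt
  have hnn := ge_of_tendsto hlim (by
    filter_upwards [Ioo_mem_nhdsGT one_pos] with t ht
    exact key t ht.1 ht.2)
  linarith

/-- The σ-algebra generated by the first coordinate. -/
abbrev fstSigma (X Y : Type*) [MeasurableSpace X] : MeasurableSpace (X × Y) :=
  MeasurableSpace.comap Prod.fst inferInstance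

/-- A function whose integral cannot be decreased by changing the conditional distributions of the
second coordinate is a function of the first coordinate. -/
lemma ae_eq_comp_fst_of_variation {X Y : Type*} [MeasurableSpace X] [MeasurableSpace Y]
    {μ : Measure (X × Y)} [IsProbabilityMeasure μ] {f : X × Y → ℝ} (hfm : Measurable f)
    (hf : Integrable f μ)
    (h : ∀ w : X × Y → ℝ, Measurable w → (∀ᵐ z ∂μ, 0 ≤ w z ∧ w z ≤ 2) →
      (μ.withDensity fun z => ENNReal.ofReal (w z)).map Prod.fst = μ.map Prod.fst →
      ∫ z, f z ∂μ ≤ ∫ z, w z * f z ∂μ) :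
    ∃ c : X → ℝ, Measurable c ∧ Integrable c (μ.map Prod.fst) ∧ ∀ᵐ z ∂μ, f z = c z.1 := by
  have hm : fstSigma X Y ≤ Prod.instMeasurableSpace := measurable_fst.comap_le
  obtain ⟨c, hc, hce⟩ := (stronglyMeasurable_condExp (f := f) (m := fstSigma X Y) (μ := μ)).exists_eq_measurable_comp
  have hcm := hc.measurable
  have hci : Integrable (c ∘ Prod.fst) μ := hce ▸ integrable_condExp
  refine ⟨c, hcm, (integrable_map_measure hcm.aestronglyMeasurable measurable_fst.aemeasurable).2 hci, ?_⟩
  classical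
  -- `s` is minus the sign of `f - c`, where `c` is the conditional expectation of `f`. Subtracting
  -- the conditional expectation `E` of `s` preserves the marginal, and half the difference lies in
  -- `[-1, 1]`, so `1 + (s - E) / 2` is a density between `0` and `2`.
  set s : X × Y → ℝ := fun z => if c z.1 ≤ f z then -1 else 1
  have hsm : Measurable s := Measurable.ite
    (measurableSet_le (hcm.comp measurable_fst) hfm) measurable_const measurable_const
  have hsb : ∀ z, |s z| ≤ 1 := fun z => by simp only [s]; split_ifs <;> simp
  have hsi : Integrable s μ := Integrable.of_bound hsm.aestronglyMeasurable 1 (ae_of_all _ hsb)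
  set E := μ[s|fstSigma X Y]
  have hEm : StronglyMeasurable[fstSigma X Y] E := stronglyMeasurable_condExp
  have hEb : ∀ᵐ z ∂μ, |E z| ≤ 1 := by
    have := ae_bdd_abs_condExp_of_ae_bdd_abs (m := fstSigma X Y) (R := 1) (f := s) (μ := μ)
      (ae_of_all _ hsb)
    exact this
  have hEM : Measurable E := (hEm.mono hm).measurable
  have hEi : Integrable E μ := integrable_condExp
  have hEf : Integrable (fun z => E z * f z) μ := hf.bdd_mul hEM.aestronglyMeasurable hEb
  have hsf : Integrable (fun z => s z * f z) μ := hf.bdd_mul hsm.aestronglyMeasurable (ae_of_all _ hsb)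
  have hsc : Integrable (fun z => s z * c z.1) μ :=
    hci.bdd_mul hsm.aestronglyMeasurable (ae_of_all _ hsb)
  -- admissible density
  have hw := h (fun z => 1 + (s z - E z) / 2) (by fun_prop) ?_ ?_
  -- Conditioning moves the expectation from `s` to `f`. The variation then equals `-∫ |f - c| / 2`,
  -- and minimality forces `f = c` almost everywhere.
  · have e1 : ∫ z, E z * f z ∂μ = ∫ z, s z * c z.1 ∂μ := by
      have p1 : μ[fun z => E z * f z|fstSigma X Y] =ᵐ[μ] fun z => E z * (μ[f|fstSigma X Y]) z :=
        condExp_mul_of_stronglyMeasurable_left hEm hEf hf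
      have p2 : μ[fun z => s z * c z.1|fstSigma X Y] =ᵐ[μ] fun z => E z * c z.1 :=
        condExp_mul_of_stronglyMeasurable_right (g := c ∘ Prod.fst)
          (hce ▸ stronglyMeasurable_condExp) hsc hsi
      rw [← integral_condExp hm, integral_congr_ae p1, ← integral_condExp hm (f := fun z => s z * c z.1),
        integral_congr_ae p2, hce]
      rfl
    have e2 : ∫ z, (1 + (s z - E z) / 2) * f z ∂μ
        = ∫ z, f z ∂μ + (∫ z, s z * (f z - c z.1) ∂μ) / 2 := by
      have : ∀ z, (1 + (s z - E z) / 2) * f z = f z + (s z * f z - E z * f z) / 2 := fun z => by ring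
      simp_rw [this, mul_sub]
      have i3 : Integrable (fun z => (s z * f z - E z * f z) / 2) μ := (hsf.sub hEf).div_const 2
      rw [integral_add hf i3, integral_div, integral_sub hsf hEf, e1, integral_sub hsf hsc]
    have e3 : ∀ z, s z * (f z - c z.1) = -|f z - c z.1| := fun z => by
      simp only [s]
      split_ifs with hz
      · rw [abs_of_nonneg (by linarith)]; ring
      · rw [abs_of_neg (by linarith)]; ring
    simp_rw [e2, e3, integral_neg] at hw
    have hz : ∫ z, |f z - c z.1| ∂μ = 0 :=
      le_antisymm (by linarith) (integral_nonneg fun z => abs_nonneg _)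
    have := (integral_eq_zero_iff_of_nonneg (fun z => abs_nonneg _) (hf.sub hci).abs).1 hz
    filter_upwards [this] with z hz
    have : f z - c z.1 = 0 := abs_eq_zero.1 hz
    linarith
  · filter_upwards [hEb] with z hz
    have h1 := abs_le.1 (hsb z)
    have h2 := abs_le.1 hz
    constructor <;> linarith
  · ext A hA
    have hA' : MeasurableSet[fstSigma X Y] (Prod.fst ⁻¹' A : Set (X × Y)) := ⟨A, hA, rfl⟩
    rw [Measure.map_apply measurable_fst hA, Measure.map_apply measurable_fst hA,
      withDensity_apply _ (hm _ hA'), ← ofReal_integral_eq_lintegral_ofReal]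
    · have i4 : Integrable (fun z => (s z - E z) / 2) μ := (hsi.sub hEi).div_const 2
      rw [integral_add (integrable_const _) i4.integrableOn, integral_div,
        integral_sub hsi.integrableOn hEi.integrableOn, setIntegral_condExp hm hsi hA']
      simp
    · exact ((integrable_const (1 : ℝ)).add ((hsi.sub hEi).div_const 2)).integrableOn
    · filter_upwards [ae_restrict_of_ae hEb] with z hz
      have h1 := abs_le.1 (hsb z)
      have h2 := abs_le.1 hz
      simp only [Pi.zero_apply]
      linarith

end

/-! ### Euler-Lagrange conditions, bounded support and finiteness of the potential. -/

section
variable {d N : ℕ} {qmin qmax a b : ℝ} {g : Charge qmin qmax → ℝ} {ν : Measure (Charge qmin qmax)}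
  {μ : Measure (Charge qmin qmax × Pos d)} [IsProbabilityMeasure ν]

/-- Given the charge, `ζ` is constant on a minimizer. -/
lemma exists_zeta_eq_charge (hg : Measurable g) (hμ : IsEnergyMinimizer g ν μ) :
    ∃ c : Charge qmin qmax → ℝ, Measurable c ∧ Integrable c ν ∧ ∀ᵐ z ∂μ, zeta g μ z = c z.1 := by
  have := isProbabilityMeasure_of_map_fst hμ.1
  have h0 := hμ.2.1.interact
  have hz := (integral_zeta hμ.2.1.1 h0).1
  have hzm : Measurable (zeta g μ) := measurable_zeta hg
  have key := ae_eq_comp_fst_of_variation hzm hz fun w hw hwb hmarg => by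
    -- A density bounded by `2` keeps the competitor below `2 • μ`, so its energy is finite by
    -- `Interact.mono`.
    have hle : μ.withDensity (fun z => ENNReal.ofReal (w z)) ≤ (2 : ℝ≥0∞) • μ := by
      rw [← withDensity_const]
      refine withDensity_mono ?_
      filter_upwards [hwb] with z hz
      exact (ENNReal.ofReal_le_ofReal hz.2).trans_eq (by simp)
    have h2 : (2 : ℝ≥0∞) ≠ ⊤ := ENNReal.ofNat_ne_top
    have hle' : μ ≤ (2 : ℝ≥0∞) • μ := by
      intro s
      rw [Measure.smul_apply, smul_eq_mul]
      exact le_mul_of_one_le_left zero_le one_le_two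
    have hν := hmarg.trans hμ.1
    have := isProbabilityMeasure_of_map_fst hν
    have hmin := integral_zeta_le hμ hν ((hμ.2.1.1.smul_measure h2).mono_measure hle)
      (h0.mono h2 hle' hle) (h0.mono h2 hle hle)
    rw [integral_withDensity_eq_integral_toReal_smul (by fun_prop)
      (ae_of_all _ fun z => ENNReal.ofReal_lt_top)] at hmin
    refine hmin.trans_eq (integral_congr_ae ?_)
    filter_upwards [hwb] with z hz
    rw [ENNReal.toReal_ofReal hz.1, smul_eq_mul]
  rwa [hμ.1] at key

lemma integrable_norm_minimizer (hq : 0 < qmin) (ha : 0 < a) (hga : ∀ t, a ≤ g t)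
    (hμ : IsEnergyMinimizer g ν μ) : Integrable (fun z => ‖z.2‖) μ := by
  have := isProbabilityMeasure_of_map_fst hμ.1
  exact integrable_norm_of_confinement hq ha hga hμ.2.1.1

lemma prod_unitBall_ae_norm {ν : Measure (Charge qmin qmax)} [SFinite ν] :
    ∀ᵐ z ∂(ν.prod (unitBall d)), ‖z.2‖ < 1 :=
  Measure.quasiMeasurePreserving_snd.ae unitBall_ae_norm

/-- Fubini gives integrability of `t * potential m y` in `y` for almost every charge `t`; one such
`t` suffices, since it is positive. -/
lemma integrable_potential_unitBall (hq : 0 < qmin) (m : Measure (Charge qmin qmax × Pos d))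
    [IsFiniteMeasure m] (h : Interact (ν.prod (unitBall d)) m) :
    Integrable (potential m) (unitBall d) := by
  have h1 := h.2.integral_prod_left
  simp_rw [integral_interaction_right] at h1
  obtain ⟨t, ht⟩ := h1.prod_right_ae.exists
  have ht0 := (charge_nonneg hq t).ne'
  refine (ht.const_mul (t : ℝ)⁻¹).congr (ae_of_all _ fun y => ?_)
  simp only
  rw [inv_mul_cancel_left₀ ht0]

lemma integrable_confinement_unitBall (hq : 0 < qmin) (hg : Measurable g) (ha : 0 < a)
    (hga : ∀ t, a ≤ g t) (hgb : ∀ t, g t ≤ b) :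
    Integrable (confinement g) (ν.prod (unitBall d)) := by
  refine Integrable.of_bound (measurable_confinement hg).aestronglyMeasurable (qmax * b) ?_
  filter_upwards [prod_unitBall_ae_norm] with z hz
  have h1 := charge_nonneg hq z.1
  have h2 : 0 < g z.1 := ha.trans_le (hga _)
  rw [confinement, Real.norm_of_nonneg (by positivity)]
  have h3 : ‖z.2‖ ^ 2 ≤ 1 := pow_le_one₀ (norm_nonneg _) hz.le
  have h4 : (z.1 : ℝ) * g z.1 ≤ qmax * b :=
    mul_le_mul z.1.2.2 (hgb _) h2.le (h1.le.trans z.1.2.2)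
  nlinarith [mul_pos h1 h2]

/-- The Euler-Lagrange inequality, tested with charges moved to the unit ball. -/
lemma charge_constant_le (hd : 2 ≤ d) (hq : 0 < qmin) (hg : Measurable g) (ha : 0 < a)
    (hga : ∀ t, a ≤ g t) (hgb : ∀ t, g t ≤ b) (hμ : IsEnergyMinimizer g ν μ)
    {c : Charge qmin qmax → ℝ} (hc : Measurable c) (hci : Integrable c ν)
    (hcz : ∀ᵐ z ∂μ, zeta g μ z = c z.1) :
    ∀ᵐ t ∂ν, c t ≤ (t : ℝ) * (b / 2 - ∫ y, potential μ y ∂(unitBall d)) := by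
  have := isProbabilityMeasure_of_map_fst hμ.1
  have h0 := hμ.2.1.interact
  set n : Measure (Charge qmin qmax × Pos d) := ν.prod (unitBall d)
  have hm := integrable_norm_minimizer hq ha hga hμ
  have hcn : Integrable (confinement g) n := integrable_confinement_unitBall hq hg ha hga hgb
  have hn : Integrable (fun z => ‖z.2‖) n := integrable_norm_of_confinement hq ha hga hcn
  have h1 : Interact μ n := interact_unitBall hd hq ν μ hm
  have h2 : Interact n n := interact_unitBall hd hq ν n hn
  have hpot : Integrable (potential μ) (unitBall d) := integrable_potential_unitBall hq μ h1.symm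
  have hqi : Integrable (fun t : Charge qmin qmax => (t : ℝ)) ν :=
    Integrable.of_bound (by fun_prop : Measurable fun t : Charge qmin qmax => (t : ℝ)).aestronglyMeasurable
      qmax (ae_of_all _ fun t => by
        rw [Real.norm_of_nonneg (charge_nonneg hq t).le]; exact t.2.2)
  -- The inequality between functions of the charge is tested on each set `A` of charges separately.
  refine ae_le_of_forall_setIntegral_le hci (hqi.mul_const _) fun A hA _ => ?_
  have hA' : MeasurableSet (Prod.fst ⁻¹' A : Set (Charge qmin qmax × Pos d)) := measurable_fst hA
  set ν' := ν.restrict A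
  -- Charges outside `A` stay in place, those in `A` are spread uniformly over the unit ball; the
  -- charge marginal is unchanged.
  set μ' := μ.restrict (Prod.fst ⁻¹' A)ᶜ + ν'.prod (unitBall d)
  have hle1 : ν'.prod (unitBall d) ≤ n := Measure.prod_mono Measure.restrict_le_self le_rfl
  have hle : μ' ≤ (1 : ℝ≥0∞) • (μ + n) := by
    rw [one_smul]
    exact add_le_add Measure.restrict_le_self hle1
  have hleμ : μ ≤ (1 : ℝ≥0∞) • μ := by rw [one_smul]
  have hmarg : μ'.map Prod.fst = ν := by
    rw [Measure.map_add _ _ measurable_fst, Measure.map_fst_prod, measure_univ, one_smul,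
      ← Set.preimage_compl, ← Measure.restrict_map measurable_fst hA.compl, hμ.1, add_comm]
    exact Measure.restrict_add_restrict_compl hA
  have := isProbabilityMeasure_of_map_fst hmarg
  have hcμ' : Integrable (confinement g) μ' :=
    ((hμ.2.1.1.add_measure hcn).smul_measure ENNReal.one_ne_top).mono_measure hle
  have hmin := integral_zeta_le hμ hmarg hcμ'
    ((h0.add_right h1).mono ENNReal.one_ne_top hleμ hle)
    (((h0.add_right h1).add_left (h1.symm.add_right h2)).mono ENNReal.one_ne_top hle hle)
  have hz := (integral_zeta hμ.2.1.1 h0).1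
  have hzn := (integral_zeta hcn h1.symm).1.mono_measure hle1
  rw [integral_add_measure hz.integrableOn hzn, ← integral_add_compl hA' hz] at hmin
  have e1 : ∫ z in Prod.fst ⁻¹' A, zeta g μ z ∂μ = ∫ t in A, c t ∂ν := by
    rw [← hμ.1, setIntegral_map hA hc.aestronglyMeasurable measurable_fst.aemeasurable]
    exact setIntegral_congr_ae hA' (hcz.mono fun z hz _ => hz)
  have hqi' : Integrable (fun t : Charge qmin qmax => (t : ℝ)) ν' := hqi.integrableOn
  have hpot' : Integrable (fun y => b / 2 - potential μ y) (unitBall d) :=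
    (integrable_const _).sub hpot
  have e2 : ∫ z, zeta g μ z ∂(ν'.prod (unitBall d))
      ≤ ∫ z, (z.1 : ℝ) * (b / 2 - potential μ z.2) ∂(ν'.prod (unitBall d)) := by
    refine integral_mono_ae hzn (hqi'.mul_prod hpot') ?_
    have : ∀ᵐ z ∂(ν'.prod (unitBall d)), ‖z.2‖ < 1 :=
      Measure.quasiMeasurePreserving_snd.ae unitBall_ae_norm
    filter_upwards [this] with z hz
    have a1 := charge_nonneg hq z.1
    have a2 : 0 < g z.1 := ha.trans_le (hga _)
    have a3 : ‖z.2‖ ^ 2 ≤ 1 := pow_le_one₀ (norm_nonneg _) hz.le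
    have a4 : g z.1 * ‖z.2‖ ^ 2 ≤ b := by nlinarith [hgb z.1]
    have a5 : zeta g μ z = z.1 * (g z.1 * ‖z.2‖ ^ 2 / 2 - potential μ z.2) := by rw [zeta]; ring
    rw [a5]
    exact mul_le_mul_of_nonneg_left (by linarith) a1.le
  rw [integral_prod_mul (fun t : Charge qmin qmax => (t : ℝ)) (fun y => b / 2 - potential μ y),
    integral_sub (integrable_const _) hpot, integral_const, probReal_univ, one_smul] at e2
  rw [integral_mul_const]
  linarith

/-- On a minimizer the confinement and the potential are bounded. -/
lemma exists_minimizer_bound (hd : 2 ≤ d) (hq : 0 < qmin) (hg : Measurable g) (ha : 0 < a)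
    (hga : ∀ t, a ≤ g t) (hgb : ∀ t, g t ≤ b) (hμ : IsEnergyMinimizer g ν μ) :
    ∃ K : ℝ, ∀ᵐ z ∂μ, a / 2 * ‖z.2‖ ^ 2 - potential μ z.2 ≤ K := by
  obtain ⟨c, hc, hci, hcz⟩ := exists_zeta_eq_charge hg hμ
  have h := charge_constant_le hd hq hg ha hga hgb hμ hc hci hcz
  rw [← hμ.1] at h
  refine ⟨b / 2 - ∫ y, potential μ y ∂(unitBall d), ?_⟩
  filter_upwards [hcz, ae_of_ae_map measurable_fst.aemeasurable h] with z h1 h2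
  have a1 := charge_nonneg hq z.1
  have a5 : zeta g μ z = z.1 * (g z.1 / 2 * ‖z.2‖ ^ 2 - potential μ z.2) := by rw [zeta]; ring
  rw [← h1, a5] at h2
  have h3 := le_of_mul_le_mul_left h2 a1
  have : a / 2 * ‖z.2‖ ^ 2 ≤ g z.1 / 2 * ‖z.2‖ ^ 2 := by
    have := hga z.1
    gcongr
  linarith

lemma charge_mul_W_le (hq : 0 < qmin) (x : Pos d) (z : Charge qmin qmax × Pos d) :
    (z.1 : ℝ) * W d ‖x - z.2‖ ≤ qmax * (‖x‖ + ‖z.2‖) := by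
  have h1 := charge_nonneg hq z.1
  calc (z.1 : ℝ) * W d ‖x - z.2‖ ≤ z.1 * ‖x - z.2‖ :=
        mul_le_mul_of_nonneg_left (W_le_self (norm_nonneg _)) h1.le
    _ ≤ qmax * (‖x‖ + ‖z.2‖) :=
        mul_le_mul z.1.2.2 (norm_sub_le _ _) (norm_nonneg _) (h1.le.trans z.1.2.2)

lemma ae_integrable_potential (hq : 0 < qmin) [SFinite μ] (h : Interact μ μ) :
    ∀ᵐ z ∂μ, Integrable (fun z' : Charge qmin qmax × Pos d => (z'.1 : ℝ) * W d ‖z.2 - z'.2‖) μ := by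
  filter_upwards [h.2.prod_right_ae] with z hz
  have h0 := (charge_nonneg hq z.1).ne'
  refine (hz.const_mul (z.1 : ℝ)⁻¹).congr (ae_of_all _ fun z' => ?_)
  simp only
  rw [interaction_eq, inv_mul_cancel_left₀ h0]

lemma le_max_of_sq_le {a k m s : ℝ} (ha : 0 < a) (hk : 0 ≤ k)
    (h : a / 2 * s ^ 2 ≤ k + m * s) : s ≤ max 1 (2 / a * (k + m)) := by
  by_contra hlt
  rw [not_le, max_lt_iff] at hlt
  obtain ⟨h4, h5⟩ := hlt
  rw [div_mul_eq_mul_div, div_lt_iff₀ ha] at h5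
  have h6 : (k + m) * s < a / 2 * s * s := by
    refine mul_lt_mul_of_pos_right ?_ (by linarith)
    linarith
  nlinarith

/-- A minimizer has bounded support. -/
lemma exists_minimizer_support_bound (hd : 2 ≤ d) (hq : 0 < qmin) (hg : Measurable g) (ha : 0 < a)
    (hga : ∀ t, a ≤ g t) (hgb : ∀ t, g t ≤ b) (hμ : IsEnergyMinimizer g ν μ) :
    ∃ R : ℝ, 0 ≤ R ∧ ∀ᵐ z ∂μ, ‖z.2‖ ≤ R := by
  have := isProbabilityMeasure_of_map_fst hμ.1
  have hm := integrable_norm_minimizer hq ha hga hμ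
  obtain ⟨K, hK⟩ := exists_minimizer_bound hd hq hg ha hga hgb hμ
  set M := ∫ z, ‖z.2‖ ∂μ
  have hM : 0 ≤ M := integral_nonneg fun z => norm_nonneg _
  obtain ⟨t⟩ : Nonempty (Charge qmin qmax) := ν.nonempty_of_neZero
  have hqm : 0 < qmax := (charge_nonneg hq t).trans_le t.2.2
  refine ⟨max 1 (2 / a * (|K| + qmax * M + qmax)), le_max_of_le_left zero_le_one, ?_⟩
  filter_upwards [hK, ae_integrable_potential hq hμ.2.1.interact] with z h1 h2
  -- `W r ≤ r` gives linear growth of the potential, which cannot balance the quadratic confinement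
  -- far away.
  have h3 : potential μ z.2 ≤ qmax * (‖z.2‖ + M) := by
    calc potential μ z.2 ≤ ∫ z' : Charge qmin qmax × Pos d, qmax * (‖z.2‖ + ‖z'.2‖) ∂μ :=
          integral_mono h2 (((integrable_const _).add hm).const_mul _) fun z' => charge_mul_W_le hq z.2 z'
      _ = _ := by
          rw [integral_const_mul, integral_add (integrable_const _) hm, integral_const,
            probReal_univ, one_smul]
  refine le_max_of_sq_le ha (by positivity) ?_
  linarith [le_abs_self K]

/-- The singular part of the potential of a double-layer measure. -/
def singularPotential (m : Measure (Charge qmin qmax × Pos d)) (y : Pos d) : ℝ≥0∞ :=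
  ∫⁻ z, ENNReal.ofReal (-((z.1 : ℝ) * W d ‖y - z.2‖)) ∂m

lemma measurable_singular (y : Pos d) : Measurable fun z : Charge qmin qmax × Pos d =>
    ENNReal.ofReal (-((z.1 : ℝ) * W d ‖y - z.2‖)) := by
  have := measurable_W d
  fun_prop

/-- `exists_minimizer_bound` bounds the potential below by `-K`. On the bounded support `q W` is at
most `2 R qmax`, so `2 R qmax - q W` is nonnegative, dominates the singular part and has integral at
most `2 R qmax + K`. -/
lemma ae_singularPotential_le (hd : 2 ≤ d) (hq : 0 < qmin) (hg : Measurable g) (ha : 0 < a)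
    (hga : ∀ t, a ≤ g t) (hgb : ∀ t, g t ≤ b) (hμ : IsEnergyMinimizer g ν μ) :
    ∃ C : ℝ≥0∞, C < ⊤ ∧ ∀ᵐ z ∂μ, singularPotential μ z.2 ≤ C := by
  have := isProbabilityMeasure_of_map_fst hμ.1
  have hm := integrable_norm_minimizer hq ha hga hμ
  obtain ⟨K, hK⟩ := exists_minimizer_bound hd hq hg ha hga hgb hμ
  obtain ⟨R, hR, hRz⟩ := exists_minimizer_support_bound hd hq hg ha hga hgb hμ
  obtain ⟨t⟩ : Nonempty (Charge qmin qmax) := ν.nonempty_of_neZero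
  have hqm : 0 < qmax := (charge_nonneg hq t).trans_le t.2.2
  refine ⟨ENNReal.ofReal (K + qmax * (R + R)), ENNReal.ofReal_lt_top, ?_⟩
  filter_upwards [hK, hRz, ae_integrable_potential hq hμ.2.1.interact] with z h1 h2 h3
  have hle : singularPotential μ z.2 ≤ ∫⁻ z' : Charge qmin qmax × Pos d,
      ENNReal.ofReal (qmax * (R + R) - (z'.1 : ℝ) * W d ‖z.2 - z'.2‖) ∂μ := by
    refine lintegral_mono fun z' => ENNReal.ofReal_le_ofReal ?_
    have : 0 ≤ qmax * (R + R) := by positivity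
    linarith
  refine hle.trans ?_
  have h5 : Integrable (fun z' : Charge qmin qmax × Pos d =>
      qmax * (R + R) - (z'.1 : ℝ) * W d ‖z.2 - z'.2‖) μ := (integrable_const _).sub h3
  rw [← ofReal_integral_eq_lintegral_ofReal h5]
  · refine ENNReal.ofReal_le_ofReal ?_
    rw [integral_sub (integrable_const _) h3, integral_const, probReal_univ, one_smul]
    have : 0 ≤ a / 2 * ‖z.2‖ ^ 2 := by positivity
    have h4 : potential μ z.2 = ∫ z' : Charge qmin qmax × Pos d, (z'.1 : ℝ) * W d ‖z.2 - z'.2‖ ∂μ := rfl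
    linarith
  · filter_upwards [hRz] with z' hz'
    have h4 := charge_mul_W_le hq z.2 z'
    have : qmax * (‖z.2‖ + ‖z'.2‖) ≤ qmax * (R + R) := by gcongr
    simp only [Pi.zero_apply]
    linarith

/-- If the layer over `y` had positive mass, its square would be charged by the product measure,
although it lies in the excluded diagonal. -/
lemma ae_ne_of_interact [SFinite μ] (h : Interact μ μ) (y : Pos d) : ∀ᵐ z ∂μ, y ≠ z.2 := by
  have hA : MeasurableSet {z : Charge qmin qmax × Pos d | y = z.2} :=
    measurableSet_eq_fun measurable_const measurable_snd
  have h1 := h.1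
  rw [ae_iff] at h1 ⊢
  simp only [ne_eq, not_not] at h1 ⊢
  have h2 : μ.prod μ ({z | y = z.2} ×ˢ {z | y = z.2}) = 0 :=
    measure_mono_null (fun p hp => hp.1.symm.trans hp.2) h1
  rw [Measure.prod_prod] at h2
  exact mul_self_eq_zero.1 h2

lemma continuousAt_W (hd : 2 ≤ d) {r : ℝ} (hr : r ≠ 0) : ContinuousAt (W d) r :=
  (hasDerivAt_W hd hr).continuousAt

/-- The singular part of the potential is lower semicontinuous. -/
lemma isClosed_singularPotential_le (hd : 2 ≤ d) (C : ℝ≥0∞) :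
    IsClosed {y | singularPotential μ y ≤ C} := by
  refine isSeqClosed_iff_isClosed.1 fun u y hu hy => ?_
  have h1 : singularPotential μ y ≤ ∫⁻ z, liminf (fun n =>
      ENNReal.ofReal (-((z.1 : ℝ) * W d ‖u n - z.2‖))) atTop ∂μ := by
    refine lintegral_mono fun z => ?_
    by_cases hyz : ‖y - z.2‖ = 0
    -- At a coincidence the integrand on the left is `0` by the default value of `W`, so nothing has
    -- to converge.
    · simp [hyz, W_zero hd]
    · refine (Tendsto.liminf_eq ?_).ge
      have h2 : Tendsto (fun n => ‖u n - z.2‖) atTop (𝓝 ‖y - z.2‖) := (hy.sub_const _).norm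
      exact ENNReal.tendsto_ofReal ((((continuousAt_W hd hyz).tendsto.comp h2).const_mul _).neg)
  refine h1.trans ((lintegral_liminf_le fun n => measurable_singular (u n)).trans ?_)
  exact liminf_le_of_frequently_le' (Frequently.of_forall hu)

/-- A doubling property: comparing the kernel at `s` with its value at a distance up to `2 * s`
costs only a factor and an additive constant. -/
lemma neg_W_le_of_le_two_mul (hd : 2 ≤ d) {r s : ℝ} (hr : 0 < r) (hrs : r ≤ 2 * s) :
    -W d s ≤ 2 ^ d * max (-W d r) 0 + 1 := by
  have hs : 0 < s := by linarith
  unfold W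
  split_ifs with h
  · subst h
    have h1 := Real.log_le_log hr hrs
    rw [Real.log_mul two_ne_zero hs.ne'] at h1
    have h2 : Real.log 2 ≤ 1 := by linarith [Real.log_le_sub_one_of_pos (zero_lt_two' ℝ)]
    have h3 := le_max_left (-Real.log r) 0
    have h4 := le_max_right (-Real.log r) 0
    norm_num
    linarith
  · rw [neg_neg, neg_neg]
    have h1 : 0 < 1 / r ^ (d - 2) := by positivity
    rw [max_eq_left h1.le]
    have h2 : 1 / s ^ (d - 2) ≤ 2 ^ (d - 2) * (1 / r ^ (d - 2)) := by
      have : r ^ (d - 2) ≤ 2 ^ (d - 2) * s ^ (d - 2) := by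
        rw [← mul_pow]; exact pow_le_pow_left₀ hr.le hrs _
      rw [mul_one_div, div_le_div_iff₀ (by positivity) (by positivity)]
      linarith
    have h3 : (2 : ℝ) ^ (d - 2) ≤ 2 ^ d := pow_le_pow_right₀ (by norm_num) (by omega)
    nlinarith

/-- The potential of a minimizer is finite everywhere. -/
lemma singularPotential_lt_top (hd : 2 ≤ d) (hq : 0 < qmin) (hg : Measurable g) (ha : 0 < a)
    (hga : ∀ t, a ≤ g t) (hgb : ∀ t, g t ≤ b) (hμ : IsEnergyMinimizer g ν μ) (y : Pos d) :
    singularPotential μ y < ⊤ := by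
  have := isProbabilityMeasure_of_map_fst hμ.1
  obtain ⟨C, hC, hCz⟩ := ae_singularPotential_le hd hq hg ha hga hgb hμ
  set F : Set (Pos d) := {y | singularPotential μ y ≤ C}
  have hF : IsClosed F := isClosed_singularPotential_le hd C
  obtain ⟨z₀, hz₀⟩ := hCz.exists
  -- `F` is closed and carries `μ`. For `p` in `F` nearest to `y` and `z` in `F`, `‖p - z‖ ≤ ‖p - y‖
  -- + ‖y - z‖ ≤ 2 ‖y - z‖`, so the potential at `y` is controlled by that at `p`.
  obtain ⟨p, hp, hpy⟩ := hF.exists_infDist_eq_dist ⟨z₀.2, hz₀⟩ y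
  have hbound : ∀ᵐ z ∂μ, ENNReal.ofReal (-((z.1 : ℝ) * W d ‖y - z.2‖))
      ≤ ENNReal.ofReal (2 ^ d) * ENNReal.ofReal (-((z.1 : ℝ) * W d ‖p - z.2‖))
        + ENNReal.ofReal qmax := by
    filter_upwards [hCz, ae_ne_of_interact hμ.2.1.interact p] with z hz hpz
    have h1 : dist y p ≤ dist y z.2 := hpy ▸ Metric.infDist_le_dist_of_mem hz
    have h2 : ‖p - z.2‖ ≤ 2 * ‖y - z.2‖ := by
      rw [← dist_eq_norm, ← dist_eq_norm]
      linarith [dist_triangle p y z.2, dist_comm p y]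
    have h3 : 0 < ‖p - z.2‖ := norm_pos_iff.2 (sub_ne_zero.2 hpz)
    have h4 := neg_W_le_of_le_two_mul hd h3 h2
    have hz1 := charge_nonneg hq z.1
    have h5 : -((z.1 : ℝ) * W d ‖y - z.2‖)
        ≤ 2 ^ d * max (-((z.1 : ℝ) * W d ‖p - z.2‖)) 0 + qmax := by
      have h6 : max (-((z.1 : ℝ) * W d ‖p - z.2‖)) 0 = z.1 * max (-W d ‖p - z.2‖) 0 := by
        rw [mul_max_of_nonneg _ _ hz1.le, mul_zero, mul_neg]
      rw [h6]
      have := mul_le_mul_of_nonneg_left h4 hz1.le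
      linarith [z.1.2.2]
    refine (ENNReal.ofReal_le_ofReal h5).trans ?_
    rw [ENNReal.ofReal_add (by positivity) (hz1.le.trans z.1.2.2), ENNReal.ofReal_mul (by positivity),
      ENNReal.ofReal_max, ENNReal.ofReal_zero, max_eq_left zero_le]
  refine (lintegral_mono_ae hbound).trans_lt ?_
  rw [lintegral_add_right _ measurable_const, lintegral_const_mul _ (measurable_singular p),
    lintegral_const, measure_univ, mul_one]
  exact ENNReal.add_lt_top.2 ⟨ENNReal.mul_lt_top ENNReal.ofReal_lt_top (hp.trans_lt hC),
    ENNReal.ofReal_lt_top⟩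

/-- The potential of a minimizer converges absolutely at every point. -/
lemma integrable_potential_minimizer (hd : 2 ≤ d) (hq : 0 < qmin) (hg : Measurable g) (ha : 0 < a)
    (hga : ∀ t, a ≤ g t) (hgb : ∀ t, g t ≤ b) (hμ : IsEnergyMinimizer g ν μ) (y : Pos d) :
    Integrable (fun z : Charge qmin qmax × Pos d => (z.1 : ℝ) * W d ‖y - z.2‖) μ := by
  have := isProbabilityMeasure_of_map_fst hμ.1
  have hm := integrable_norm_minimizer hq ha hga hμ
  have hW := measurable_W d
  refine ⟨(by fun_prop : Measurable _).aestronglyMeasurable, ?_⟩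
  have hi : Integrable (fun z : Charge qmin qmax × Pos d => qmax * (‖y‖ + ‖z.2‖)) μ :=
    ((integrable_const _).add hm).const_mul _
  have hb : ∀ z : Charge qmin qmax × Pos d, ‖(z.1 : ℝ) * W d ‖y - z.2‖‖ₑ
      ≤ ENNReal.ofReal (-((z.1 : ℝ) * W d ‖y - z.2‖)) + ENNReal.ofReal (qmax * (‖y‖ + ‖z.2‖)) := by
    intro z
    have h1 := charge_mul_W_le hq y z
    rw [Real.enorm_eq_ofReal_abs]
    rcases le_total ((z.1 : ℝ) * W d ‖y - z.2‖) 0 with h | h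
    · rw [abs_of_nonpos h]; exact le_self_add
    · rw [abs_of_nonneg h]
      exact (ENNReal.ofReal_le_ofReal h1).trans le_add_self
  refine (lintegral_mono hb).trans_lt ?_
  rw [lintegral_add_left (measurable_singular y)]
  exact ENNReal.add_lt_top.2 ⟨singularPotential_lt_top hd hq hg ha hga hgb hμ y, hi.lintegral_lt_top⟩

end

/-! ### Charge distributions in space and their dilations. -/

section
variable {d N : ℕ} {qmin qmax : ℝ} {m : Measure (Charge qmin qmax × Pos d)}

/-- The charge distribution in space of a double-layer measure. -/
def chargeMeasure (m : Measure (Charge qmin qmax × Pos d)) : Measure (Pos d) :=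
  (m.withDensity fun z => ENNReal.ofReal z.1).map Prod.snd

lemma measurable_ofReal_charge :
    Measurable fun z : Charge qmin qmax × Pos d => ENNReal.ofReal z.1 := by fun_prop

lemma isFiniteMeasure_withDensity_charge [IsFiniteMeasure m] :
    IsFiniteMeasure (m.withDensity fun z => ENNReal.ofReal z.1) := by
  refine isFiniteMeasure_withDensity (ne_of_lt ?_)
  calc ∫⁻ z, ENNReal.ofReal z.1 ∂m ≤ ∫⁻ _, ENNReal.ofReal qmax ∂m :=
        lintegral_mono fun z => ENNReal.ofReal_le_ofReal z.1.2.2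
    _ < ⊤ := by
        rw [lintegral_const]
        exact ENNReal.mul_lt_top ENNReal.ofReal_lt_top (measure_lt_top _ _)

instance isFiniteMeasure_chargeMeasure [IsFiniteMeasure m] : IsFiniteMeasure (chargeMeasure m) := by
  have := isFiniteMeasure_withDensity_charge (m := m)
  unfold chargeMeasure
  infer_instance

/-- As all charges are positive, weighting by `ENNReal.ofReal` loses nothing, and a double-layer
measure acts through a positive measure on space, to which the field estimates apply. -/
lemma integral_chargeMeasure {E : Type*} [NormedAddCommGroup E] [NormedSpace ℝ E] (hq : 0 < qmin)
    {f : Pos d → E} (hf : StronglyMeasurable f) :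
    ∫ b, f b ∂(chargeMeasure m) = ∫ z, (z.1 : ℝ) • f z.2 ∂m := by
  rw [chargeMeasure, integral_map measurable_snd.aemeasurable hf.aestronglyMeasurable,
    integral_withDensity_eq_integral_toReal_smul measurable_ofReal_charge
      (ae_of_all _ fun _ => ENNReal.ofReal_lt_top)]
  refine integral_congr_ae (ae_of_all _ fun z => ?_)
  simp only [ENNReal.toReal_ofReal (charge_nonneg hq z.1).le]

lemma integrable_chargeMeasure (hq : 0 < qmin) {f : Pos d → ℝ} (hf : StronglyMeasurable f)
    (h : Integrable (fun z => (z.1 : ℝ) * f z.2) m) : Integrable f (chargeMeasure m) := by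
  rw [chargeMeasure, integrable_map_measure hf.aestronglyMeasurable measurable_snd.aemeasurable,
    integrable_withDensity_iff_integrable_smul' measurable_ofReal_charge
      (ae_of_all _ fun _ => ENNReal.ofReal_lt_top)]
  refine h.congr (ae_of_all _ fun z => ?_)
  simp [ENNReal.toReal_ofReal (charge_nonneg hq z.1).le]

lemma ae_chargeMeasure {P : Pos d → Prop} (hP : MeasurableSet {b | P b}) (h : ∀ᵐ z ∂m, P z.2) :
    ∀ᵐ b ∂(chargeMeasure m), P b := by
  rw [chargeMeasure, ae_map_iff measurable_snd.aemeasurable hP]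
  exact (withDensity_absolutelyContinuous _ _).ae_le h

lemma chargeMeasure_prod [IsFiniteMeasure m] :
    (chargeMeasure m).prod (chargeMeasure m) =
      ((m.prod m).withDensity fun p => ENNReal.ofReal p.1.1 * ENNReal.ofReal p.2.1).map
        (Prod.map Prod.snd Prod.snd) := by
  have := isFiniteMeasure_withDensity_charge (m := m)
  rw [chargeMeasure, Measure.map_prod_map _ _ measurable_snd measurable_snd,
    prod_withDensity measurable_ofReal_charge measurable_ofReal_charge]

lemma measurableSet_prod_ne : MeasurableSet {z : Pos d × Pos d | z.1 ≠ z.2} :=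
  (measurableSet_eq_fun measurable_fst measurable_snd).compl

lemma ae_ne_chargeMeasure_prod [IsFiniteMeasure m] (h : Interact m m) :
    ∀ᵐ z ∂((chargeMeasure m).prod (chargeMeasure m)), z.1 ≠ z.2 := by
  rw [chargeMeasure_prod, ae_map_iff (by fun_prop) measurableSet_prod_ne]
  exact (withDensity_absolutelyContinuous _ _).ae_le h.1

lemma stronglyMeasurable_W_sub : StronglyMeasurable fun z : Pos d × Pos d => W d ‖z.1 - z.2‖ := by
  have := measurable_W d
  exact Measurable.stronglyMeasurable (by fun_prop)

lemma integrable_W_chargeMeasure_prod [IsFiniteMeasure m] (hq : 0 < qmin) (h : Interact m m) :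
    Integrable (fun z => W d ‖z.1 - z.2‖) ((chargeMeasure m).prod (chargeMeasure m)) := by
  rw [chargeMeasure_prod, integrable_map_measure stronglyMeasurable_W_sub.aestronglyMeasurable
    (by fun_prop), integrable_withDensity_iff_integrable_smul' (by fun_prop)
      (ae_of_all _ fun _ => ENNReal.mul_lt_top ENNReal.ofReal_lt_top ENNReal.ofReal_lt_top)]
  refine h.2.congr (ae_of_all _ fun p => ?_)
  simp [interaction, ENNReal.toReal_ofReal (charge_nonneg hq p.1.1).le,
    ENNReal.toReal_ofReal (charge_nonneg hq p.2.1).le]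

lemma interactionEnergy_chargeMeasure [IsFiniteMeasure m] (hq : 0 < qmin) :
    interactionEnergy (chargeMeasure m) (chargeMeasure m) = crossEnergy m m := by
  rw [interactionEnergy, chargeMeasure_prod,
    integral_map (by fun_prop) stronglyMeasurable_W_sub.aestronglyMeasurable,
    integral_withDensity_eq_integral_toReal_smul (by fun_prop)
      (ae_of_all _ fun _ => ENNReal.mul_lt_top ENNReal.ofReal_lt_top ENNReal.ofReal_lt_top),
    crossEnergy]
  refine integral_congr_ae (ae_of_all _ fun p => ?_)
  simp [interaction, ENNReal.toReal_ofReal (charge_nonneg hq p.1.1).le,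
    ENNReal.toReal_ofReal (charge_nonneg hq p.2.1).le]

lemma stronglyMeasurable_W_sub_left (y : Pos d) : StronglyMeasurable fun b : Pos d => W d ‖y - b‖ := by
  have := measurable_W d
  exact Measurable.stronglyMeasurable (by fun_prop)

lemma pot_chargeMeasure (hq : 0 < qmin) (y : Pos d) : pot (chargeMeasure m) y = potential m y :=
  integral_chargeMeasure hq (stronglyMeasurable_W_sub_left y)

lemma chargeMeasure_real_univ (hq : 0 < qmin) :
    (chargeMeasure m).real Set.univ = ∫ z, (z.1 : ℝ) ∂m := by
  have := integral_chargeMeasure (m := m) hq (stronglyMeasurable_const (b := (1 : ℝ)))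
  simpa using this

/-- The behaviour of the kernel under dilations. -/
lemma W_mul (hd : 2 ≤ d) {l r : ℝ} (hl : 0 < l) (hr : r ≠ 0) :
    W d (l * r) = 1 / l ^ (d - 2) * W d r + if d = 2 then Real.log l else 0 := by
  unfold W
  split_ifs with h
  · subst h
    rw [Real.log_mul hl.ne' hr]; simp; ring
  · rw [mul_pow]
    have : l ^ (d - 2) ≠ 0 := pow_ne_zero _ hl.ne'
    have : r ^ (d - 2) ≠ 0 := pow_ne_zero _ hr
    field_simp; ring

lemma W_norm_smul_sub (hd : 2 ≤ d) {l : ℝ} (hl : 0 < l) {a b : Pos d} (hab : a ≠ b) :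
    W d ‖l • a - l • b‖ = 1 / l ^ (d - 2) * W d ‖a - b‖ + if d = 2 then Real.log l else 0 := by
  rw [← smul_sub, norm_smul, Real.norm_of_nonneg hl.le,
    W_mul hd hl (norm_ne_zero_iff.2 (sub_ne_zero.2 hab))]

section dilation
variable {β : Measure (Pos d)} {l : ℝ}

/-- The image of a measure under a dilation. -/
def dilate (l : ℝ) (β : Measure (Pos d)) : Measure (Pos d) := β.map (l • ·)

lemma dilate_real_univ : (dilate l β).real Set.univ = β.real Set.univ := by
  rw [dilate, map_measureReal_apply (by fun_prop) MeasurableSet.univ, Set.preimage_univ]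

variable [IsFiniteMeasure β]

instance : IsFiniteMeasure (dilate l β) := by unfold dilate; infer_instance

lemma pot_dilate (hd : 2 ≤ d) (hl : 0 < l) {y : Pos d} (hi : Integrable (fun b => W d ‖y - b‖) β)
    (hne : ∀ᵐ b ∂β, y ≠ b) : Integrable (fun b => W d ‖l • y - b‖) (dilate l β) ∧
    pot (dilate l β) (l • y) =
      1 / l ^ (d - 2) * pot β y + (if d = 2 then Real.log l else 0) * β.real Set.univ := by
  have e : (fun b => W d ‖l • y - l • b‖) =ᵐ[β] fun b =>
      1 / l ^ (d - 2) * W d ‖y - b‖ + if d = 2 then Real.log l else 0 := by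
    filter_upwards [hne] with b hb using W_norm_smul_sub hd hl hb
  have hi' := (hi.const_mul (1 / l ^ (d - 2))).add
    (integrable_const (if d = 2 then Real.log l else 0))
  refine ⟨(integrable_map_measure (stronglyMeasurable_W_sub_left _).aestronglyMeasurable
    (by fun_prop)).2 (hi'.congr e.symm), ?_⟩
  rw [pot, dilate, integral_map (by fun_prop) (stronglyMeasurable_W_sub_left _).aestronglyMeasurable,
    integral_congr_ae e, integral_add (hi.const_mul _) (integrable_const _), integral_const_mul,
    integral_const, pot, smul_eq_mul, mul_comm (β.real Set.univ)]

lemma dilate_prod : (dilate l β).prod (dilate l β) =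
    (β.prod β).map (Prod.map (l • ·) (l • ·)) := by
  rw [dilate, Measure.map_prod_map _ _ (by fun_prop) (by fun_prop)]

lemma ae_ne_dilate_prod (hl : 0 < l) (hne : ∀ᵐ z ∂(β.prod β), z.1 ≠ z.2) :
    ∀ᵐ z ∂((dilate l β).prod (dilate l β)), z.1 ≠ z.2 := by
  rw [dilate_prod, ae_map_iff (by fun_prop) measurableSet_prod_ne]
  filter_upwards [hne] with z hz h
  exact hz (smul_right_injective _ hl.ne' h)

lemma interactionEnergy_dilate (hd : 2 ≤ d) (hl : 0 < l) (hne : ∀ᵐ z ∂(β.prod β), z.1 ≠ z.2)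
    (hi : Integrable (fun z => W d ‖z.1 - z.2‖) (β.prod β)) :
    Integrable (fun z => W d ‖z.1 - z.2‖) ((dilate l β).prod (dilate l β)) ∧
    interactionEnergy (dilate l β) (dilate l β) = 1 / l ^ (d - 2) * interactionEnergy β β
      + (if d = 2 then Real.log l else 0) * β.real Set.univ ^ 2 := by
  have e : (fun z : Pos d × Pos d => W d ‖l • z.1 - l • z.2‖) =ᵐ[β.prod β] fun z =>
      1 / l ^ (d - 2) * W d ‖z.1 - z.2‖ + if d = 2 then Real.log l else 0 := by
    filter_upwards [hne] with z hz using W_norm_smul_sub hd hl hz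
  have hi' := (hi.const_mul (1 / l ^ (d - 2))).add
    (integrable_const (if d = 2 then Real.log l else 0))
  rw [interactionEnergy, dilate_prod]
  refine ⟨(integrable_map_measure stronglyMeasurable_W_sub.aestronglyMeasurable
    (by fun_prop)).2 (hi'.congr e.symm), ?_⟩
  rw [integral_map (by fun_prop) stronglyMeasurable_W_sub.aestronglyMeasurable]
  simp only [Prod.map_fst, Prod.map_snd]
  rw [integral_congr_ae e, integral_add (hi.const_mul _) (integrable_const _), integral_const_mul,
    integral_const, interactionEnergy, smul_eq_mul, ← Set.univ_prod_univ, measureReal_prod_prod]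
  ring

/-- The behaviour under dilations of the interaction energy without self-interactions. -/
lemma offDiagonalEnergy_dilate (hd : 2 ≤ d) (hl : 0 < l) (q : Fin N → ℝ) {p : Fin N → Pos d}
    (hp : Function.Injective p) (hne : ∀ᵐ z ∂(β.prod β), z.1 ≠ z.2)
    (hi : Integrable (fun z => W d ‖z.1 - z.2‖) (β.prod β))
    (hpot : ∀ y, Integrable (fun b => W d ‖y - b‖) β) (hpne : ∀ y, ∀ᵐ b ∂β, y ≠ b) :
    offDiagonalEnergy q (fun i => l • p i) (dilate l β) =
      1 / l ^ (d - 2) * offDiagonalEnergy q p β + (if d = 2 then Real.log l else 0) *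
        ((∑ i, q i - β.real Set.univ) ^ 2 - ∑ i, q i ^ 2) := by
  set s := 1 / l ^ (d - 2)
  set t := if d = 2 then Real.log l else 0
  have h1 : ∑ i, ∑ j ∈ Finset.univ.erase i, q i * q j * W d ‖l • p i - l • p j‖ =
      s * (∑ i, ∑ j ∈ Finset.univ.erase i, q i * q j * W d ‖p i - p j‖)
        + t * ((∑ i, q i) ^ 2 - ∑ i, q i ^ 2) := by
    have : (∑ i, q i) ^ 2 - ∑ i, q i ^ 2 = ∑ i, ∑ j ∈ Finset.univ.erase i, q i * q j := by
      rw [sq, Finset.sum_mul_sum, ← Finset.sum_sub_distrib]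
      refine Finset.sum_congr rfl fun i _ => ?_
      rw [← Finset.add_sum_erase _ _ (Finset.mem_univ i)]; ring
    rw [this, Finset.mul_sum, Finset.mul_sum, ← Finset.sum_add_distrib]
    refine Finset.sum_congr rfl fun i _ => ?_
    rw [Finset.mul_sum, Finset.mul_sum, ← Finset.sum_add_distrib]
    refine Finset.sum_congr rfl fun j hj => ?_
    rw [W_norm_smul_sub hd hl (hp.ne (Finset.ne_of_mem_erase hj).symm)]
    simp only [s, t]; ring
  have h2 : ∑ i, q i * pot (dilate l β) (l • p i) =
      s * (∑ i, q i * pot β (p i)) + t * ((∑ i, q i) * β.real Set.univ) := by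
    rw [Finset.mul_sum, Finset.sum_mul, Finset.mul_sum, ← Finset.sum_add_distrib]
    refine Finset.sum_congr rfl fun i _ => ?_
    rw [(pot_dilate hd hl (hpot _) (hpne _)).2]
    simp only [s, t]; ring
  -- The logarithmic corrections are `(∑ q)² - ∑ q²` from the pairs, `-2 (∑ q) b` from the cross
  -- terms and `b²` from the background of total charge `b`: the square of the total charge without
  -- the diagonal.
  rw [offDiagonalEnergy, offDiagonalEnergy, h1, h2, (interactionEnergy_dilate hd hl hne hi).2]
  ring

end dilation

end

/-! ### Blow-up and splitting of the Hamiltonian. -/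

section
variable {d N : ℕ} {qmin qmax : ℝ} {g : Charge qmin qmax → ℝ} {ν : Measure (Charge qmin qmax)}
  {μ m : Measure (Charge qmin qmax × Pos d)}

lemma measurableSet_pos_ne (y : Pos d) : MeasurableSet {b | y ≠ b} :=
  (measurableSet_eq_fun measurable_const measurable_id).compl

lemma integral_pointMeasure {E : Type*} [NormedAddCommGroup E] [NormedSpace ℝ E] [CompleteSpace E]
    (q : Fin N → Charge qmin qmax)
    (p : Fin N → Pos d) {f : Charge qmin qmax × Pos d → E} (hf : StronglyMeasurable f) :
    ∫ z, f z ∂(pointMeasure q p) = ∑ i, f (q i, p i) := by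
  rw [pointMeasure, integral_finsetSum_measure fun i _ => integrable_dirac' hf enorm_lt_top]
  exact Finset.sum_congr rfl fun i _ => integral_dirac' _ _ hf

instance isFiniteMeasure_pointMeasure (q : Fin N → Charge qmin qmax) (p : Fin N → Pos d) :
    IsFiniteMeasure (pointMeasure q p) := by unfold pointMeasure; infer_instance

lemma field_pointMeasure (hq : 0 < qmin) (q : Fin N → Charge qmin qmax) (p : Fin N → Pos d)
    (y : Pos d) : field (chargeMeasure (pointMeasure q p)) y =
      ∑ i, (q i : ℝ) • coulombField d (y - p i) := by
  have hK := measurable_coulombField d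
  rw [field, integral_chargeMeasure hq (Measurable.stronglyMeasurable (by fun_prop)),
    integral_pointMeasure q p (Measurable.stronglyMeasurable (by fun_prop))]

lemma ae_norm_pointMeasure {R : ℝ} (q : Fin N → Charge qmin qmax) {p : Fin N → Pos d}
    (hp : ∀ i, ‖p i‖ ≤ R) : ∀ᵐ b ∂(chargeMeasure (pointMeasure q p)), ‖b‖ ≤ R := by
  refine ae_chargeMeasure (measurableSet_le measurable_norm measurable_const) ?_
  rw [pointMeasure, ae_finsetSum_measure_iff]
  intro i _
  rw [ae_dirac_iff (measurableSet_le (by fun_prop) measurable_const)]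
  exact hp i

/-- The dilation factor of the blow-up. -/
def blowUpFactor (d N : ℕ) : ℝ := (N : ℝ) ^ (1 / (d : ℝ))

lemma blowUpFactor_pos (hN : 1 ≤ N) : 0 < blowUpFactor d N :=
  Real.rpow_pos_of_pos (by exact_mod_cast hN) _

lemma blowUpFactor_pow (hd : 2 ≤ d) (hN : 1 ≤ N) :
    blowUpFactor d N ^ (d - 2) = (N : ℝ) ^ (1 - 2 / (d : ℝ)) := by
  have hd' : (d : ℝ) ≠ 0 := by positivity
  rw [blowUpFactor, ← Real.rpow_natCast, ← Real.rpow_mul (by positivity), Nat.cast_sub hd]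
  congr 1
  push_cast
  field_simp

lemma potential_blowUpMeasure [IsFiniteMeasure μ] (hq : 0 < qmin) (y : Pos d) :
    potential (blowUpMeasure N μ) y =
      pot (dilate (blowUpFactor d N) (chargeMeasure ((N : ℝ≥0∞) • μ))) y := by
  have hW := measurable_W d
  rw [pot, dilate, integral_map (by fun_prop) (stronglyMeasurable_W_sub_left _).aestronglyMeasurable,
    integral_chargeMeasure hq (Measurable.stronglyMeasurable (by fun_prop)), integral_smul_measure,
    potential, blowUpMeasure, integral_smul_measure, integral_map (by fun_prop)
    (Measurable.aestronglyMeasurable (by fun_prop))]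
  rfl

lemma isFiniteMeasure_natCast_smul [IsFiniteMeasure m] : IsFiniteMeasure ((N : ℝ≥0∞) • m) :=
  m.smul_finite (ENNReal.natCast_ne_top N)

lemma isWeakGradient_rescaledPotential [IsFiniteMeasure μ] (hd : 2 ≤ d) (hq : 0 < qmin)
    (q : Fin N → Charge qmin qmax) (x : Fin N → Pos d) {R : ℝ}
    (hR : ∀ᵐ b ∂(dilate (blowUpFactor d N) (chargeMeasure ((N : ℝ≥0∞) • μ))), ‖b‖ ≤ R)
    (hxR : ∀ i, ‖blowUp x i‖ ≤ R) :
    IsWeakGradient (rescaledPotential μ q x)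
      (particleField (fun i => (q i : ℝ)) (blowUp x)
        (dilate (blowUpFactor d N) (chargeMeasure ((N : ℝ≥0∞) • μ)))) := by
  have := isFiniteMeasure_natCast_smul (N := N) (m := μ)
  have h := (isWeakGradient_pot hd (ae_norm_pointMeasure q hxR)).sub (isWeakGradient_pot hd hR)
  have e1 : rescaledPotential μ q x = pot (chargeMeasure (pointMeasure q (blowUp x)))
      - pot (dilate (blowUpFactor d N) (chargeMeasure ((N : ℝ≥0∞) • μ))) := by
    ext y
    rw [rescaledPotential, Pi.sub_apply, pot_chargeMeasure hq, potential_blowUpMeasure hq]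
  have e2 : particleField (fun i => (q i : ℝ)) (blowUp x)
      (dilate (blowUpFactor d N) (chargeMeasure ((N : ℝ≥0∞) • μ))) =
      field (chargeMeasure (pointMeasure q (blowUp x)))
      - field (dilate (blowUpFactor d N) (chargeMeasure ((N : ℝ≥0∞) • μ))) := by
    ext1 y
    rw [particleField, Pi.sub_apply, field_pointMeasure hq]
  rw [e1, e2]
  exact h

/-- Expansion of the Hamiltonian around the equilibrium measure. -/
lemma hamiltonian_eq [IsProbabilityMeasure μ] (hq : 0 < qmin) (hg : Measurable g)
    (hμ : HasFiniteEnergy g μ) (q : Fin N → Charge qmin qmax) (x : Fin N → Pos d) :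
    hamiltonian g q x = (N : ℝ) ^ 2 * energy g μ
      + 2 * (N : ℝ) * ((∫ z, zeta g μ z ∂(pointMeasure q x)) - (N : ℝ) * ∫ z, zeta g μ z ∂μ)
      - offDiagonalEnergy (fun i => (q i : ℝ)) x (chargeMeasure ((N : ℝ≥0∞) • μ)) := by
  have := isFiniteMeasure_natCast_smul (N := N) (m := μ)
  have e1 : ∀ y, pot (chargeMeasure ((N : ℝ≥0∞) • μ)) y = N * potential μ y := fun y => by
    rw [pot_chargeMeasure hq, potential, integral_smul_measure]; simp [potential]
  have e2 : interactionEnergy (chargeMeasure ((N : ℝ≥0∞) • μ)) (chargeMeasure ((N : ℝ≥0∞) • μ))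
      = (N : ℝ) ^ 2 * crossEnergy μ μ := by
    rw [interactionEnergy_chargeMeasure hq, crossEnergy_smul_left, crossEnergy_comm,
      crossEnergy_smul_left]
    simp; ring
  have e3 : energy g μ = (∫ z, confinement g z ∂μ) - crossEnergy μ μ := rfl
  -- Since `∫ ζ dμ` is half the confinement energy minus `crossEnergy μ μ`, all terms in `N ^ 2`
  -- cancel. The cross terms with the potential cancel as well, which is why `ζ` is the right linear
  -- term.
  rw [offDiagonalEnergy, e2, (integral_zeta hμ.1 hμ.interact).2, e3,
    integral_pointMeasure q x (measurable_zeta hg).stronglyMeasurable, hamiltonian]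
  simp_rw [e1, zeta]
  have e4 : ∑ i, ((q i : ℝ) * g (q i) / 2 * ‖x i‖ ^ 2 - (q i : ℝ) * potential μ (x i)) =
      (∑ i, (q i : ℝ) * g (q i) * ‖x i‖ ^ 2) / 2 - ∑ i, (q i : ℝ) * potential μ (x i) := by
    rw [Finset.sum_sub_distrib, Finset.sum_div]
    congr 1
    exact Finset.sum_congr rfl fun i _ => by ring
  have e5 : ∑ i, (q i : ℝ) * (N * potential μ (x i)) = N * ∑ i, (q i : ℝ) * potential μ (x i) := by
    rw [Finset.mul_sum]
    exact Finset.sum_congr rfl fun i _ => by ring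
  rw [e4, e5]
  ring

lemma chargeMeasure_smul_real_univ [IsFiniteMeasure μ] (hq : 0 < qmin) (h : μ.map Prod.fst = ν) :
    (chargeMeasure ((N : ℝ≥0∞) • μ)).real Set.univ = N * ∫ t, (t : ℝ) ∂ν := by
  rw [chargeMeasure_real_univ hq, integral_smul_measure, ← h, integral_map
    measurable_fst.aemeasurable (Measurable.aestronglyMeasurable (by fun_prop))]
  simp

/-- The renormalized energy of the rescaled field. -/
lemma exists_renormalizedEnergy_rescaled [IsProbabilityMeasure ν] (hd : 2 ≤ d) (hq : 0 < qmin)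
    (hg : Measurable g) {a b : ℝ} (ha : 0 < a) (hga : ∀ t, a ≤ g t) (hgb : ∀ t, g t ≤ b)
    (hμ : IsEnergyMinimizer g ν μ) (hN : 1 ≤ N) (q : Fin N → Charge qmin qmax) {x : Fin N → Pos d}
    (hx : Function.Injective x)
    (hneutral : d = 2 → ∑ i, (q i : ℝ) = (N : ℝ) * ∫ t, (t : ℝ) ∂ν) :
    ∃ F, IsWeakGradient (rescaledPotential μ q x) F ∧
      HasRenormalizedEnergy q (blowUp x) F (fun _ => 1)
        (-(kd d * (1 / blowUpFactor d N ^ (d - 2) *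
            offDiagonalEnergy (fun i => (q i : ℝ)) x (chargeMeasure ((N : ℝ≥0∞) • μ))
          - if d = 2 then Real.log N / 2 * ∑ i, (q i : ℝ) ^ 2 else 0))) := by
  have := isProbabilityMeasure_of_map_fst hμ.1
  have := isFiniteMeasure_natCast_smul (N := N) (m := μ)
  obtain ⟨R, hR, hμR⟩ := exists_minimizer_support_bound hd hq hg ha hga hgb hμ
  have hl : 0 < blowUpFactor d N := blowUpFactor_pos hN
  set l := blowUpFactor d N with hldef
  set β := chargeMeasure ((N : ℝ≥0∞) • μ) with hβdef
  have hI : Interact ((N : ℝ≥0∞) • μ) ((N : ℝ≥0∞) • μ) :=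
    ((hμ.2.1.interact.smul_left (ENNReal.natCast_ne_top N)).symm).smul_left
      (ENNReal.natCast_ne_top N)
  have hne : ∀ᵐ z ∂(β.prod β), z.1 ≠ z.2 := ae_ne_chargeMeasure_prod hI
  have hi : Integrable (fun z => W d ‖z.1 - z.2‖) (β.prod β) :=
    integrable_W_chargeMeasure_prod hq hI
  have hpot : ∀ y, Integrable (fun b => W d ‖y - b‖) β := fun y =>
    integrable_chargeMeasure hq (stronglyMeasurable_W_sub_left y)
      ((integrable_potential_minimizer hd hq hg ha hga hgb hμ y).smul_measure
        (ENNReal.natCast_ne_top N))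
  have hpne : ∀ y, ∀ᵐ b ∂β, y ≠ b := fun y =>
    ae_chargeMeasure (measurableSet_pos_ne y)
      (Measure.ae_smul_measure (ae_ne_of_interact hμ.2.1.interact y) _)
  have hβR : ∀ᵐ b ∂β, ‖b‖ ≤ R :=
    ae_chargeMeasure (measurableSet_le measurable_norm measurable_const)
      (Measure.ae_smul_measure hμR _)
  have hmass : β.real Set.univ = N * ∫ t, (t : ℝ) ∂ν := chargeMeasure_smul_real_univ hq hμ.1
  -- Every point is the dilation of another one, so finiteness of the potential everywhere survives
  -- the blow-up.
  have hinv : ∀ y : Pos d, l • (l⁻¹ • y) = y := fun y => smul_inv_smul₀ hl.ne' y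
  have hpot' : ∀ y, Integrable (fun b => W d ‖y - b‖) (dilate l β) := fun y => by
    have := (pot_dilate hd hl (hpot (l⁻¹ • y)) (hpne _)).1
    rwa [hinv] at this
  have hpne' : ∀ y, ∀ᵐ b ∂(dilate l β), y ≠ b := fun y => by
    rw [dilate, ae_map_iff (by fun_prop) (measurableSet_pos_ne y)]
    filter_upwards [hpne (l⁻¹ • y)] with b hb h
    exact hb (by rw [h, inv_smul_smul₀ hl.ne'])
  -- One radius for both the dilated background and the dilated particles.
  set R' := l * (R + ∑ i, ‖x i‖) with hR'
  have hS : 0 ≤ ∑ i, ‖x i‖ := Finset.sum_nonneg fun _ _ => norm_nonneg _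
  have hβR' : ∀ᵐ b ∂(dilate l β), ‖b‖ ≤ R' := by
    rw [dilate, ae_map_iff (by fun_prop) (measurableSet_le measurable_norm measurable_const)]
    filter_upwards [hβR] with b hb
    rw [norm_smul, Real.norm_of_nonneg hl.le]
    exact mul_le_mul_of_nonneg_left (by linarith) hl.le
  have hpR : ∀ i, ‖blowUp x i‖ ≤ R' := fun i => by
    have := Finset.single_le_sum (f := fun i => ‖x i‖) (fun _ _ => norm_nonneg _) (Finset.mem_univ i)
    rw [blowUp, norm_smul]
    change ‖l‖ * _ ≤ _
    rw [Real.norm_of_nonneg hl.le]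
    exact mul_le_mul_of_nonneg_left (by linarith) hl.le
  have hp : Function.Injective (blowUp x) := (smul_right_injective _ hl.ne').comp hx
  refine ⟨_, isWeakGradient_rescaledPotential hd hq q x hβR' hpR, ?_⟩
  have h := hasRenormalizedEnergy_particleField (q := q) hd (by positivity) hp hpR hβR'
    (ae_ne_dilate_prod hl hne) (interactionEnergy_dilate hd hl hne hi).1 hpot' hpne'
    (fun h2 => by rw [dilate_real_univ, hmass, hneutral h2])
  convert h using 3
  change _ = offDiagonalEnergy (fun i => (q i : ℝ)) (fun i => l • x i) (dilate l β)
  rw [offDiagonalEnergy_dilate hd hl _ hx hne hi hpot hpne, hmass]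
  split_ifs with h2
  -- Neutrality cancels the squared total charge, and `l = N ^ (1 / 2)` turns `log l` into `log N /
  -- 2`.
  · rw [hneutral h2, hldef, blowUpFactor, Real.log_rpow (by exact_mod_cast hN)]
    subst h2
    push_cast
    ring
  · ring

end

end HetGas
end

/-! ### The scaling theorem. -/

theorem mainTheorem4 (d : ℕ) (hd : 2 ≤ d) (qmin qmax : ℝ) (hq : 0 < qmin)
    (g : HetGas.Charge qmin qmax → ℝ) (hg : Measurable g)
    (hg_bdd : ∃ a b : ℝ, 0 < a ∧ ∀ t, a ≤ g t ∧ g t ≤ b)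
    (ν : MeasureTheory.Measure (HetGas.Charge qmin qmax))
    [MeasureTheory.IsProbabilityMeasure ν]
    (μ : MeasureTheory.Measure (HetGas.Charge qmin qmax × HetGas.Pos d))
    (hμ : HetGas.IsEnergyMinimizer g ν μ)
    (N : ℕ) (hN : 1 ≤ N)
    (q : Fin N → HetGas.Charge qmin qmax) (x : Fin N → HetGas.Pos d)
    (hx : Function.Injective x)
    (hneutral : d = 2 → ∑ i, (q i : ℝ) = (N : ℝ) * ∫ t, (t : ℝ) ∂ν) :
    -- the potentials that occur are given by convergent integrals
    (∀ y : HetGas.Pos d, MeasureTheory.Integrable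
      (fun z : HetGas.Charge qmin qmax × HetGas.Pos d => (z.1 : ℝ) * HetGas.W d ‖y - z.2‖) μ) ∧
    MeasureTheory.Integrable (HetGas.zeta g μ) μ ∧
    -- the gradient of the rescaled potential exists, and the rescaled splitting formula holds
    (∃ F, HetGas.IsWeakGradient (HetGas.rescaledPotential μ q x) F) ∧
    (∀ F, HetGas.IsWeakGradient (HetGas.rescaledPotential μ q x) F →
      ∃ L : ℝ, HetGas.HasRenormalizedEnergy q (HetGas.blowUp x) F (fun _ => 1) L ∧
        (d = 2 → HetGas.hamiltonian g q x =
          (N : ℝ) ^ 2 * HetGas.energy g μ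
            + 2 * (N : ℝ) * ((∫ z, HetGas.zeta g μ z ∂(HetGas.pointMeasure q x))
                - (N : ℝ) * ∫ z, HetGas.zeta g μ z ∂μ)
            + 1 / HetGas.kd d * L
            - Real.log N / 2 * ∑ i, (q i : ℝ) ^ 2) ∧
        (3 ≤ d → HetGas.hamiltonian g q x =
          (N : ℝ) ^ 2 * HetGas.energy g μ
            + 2 * (N : ℝ) * ((∫ z, HetGas.zeta g μ z ∂(HetGas.pointMeasure q x))
                - (N : ℝ) * ∫ z, HetGas.zeta g μ z ∂μ)
            + (N : ℝ) ^ (1 - 2 / (d : ℝ)) / HetGas.kd d * L)) ∧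
    -- `ζ`, normalized by a function of the charge, vanishes on the equilibrium measure, and
    -- then only its integral against the particles remains
    (∃ c : HetGas.Charge qmin qmax → ℝ, Measurable c ∧ MeasureTheory.Integrable c ν ∧
      (∀ᵐ z ∂μ, HetGas.zeta g μ z - c z.1 = 0) ∧
      ((∫ z, HetGas.zeta g μ z ∂(HetGas.pointMeasure q x)) - (N : ℝ) * ∫ z, HetGas.zeta g μ z ∂μ
        = (∫ z, (HetGas.zeta g μ z - c z.1) ∂(HetGas.pointMeasure q x))
          + (∑ i, c (q i) - (N : ℝ) * ∫ t, c t ∂ν)) ∧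
      ((N : ENNReal) • ν = ∑ i, MeasureTheory.Measure.dirac (q i) →
        (∫ z, HetGas.zeta g μ z ∂(HetGas.pointMeasure q x)) - (N : ℝ) * ∫ z, HetGas.zeta g μ z ∂μ
          = ∫ z, (HetGas.zeta g μ z - c z.1) ∂(HetGas.pointMeasure q x))) := by
  obtain ⟨a, b, ha, hab⟩ := hg_bdd
  have hga := fun t => (hab t).1
  have hgb := fun t => (hab t).2
  have := HetGas.isProbabilityMeasure_of_map_fst hμ.1
  have hζ := HetGas.integral_zeta hμ.2.1.1 hμ.2.1.interact
  have hζm : StronglyMeasurable (HetGas.zeta g μ) := (HetGas.measurable_zeta hg).stronglyMeasurable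
  refine ⟨HetGas.integrable_potential_minimizer hd hq hg ha hga hgb hμ, hζ.1, ?_, ?_, ?_⟩
  · obtain ⟨F, hF, -⟩ :=
      HetGas.exists_renormalizedEnergy_rescaled hd hq hg ha hga hgb hμ hN q hx hneutral
    exact ⟨F, hF⟩
  · intro F hF
    obtain ⟨G, hG, hE⟩ :=
      HetGas.exists_renormalizedEnergy_rescaled hd hq hg ha hga hgb hμ hN q hx hneutral
    have hkd := (HetGas.kd_pos hd).ne'
    have hH := HetGas.hamiltonian_eq hq hg hμ.2.1 q x
    -- The energy is known for the explicit field `G`; an arbitrary weak gradient `F` agrees with it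
    -- almost everywhere and therefore has the same one.
    refine ⟨_, hE.congr_ae (hG.ae_eq hF), fun h2 => ?_, fun h3 => ?_⟩
    · subst h2
      rw [hH, if_pos rfl]
      field_simp
      ring
    · have hpow : (N : ℝ) ^ (1 - 2 / (d : ℝ)) ≠ 0 :=
        (Real.rpow_pos_of_pos (by exact_mod_cast hN) _).ne'
      rw [hH, if_neg (by omega), HetGas.blowUpFactor_pow hd hN]
      field_simp
      ring
  · obtain ⟨c, hc, hci, hcz⟩ := HetGas.exists_zeta_eq_charge hg hμ
    have hμc : ∫ z, HetGas.zeta g μ z ∂μ = ∫ t, c t ∂ν := by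
      rw [integral_congr_ae hcz, ← hμ.1, integral_map measurable_fst.aemeasurable
        hc.aestronglyMeasurable]
    have hsum := HetGas.integral_pointMeasure q x hζm
    have hdiff := HetGas.integral_pointMeasure q x
      (hζm.sub (hc.comp measurable_fst).stronglyMeasurable)
    simp only [Pi.sub_apply, Function.comp_apply, Finset.sum_sub_distrib] at hdiff
    refine ⟨c, hc, hci, hcz.mono fun z hz => by rw [hz, sub_self], ?_, fun hν => ?_⟩
    · rw [hsum, hdiff, hμc]; ring
    -- If the charge marginal is the empirical one, integrating `c` against both sides makes the
    -- correction in `c` vanish.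
    · have hN' : (N : ℝ) * ∫ t, c t ∂ν = ∑ i, c (q i) := by
        have h1 : ∫ t, c t ∂((N : ℝ≥0∞) • ν) = (N : ℝ) * ∫ t, c t ∂ν := by
          rw [integral_smul_measure]; simp
        rw [← h1, hν, integral_finsetSum_measure fun i _ =>
          integrable_dirac' hc.stronglyMeasurable enorm_lt_top]
        exact Finset.sum_congr rfl fun i _ => integral_dirac' _ _ hc.stronglyMeasurable
      rw [hsum, hdiff, hμc, hN']
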